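/- **Setting.** Let $Q:\mathbb C\to\mathbb R$ be $C^2$-smooth with $\liminf_{|z|\to\infty}Q(z)/\log|z|>1$, let $0<\tau\le 1$, let $\check Q$ be the supremum of all subharmonic $u\le Q$ on $\mathbb C$ with $u(z)\le\tau\log|z|+O(1)$ at infinity, let $\mathcal S=\{\check Q=Q\}$, let $\Omega$ be the unbounded component of $\mathbb C\setminus\mathcal S$, and $\Gamma=\partial\Omega$. Assume that $\mathcal S$ is connected, that $\Gamma$ is a real-analytically smooth Jordan curve, and that $Q$ is real-analytic and strictly subharmonic near $\Gamma$. Let $\phi:\Omega\to\{|\zeta|>1\}$ be the conformal bijection with $\phi(\infty)=\infty$, $\phi'(\infty)>0$, continued conformally across $\Gamma$ to a neighbourhood $U$ of $\overline\Omega$; let $\breve Q$ be the harmonic continuation of $\check Q|_\Omega$ to $U$ ($U$ being close enough to $\overline\Omega$), and let $V$ be the $C^2$-smooth square root of $Q-\breve Q$ on $U$ that is positive on $\Omega$ and negative on $U\setminus\overline\Omega$. Write $\partial,\bar\partial$ for the Wirtinger derivatives, $\Delta=\partial\bar\partial$, and $\mathbf P_\Omega$ for the Poisson extension from $\Gamma$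 to $\Omega$, continued harmonically across $\Gamma$. Quotients by $V$ are extended by continuity across $\Gamma$. For $\vartheta\in\mathbb C$ put $$L=2|\partial V|^2\frac{\log|\phi|}{V}+\frac\vartheta2\Delta\frac{\log|\phi|}{V},$$ $$\mathbf S[f]=\partial V\,\bar\partial f+\bar\partial V\,\partial f+f\Delta V+|\partial V|^2\frac{(\mathbf P_\Omega-\mathbf I)f}{V}+\frac\vartheta4\Delta\frac{(\mathbf P_\Omega-\mathbf I)f}{V},$$ $$\mathbf T[f]=\frac1{4V|\partial V|^2}\Big\{L+\vartheta\mathbf S[f]-\exp\big(\mathbf P_\Omega[\log(L+\vartheta\mathbf S[f])]\big)\Big\},$$ where $\log$ is the principal branch. For $0<\sigma<1$ let $\rho(\sigma)=(\sigma+\sqrt{1+\sigma^2})^{-1}$, $\mathbb A_\sigma=\{\rho(\sigma)<|\zeta|<\rho(\sigma)^{-1}\}$ and $\hat{\mathbb A}(\sigma)=\{(z,w)\in\mathbb A_\sigma^2:|z-w|<2\sigma\}$. The space $\mathscr H^\infty_\sigma(\Gamma)$ consists of the functions $f$ on $\phi^{-1}(\mathbb A_\sigma)$ for which $f\circ\phi^{-1}$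 has a bounded Hermitian-analytic polarization $f_\phi$ on $\hat{\mathbb A}(\sigma)$ (that is, $f_\phi(z,w)$ is holomorphic in $(z,\bar w)$ and $f_\phi(z,z)=f(\phi^{-1}(z))$), with norm $\|f\|_\sigma=\sup_{\hat{\mathbb A}(\sigma)}|f_\phi|$. Let $\|\mathbf P_\Omega\|_{\sigma\to\sigma}$ be the operator norm of $\mathbf P_\Omega$ on this space. For $\sigma^*\in(0,1)$, $\epsilon_0>0$, $C_0>0$ put $$M_0(\sigma,\sigma',\vartheta)=C_0\Big(\frac1{(\sigma-\sigma')\sigma'}+\frac{|\vartheta|}{(\sigma-\sigma')^3\sigma'}\Big),\qquad r_0=2\sup_{|\vartheta|\le\epsilon_0}\|\mathbf T[0]\|_{\sigma^*},\qquad \Lambda(\sigma)=\sup_{|\vartheta|\le\epsilon_0}\|1/L\|_\sigma,$$ $$m_1(\sigma,\sigma',\vartheta)=\max\Big\{\epsilon_0^{-1},\;4M_0(\sigma,\sigma',\vartheta)\Lambda(\sigma')r_0,\;2\|\mathbf P_\Omega\|_{\sigma'\to\sigma'}M_0(\sigma,\sigma',\vartheta)\Lambda(\sigma')r_0\Big\}.$$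 **Theorem 8.5.** There exist $\sigma^*\in(0,1)$, $\epsilon_0>0$ and $B$, depending only on $(\Omega,\phi,V)$, for which the following holds. (a) $\phi^{-1}$ is conformal on $\rho(\sigma^*)\le|\zeta|\le\rho(\sigma^*)^{-1}$. For all $0<\sigma\le\sigma^*$ and $|\vartheta|\le\epsilon_0$ the functions $|\partial V|^{-2}$, $(1-|\phi|^2)/V$, $1/L$, $\mathbf T[0]$ and $\mathbf P_\Omega[\log L]$ belong to $\mathscr H^\infty_\sigma(\Gamma)$ with norms at most $B$, and $\mathbf P_\Omega$ maps $\mathscr H^\infty_\sigma(\Gamma)$ to itself with norm at most $B/\sigma$. (b) There is a constant $C_0>0$, depending only on $(\Omega,\phi,V)$, such that for all $0<\sigma'<\sigma\le\sigma^*$ and all $\vartheta\in\mathbb C$ the operator $\mathbf S$ maps $\mathscr H^\infty_\sigma(\Gamma)$ into $\mathscr H^\infty_{\sigma'}(\Gamma)$ with norm at most $M_0(\sigma,\sigma',\vartheta)$. (c) For each $C_0$ as in (b) there is $C_1>0$, depending only on $C_0$ and $(\Omega,\phi,V)$, such that the following holds. Let $0<\sigma'<\sigma\le\sigma^*$ and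 $\sigma''=\frac12(\sigma+\sigma')$, and let $\vartheta\in\mathbb C$ satisfy $|\vartheta|\le 1/m_1(\sigma,\sigma'',\vartheta)$. Then for all $f,g\in\mathscr H^\infty_\sigma(\Gamma)$ with $\|f\|_\sigma,\|g\|_\sigma\le r_0$, we have $\mathbf T[f],\mathbf T[g]\in\mathscr H^\infty_{\sigma'}(\Gamma)$ and $$\|\mathbf T[f]-\mathbf T[g]\|_{\sigma'}\le C(\sigma,\sigma')\,M_0(\sigma,\sigma'',\vartheta)\,|\vartheta|\,\|f-g\|_\sigma,$$ where $$C(\sigma,\sigma')=\frac{3\,\||\partial V|^{-2}\|_{\sigma'}\,\|(1-|\phi|^2)/V\|_{\sigma'}}{2(\sigma-\sigma')}\Big(1+6\,\|\mathbf P_\Omega\|_{\sigma''\to\sigma''}\,\Lambda(\sigma'')\,\exp\big(\|\mathbf P_\Omega[\log L]\|_\sigma\big)\Big).$$ Moreover, for all such $\sigma,\sigma',\vartheta$, $$C(\sigma,\sigma')\,M_0(\sigma,\sigma'',\vartheta)\le C_1\Big(\frac1{(\sigma')^2(\sigma-\sigma')^2}+\frac{|\vartheta|}{(\sigma')^2(\sigma-\sigma')^4}\Big).$$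 -/

import Mathlib

open Filter Topology

noncomputable section

namespace PlanarOP

/-! ### The droplet, the exterior conformal map and the function `V` -/

/-- A finite-valued subharmonic function on the plane: upper semicontinuous, with the sub-mean
value property on every circle. -/
def IsSubharmonic (u : ℂ → ℝ) : Prop :=
  UpperSemicontinuous u ∧
    ∀ (z : ℂ) (r : ℝ), 0 < r → CircleIntegrable u z r ∧ u z ≤ Real.circleAverage u z r

/-- The class of subharmonic functions growing at most like `τ log |z| + O(1)` at infinity. (Only
finite-valued functions are used. Replacing `u` by `max u (-N)`, with `N` large, shows that this
does not change the envelope below when `Q` is bounded from below and `τ > 0`.) -/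
def IsSubharmonicOfGrowth (τ : ℝ) (u : ℂ → ℝ) : Prop :=
  IsSubharmonic u ∧ ∃ c : ℝ, ∀ᶠ z in cocompact ℂ, u z ≤ τ * Real.log ‖z‖ + c

/-- The envelope: the supremum of the subharmonic functions `u ≤ Q` of growth at most
`τ log |z| + O(1)`. -/
def envelope (Q : ℂ → ℝ) (τ : ℝ) (z : ℂ) : ℝ :=
  sSup {y : ℝ | ∃ u : ℂ → ℝ, IsSubharmonicOfGrowth τ u ∧ (∀ w, u w ≤ Q w) ∧ y = u z}

/-- The coincidence set (droplet). -/
def droplet (Q : ℂ → ℝ) (τ : ℝ) : Set ℂ := {z | envelope Q τ z = Q z}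

/-- A real-analytically smooth simple closed curve. -/
def IsAnalyticJordanCurve (Γ : Set ℂ) : Prop :=
  ∃ γ : ℝ → ℂ, AnalyticOnNhd ℝ γ Set.univ ∧ Function.Periodic γ (2 * Real.pi) ∧
    (∀ t, deriv γ t ≠ 0) ∧ Set.InjOn γ (Set.Ico 0 (2 * Real.pi)) ∧ Set.range γ = Γ

/-- `Q` is an admissible potential for the parameter `τ`, and `Ω` is the unbounded component of
the complement of the droplet. -/
structure IsPotential (Q : ℂ → ℝ) (τ : ℝ) (Ω : Set ℂ) : Prop where
  tau_pos : 0 < τ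
  tau_le_one : τ ≤ 1
  contDiff : ContDiff ℝ 2 Q
  /-- the lower limit of `Q(z) / log |z|` at infinity exceeds `1` -/
  growth : ∃ c : ℝ, 1 < c ∧ ∀ᶠ z in cocompact ℂ, c * Real.log ‖z‖ ≤ Q z
  droplet_connected : IsConnected (droplet Q τ)
  component : ∃ z ∈ (droplet Q τ)ᶜ, Ω = connectedComponentIn (droplet Q τ)ᶜ z
  unbounded : ¬ Bornology.IsBounded Ω
  boundary_analytic : IsAnalyticJordanCurve (frontier Ω)
  /-- near the outer boundary `Q` is real-analytic and strictly subharmonic -/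
  strictly_subharmonic : ∃ W : Set ℂ, IsOpen W ∧ frontier Ω ⊆ W ∧ AnalyticOnNhd ℝ Q W ∧
    ∀ z ∈ W, 0 < Laplacian.laplacian Q z

/-- `V` is the square root of `Q - Qb` on the fattened exterior domain `U`, positive outside the
boundary curve and negative inside it, where `Qb` is the harmonic continuation to `U` of the
restriction of the envelope to `Ω`. -/
structure IsSquareRoot (Q : ℂ → ℝ) (τ : ℝ) (Ω U : Set ℂ) (V : ℂ → ℝ) (Qb : ℂ → ℝ) : Prop where
  harmonic : InnerProductSpace.HarmonicOnNhd Qb U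
  eq_envelope : ∀ z ∈ Ω, Qb z = envelope Q τ z
  contDiffOn : ContDiffOn ℝ 2 V U
  sq_eq : ∀ z ∈ U, V z ^ 2 = Q z - Qb z
  pos : ∀ z ∈ Ω, 0 < V z
  neg : ∀ z ∈ U \ closure Ω, V z < 0

/-- The exterior domain `Ω`, with boundary `Γ = frontier Ω`; its conformal map `φ` onto the
exterior disk, fixing infinity with positive derivative there, and continued conformally to an
open neighbourhood `U` of the closure of `Ω`; and the square root `V`. The potential behind these
objects enters only through its existence. -/
structure ExteriorData where
  Ω : Set ℂ
  U : Set ℂ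
  φ : ℂ → ℂ
  V : ℂ → ℝ
  isOpen_U : IsOpen U
  closure_subset : closure Ω ⊆ U
  differentiableOn : DifferentiableOn ℂ φ U
  injOn : Set.InjOn φ U
  image_eq : φ '' Ω = {ζ | 1 < ‖ζ‖}
  normalized : ∃ c : ℝ, 0 < c ∧ Tendsto (fun z => φ z / z) (cocompact ℂ) (𝓝 (c : ℂ))
  exists_potential : ∃ (Q : ℂ → ℝ) (τ : ℝ) (Qb : ℂ → ℝ),
    IsPotential Q τ Ω ∧ IsSquareRoot Q τ Ω U V Qb

/-! ### Wirtinger derivatives -/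

/-- The Wirtinger derivative `∂`. -/
def dz (f : ℂ → ℂ) (z : ℂ) : ℂ := (fderiv ℝ f z 1 - Complex.I * fderiv ℝ f z Complex.I) / 2

/-- The Wirtinger derivative `∂bar`. -/
def dzbar (f : ℂ → ℂ) (z : ℂ) : ℂ := (fderiv ℝ f z 1 + Complex.I * fderiv ℝ f z Complex.I) / 2

/-- The quarter Laplacian `∂ ∂bar`. -/
def qLap (f : ℂ → ℂ) : ℂ → ℂ := dz (dzbar f)

/-! ### The scale of spaces -/

/-- `ρ(σ) = 1 / (σ + √(1 + σ²))`. -/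
def rho (σ : ℝ) : ℝ := 1 / (σ + √(1 + σ ^ 2))

/-- The (open) annulus `ρ(σ) < |ζ| < ρ(σ)⁻¹`. -/
def annulus (σ : ℝ) : Set ℂ := {ζ | rho σ < ‖ζ‖ ∧ ‖ζ‖ < (rho σ)⁻¹}

/-- The (open) `2σ`-fattened diagonal annulus in `ℂ²`. -/
def fatAnnulus (σ : ℝ) : Set (ℂ × ℂ) :=
  {p | p.1 ∈ annulus σ ∧ p.2 ∈ annulus σ ∧ ‖p.1 - p.2‖ < 2 * σ}

namespace ExteriorData

variable (D : ExteriorData)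

/-- The inverse `φ⁻¹` of the (continued) conformal map. -/
def psi : ℂ → ℂ := Function.invFunOn D.φ D.U

/-- `F` is the Hermitian-analytic polarization of `f ∘ φ⁻¹` on the fattened diagonal annulus:
`F(z, w)` is holomorphic in `(z, conj w)`, and `F(z, z) = f(φ⁻¹(z))`. -/
def IsPolarization (σ : ℝ) (f : ℂ → ℂ) (F : ℂ → ℂ → ℂ) : Prop :=
  DifferentiableOn ℂ (fun p : ℂ × ℂ => F p.1 (starRingEnd ℂ p.2))
      {p | (p.1, starRingEnd ℂ p.2) ∈ fatAnnulus σ} ∧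
    ∀ z ∈ annulus σ, F z z = f (D.psi z)

/-- Membership in the space `ℋ^∞_σ(Γ)`: the polarization exists and is bounded. (Only the values
of `f` on `φ⁻¹(annulus σ)` matter, and there `f` is automatically real-analytic.) -/
def MemH (σ : ℝ) (f : ℂ → ℂ) : Prop :=
  ∃ F, D.IsPolarization σ f F ∧ ∃ M : ℝ, ∀ p ∈ fatAnnulus σ, ‖F p.1 p.2‖ ≤ M

/-- The polarization `f_φ`, which is unique on the fattened diagonal annulus if it exists. -/
def polarization (σ : ℝ) (f : ℂ → ℂ) : ℂ → ℂ → ℂ := Classical.epsilon (D.IsPolarization σ f)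

/-- The norm `‖f‖_σ`. -/
def hNorm (σ : ℝ) (f : ℂ → ℂ) : ℝ :=
  sSup ((fun p : ℂ × ℂ => ‖D.polarization σ f p.1 p.2‖) '' fatAnnulus σ)

/-- Norm on `ℋ^∞_σ(Γ)` of an operator from this space to itself. -/
def opNorm (σ : ℝ) (A : (ℂ → ℂ) → ℂ → ℂ) : ℝ :=
  sSup {y : ℝ | ∃ f, D.MemH σ f ∧ D.hNorm σ f ≤ 1 ∧ y = D.hNorm σ (A f)}

/-! ### The operators -/

/-- Poisson extension to the exterior disk of a function on the unit circle. -/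
def _root_.PlanarOP.poissonExt (g : ℂ → ℂ) (ζ : ℂ) : ℂ :=
  Real.circleAverage (fun η => ((‖ζ‖ ^ 2 - 1) / ‖η - ζ‖ ^ 2 : ℝ) • g η) 0 1

/-- The Poisson extension operator `P_Ω`. On `Ω` it is the Poisson integral, written in the
coordinate `φ`. At points on or inside the boundary curve its value is the one given by the
harmonic continuation, in the coordinate `φ`, to an annular region `r < |ζ|` (the value does not
depend on the choice of `r`). -/
def P (f : ℂ → ℂ) (z : ℂ) : ℂ :=
  open Classical in
  if 1 < ‖D.φ z‖ then poissonExt (f ∘ D.psi) (D.φ z)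
  else Classical.epsilon fun y : ℂ => ∃ (r : ℝ) (u : ℂ → ℂ), r < ‖D.φ z‖ ∧
    InnerProductSpace.HarmonicOnNhd u {ζ | r < ‖ζ‖} ∧
    (∀ ζ, 1 < ‖ζ‖ → u ζ = poissonExt (f ∘ D.psi) ζ) ∧ y = u (D.φ z)

/-- `V` as a complex-valued function. -/
def Vc (z : ℂ) : ℂ := (D.V z : ℂ)

/-- `|∂V|²`. -/
def gradSq (z : ℂ) : ℂ := ((‖dz D.Vc z‖ ^ 2 : ℝ) : ℂ)

/-- The quotient `u / V`, extended by continuity across the zero set of `V`. -/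
def divV (u : ℂ → ℂ) : ℂ → ℂ := extendFrom {z | D.V z ≠ 0} (fun z => u z / D.Vc z)

/-- `log |φ| / V`. -/
def logPhiDivV : ℂ → ℂ := D.divV fun z => (Real.log ‖D.φ z‖ : ℂ)

/-- `(1 - |φ|²) / V`. -/
def defDivV : ℂ → ℂ := D.divV fun z => ((1 - ‖D.φ z‖ ^ 2 : ℝ) : ℂ)

/-- The function `L = 2 |∂V|² log|φ| / V + (ϑ/2) Δ (log|φ| / V)`. -/
def L (θ : ℂ) (z : ℂ) : ℂ :=
  2 * D.gradSq z * D.logPhiDivV z + θ / 2 * qLap D.logPhiDivV z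

/-- The linear operator
`S[f] = ∂V ∂bar f + ∂bar V ∂f + f ΔV + |∂V|² (P - I)f / V + (ϑ/4) Δ ((P - I)f / V)`. -/
def S (θ : ℂ) (f : ℂ → ℂ) (z : ℂ) : ℂ :=
  dz D.Vc z * dzbar f z + dzbar D.Vc z * dz f z + f z * qLap D.Vc z
    + D.gradSq z * D.divV (D.P f - f) z + θ / 4 * qLap (D.divV (D.P f - f)) z

/-- The nonlinear operator
`T[f] = (4 V |∂V|²)⁻¹ (L + ϑ S[f] - exp (P [log (L + ϑ S[f])]))`. -/
def T (θ : ℂ) (f : ℂ → ℂ) (z : ℂ) : ℂ :=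
  D.divV (fun w => D.L θ w + θ * D.S θ f w
      - Complex.exp (D.P (fun v => Complex.log (D.L θ v + θ * D.S θ f v)) w)) z
    / (4 * D.gradSq z)

/-- `P_Ω[log L]`. -/
def PlogL (θ : ℂ) : ℂ → ℂ := D.P fun v => Complex.log (D.L θ v)

/-! ### Constants -/

/-- The supremum of `‖1/L‖_σ` over `|ϑ| ≤ ε₀`. -/
def supInvL (ε₀ σ : ℝ) : ℝ :=
  sSup ((fun θ : ℂ => D.hNorm σ fun z => (D.L θ z)⁻¹) '' Metric.closedBall 0 ε₀)

/-- The radius `r₀`, twice the supremum of `‖T[0]‖_{σ*}` over `|ϑ| ≤ ε₀`. -/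
def r0 (σs ε₀ : ℝ) : ℝ :=
  2 * sSup ((fun θ : ℂ => D.hNorm σs (D.T θ 0)) '' Metric.closedBall 0 ε₀)

/-- `M₀(σ, σ', ϑ) = C₀ (1 / ((σ - σ') σ') + |ϑ| / ((σ - σ')³ σ'))`. -/
def _root_.PlanarOP.M0 (C₀ σ σ' : ℝ) (θ : ℂ) : ℝ :=
  C₀ * (1 / ((σ - σ') * σ') + ‖θ‖ / ((σ - σ') ^ 3 * σ'))

/-- `C₀` is a constant for which `M₀(σ, σ', ϑ)` bounds the norm of the operator `S` from
`ℋ^∞_σ(Γ)` to `ℋ^∞_{σ'}(Γ)`, for all `0 < σ' < σ ≤ σ*` and all `ϑ`. -/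
def IsSBound (σs C₀ : ℝ) : Prop :=
  0 < C₀ ∧ ∀ σ σ' : ℝ, 0 < σ' → σ' < σ → σ ≤ σs → ∀ (θ : ℂ) (f : ℂ → ℂ), D.MemH σ f →
    D.MemH σ' (D.S θ f) ∧ D.hNorm σ' (D.S θ f) ≤ M0 C₀ σ σ' θ * D.hNorm σ f

/-- The threshold `m₁` attached to the pair of parameters `σ > s`. -/
def m1 (σs ε₀ C₀ σ s : ℝ) (θ : ℂ) : ℝ :=
  max (max ε₀⁻¹ (4 * M0 C₀ σ s θ * D.supInvL ε₀ s * D.r0 σs ε₀))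
    (2 * D.opNorm s D.P * M0 C₀ σ s θ * D.supInvL ε₀ s * D.r0 σs ε₀)

/-- The constant `C(σ, σ')`. -/
def lipConst (ε₀ σ σ' : ℝ) (θ : ℂ) : ℝ :=
  3 * D.hNorm σ' (fun z => (D.gradSq z)⁻¹) * D.hNorm σ' D.defDivV / (2 * (σ - σ')) *
    (1 + 6 * D.opNorm ((σ + σ') / 2) D.P * D.supInvL ε₀ ((σ + σ') / 2) *
      Real.exp (D.hNorm σ (D.PlogL θ)))

/-- `f` belongs to the closed ball of radius `M` in `ℋ^∞_σ(Γ)`. -/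
def InBall (σ M : ℝ) (f : ℂ → ℂ) : Prop := D.MemH σ f ∧ D.hNorm σ f ≤ M

/-- The parameters `σ*` and `ε₀` are small enough: `φ⁻¹` is conformal on the closed annulus
`ρ(σ*) ≤ |ζ| ≤ ρ(σ*)⁻¹`, and for `0 < σ ≤ σ*` and `|ϑ| ≤ ε₀` the functions that enter the
constants belong to `ℋ^∞_σ(Γ)`, with norms bounded by `B`, while `P_Ω` acts boundedly on this
space, with norm at most `B / σ`. -/
structure IsRange (σs ε₀ B : ℝ) : Prop where
  annulus_subset : {ζ : ℂ | rho σs ≤ ‖ζ‖ ∧ ‖ζ‖ ≤ (rho σs)⁻¹} ⊆ D.φ '' D.U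
  gradSq_inv : ∀ σ, 0 < σ → σ ≤ σs → D.InBall σ B fun z => (D.gradSq z)⁻¹
  defDivV : ∀ σ, 0 < σ → σ ≤ σs → D.InBall σ B D.defDivV
  L_inv : ∀ σ, 0 < σ → σ ≤ σs → ∀ θ : ℂ, ‖θ‖ ≤ ε₀ → D.InBall σ B fun z => (D.L θ z)⁻¹
  T_zero : ∀ σ, 0 < σ → σ ≤ σs → ∀ θ : ℂ, ‖θ‖ ≤ ε₀ → D.InBall σ B (D.T θ 0)
  PlogL : ∀ σ, 0 < σ → σ ≤ σs → ∀ θ : ℂ, ‖θ‖ ≤ ε₀ → D.InBall σ B (D.PlogL θ)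
  P_bound : ∀ σ, 0 < σ → σ ≤ σs → ∀ f, D.MemH σ f →
    D.InBall σ (B / σ * D.hNorm σ f) (D.P f)

end ExteriorData

end PlanarOP

end

/-! In the coordinate `φ` the curve is the unit circle, and a function of the scale is the
restriction to w = conj z of a holomorphic F(z, w) on `Dh σ`, a neighbourhood of the complexified
circle zw = 1. Every operation in `S` and `T` becomes an explicit operation on F, and F is
determined by its restriction (`eq_zero_of_antidiag`), so all estimates can be made for
polarizations.

The dictionary: ∂ and ∂bar are the two partial derivatives, multiplied by φ' and its conjugate. The
Poisson extension sees F only on zw = 1: if F(z, 1/z) = g(z) + h(1/z) is a Laurent splitting, the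
extension has polarization h(1/z) + g(1/w) (`Pol.P`). Finally V = (zw - 1) k with k zero-free, so
dividing by V is dividing by 1 - zw, which is possible when the numerator vanishes on zw = 1
(`Pol.divV`). The factorization holds because V² = Q - Q̆ is real-analytic near the curve, vanishes
there to second order and has Laplacian ΔQ > 0. Hence V² = (1 - zw)² q with q > 0 on the circle, and
k is the square root of q (`exists_sq_factor`, `exists_pol_Vc`).

The prices: a derivative or a division by 1 - zw costs a factor 3/δ when the domain shrinks by δ
(`norm_pz_le`, `norm_quotient_le`), and the Poisson extension costs 4/σ (`exists_split`). The worst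
term of `S` has one extension, one division and two derivatives, which is the shape of `M0`
(`Model.norm_sPol_le`). The other constants are finite because the relevant functions are
holomorphic near a compact circle to which `Dh σ` shrinks (`exists_model`).

For the Lipschitz bound, write L + ϑS[f] = L(1 + x) with x = ϑS[f]/L. The real part of L is positive
and the threshold `m1` forces |x| ≤ 1/4, so the logarithm splits and exp(P log(L + ϑS[f])) = exp(P
log L) exp(P log(1 + x)). The maps x ↦ log(1 + x) and exp are Lipschitz on the discs that occur, and
one more division by V finishes the estimate (`Model.T_sub_le`). -/

open Filter Topology

noncomputable section

namespace PlanarOP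

open Metric Set

/-! ### Holomorphic functions of two variables -/

/-- The Schwarz lemma used twice: on g it bounds the difference quotient by 2M/R, and on that
quotient, whose oscillation is at most 4M/R, it gives the quadratic remainder. The constant depends
only on M and R, so it is uniform in a second variable. -/
theorem norm_sub_sub_deriv_le {g : ℂ → ℂ} {c z : ℂ} {R M : ℝ}
    (hg : DifferentiableOn ℂ g (ball c R)) (hM : ∀ z ∈ ball c R, ‖g z‖ ≤ M) (hz : z ∈ ball c R) :
    ‖g z - g c - deriv g c * (z - c)‖ ≤ 4 * M / R ^ 2 * ‖z - c‖ ^ 2 := by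
  have hR : 0 < R := pos_of_mem_ball hz
  have hc : c ∈ ball c R := mem_ball_self hR
  have hd : DifferentiableOn ℂ (dslope g c) (ball c R) :=
    (Complex.differentiableOn_dslope (ball_mem_nhds c hR)).2 hg
  have h1 : ∀ z ∈ ball c R, ‖dslope g c z‖ ≤ 2 * M / R := fun z hz =>
    Complex.norm_dslope_le_div_of_mapsTo_ball hg (fun x hx => by
      rw [mem_closedBall, dist_eq_norm]
      linarith [norm_sub_le (g x) (g c), hM x hx, hM c hc]) hz
  have h2 := Complex.dist_le_div_mul_dist_of_mapsTo_ball (R₂ := 4 * M / R) hd (fun x hx => by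
      rw [mem_closedBall, dist_eq_norm]
      have := norm_sub_le (dslope g c x) (dslope g c c)
      have e : 4 * M / R = 2 * M / R + 2 * M / R := by ring
      linarith [h1 x hx, h1 c hc]) hz
  have h3 : g z - g c - deriv g c * (z - c) = (z - c) * (dslope g c z - dslope g c c) := by
    have := sub_smul_dslope g c z
    rw [smul_eq_mul] at this
    rw [dslope_same]
    linear_combination -this
  rw [h3, norm_mul, ← dist_eq_norm, ← dist_eq_norm]
  calc dist z c * dist (dslope g c z) (dslope g c c) ≤ dist z c * (4 * M / R / R * dist z c) := by
        gcongr
    _ = _ := by field_simp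

theorem norm_deriv_le_of_ball {g : ℂ → ℂ} {c : ℂ} {R M : ℝ} (hR : 0 < R)
    (hg : DifferentiableOn ℂ g (ball c R)) (hM : ∀ z ∈ ball c R, ‖g z‖ ≤ M) :
    ‖deriv g c‖ ≤ 2 * M / R := by
  refine Complex.norm_deriv_le_div_of_mapsTo_ball hg (fun x hx => ?_) hR
  rw [mem_closedBall, dist_eq_norm]
  linarith [norm_sub_le (g x) (g c), hM x hx, hM c (mem_ball_self hR)]

/-- The partial derivative in the first variable. -/
def pz (F : ℂ × ℂ → ℂ) (p : ℂ × ℂ) : ℂ := deriv (fun ζ => F (ζ, p.2)) p.1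

/-- The partial derivative in the second variable. -/
def pw (F : ℂ × ℂ → ℂ) (p : ℂ × ℂ) : ℂ := deriv (fun ω => F (p.1, ω)) p.2

/-- A bounded separately holomorphic function on a bidisc is holomorphic at the centre. -/
theorem hasFDerivAt_of_separately {F : ℂ × ℂ → ℂ} {p : ℂ × ℂ} {R M : ℝ} (hR : 0 < R)
    (h1 : ∀ w ∈ ball p.2 R, DifferentiableOn ℂ (fun z => F (z, w)) (ball p.1 R))
    (h2 : ∀ z ∈ ball p.1 R, DifferentiableOn ℂ (fun w => F (z, w)) (ball p.2 R))
    (hM : ∀ z ∈ ball p.1 R, ∀ w ∈ ball p.2 R, ‖F (z, w)‖ ≤ M) :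
    HasFDerivAt F (pz F p • ContinuousLinearMap.fst ℂ ℂ ℂ + pw F p • ContinuousLinearMap.snd ℂ ℂ ℂ)
      p := by
  obtain ⟨a, b⟩ := p
  simp only at h1 h2 hM
  have ha : a ∈ ball a R := mem_ball_self hR
  have hb : b ∈ ball b R := mem_ball_self hR
  have hM0 : 0 ≤ M := (norm_nonneg _).trans (hM a ha b hb)
  -- The z-derivative depends on w in a Lipschitz way: F(·, w) - F(·, b) is at most (2M/R)‖w - b‖ by
  -- the Schwarz lemma in w, and Cauchy's estimate in z adds a factor 2/R.
  have hlip : ∀ w ∈ ball b R, ‖deriv (fun z => F (z, w)) a - deriv (fun z => F (z, b)) a‖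
      ≤ 4 * M / R ^ 2 * ‖w - b‖ := by
    intro w hw
    have hd1 := (h1 w hw).differentiableAt (ball_mem_nhds a hR)
    have hd2 := (h1 b hb).differentiableAt (ball_mem_nhds a hR)
    rw [← deriv_fun_sub hd1 hd2]
    refine (norm_deriv_le_of_ball (M := 2 * M / R * ‖w - b‖) hR ((h1 w hw).sub (h1 b hb))
      fun z hz => ?_).trans_eq ?_
    · have := Complex.dist_le_div_mul_dist_of_mapsTo_ball (R₂ := 2 * M) (h2 z hz) (fun x hx => by
        rw [mem_closedBall, dist_eq_norm]
        linarith [norm_sub_le (F (z, x)) (F (z, b)), hM z hz x hx, hM z hz b hb]) hw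
      rwa [dist_eq_norm, dist_eq_norm] at this
    · field_simp; ring
  rw [hasFDerivAt_iff_isLittleO_nhds_zero]
  have hO : (fun h : ℂ × ℂ => F ((a, b) + h) - F (a, b)
      - (pz F (a, b) • ContinuousLinearMap.fst ℂ ℂ ℂ + pw F (a, b) • ContinuousLinearMap.snd ℂ ℂ ℂ) h)
      =O[𝓝 0] fun h => ‖h‖ ^ 2 := by
    refine Asymptotics.IsBigO.of_bound (12 * M / R ^ 2) ?_
    filter_upwards [ball_mem_nhds (0 : ℂ × ℂ) hR] with h hh
    obtain ⟨u, v⟩ := h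
    rw [mem_ball_zero_iff, Prod.norm_def, max_lt_iff] at hh
    have hu : a + u ∈ ball a R := by simpa using hh.1
    have hv : b + v ∈ ball b R := by simpa using hh.2
    have e1 := norm_sub_sub_deriv_le (h1 (b + v) hv) (fun z hz => hM z hz _ hv) hu
    have e2 := norm_sub_sub_deriv_le (h2 a ha) (fun w hw => hM a ha w hw) hv
    have e3 := hlip (b + v) hv
    simp only [add_sub_cancel_left] at e1 e2 e3
    have n1 : ‖u‖ ≤ ‖(u, v)‖ := norm_fst_le (u, v)
    have n2 : ‖v‖ ≤ ‖(u, v)‖ := norm_snd_le (u, v)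
    set N := ‖(u, v)‖
    -- Move in z at height b + v, then in w at the centre. The last term corrects for taking the
    -- z-derivative at b + v instead of b.
    have key : F ((a, b) + (u, v)) - F (a, b) - (pz F (a, b) • ContinuousLinearMap.fst ℂ ℂ ℂ
        + pw F (a, b) • ContinuousLinearMap.snd ℂ ℂ ℂ) (u, v)
        = (F (a + u, b + v) - F (a, b + v) - deriv (fun z => F (z, b + v)) a * u)
          + (F (a, b + v) - F (a, b) - deriv (fun w => F (a, w)) b * v)
          + (deriv (fun z => F (z, b + v)) a - deriv (fun z => F (z, b)) a) * u := by
      simp [pz, pw]; ring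
    rw [key]
    have c0 : 0 ≤ 4 * M / R ^ 2 := by positivity
    calc _ ≤ 4 * M / R ^ 2 * ‖u‖ ^ 2 + 4 * M / R ^ 2 * ‖v‖ ^ 2 + 4 * M / R ^ 2 * ‖v‖ * ‖u‖ := by
          refine (norm_add₃_le).trans (add_le_add (add_le_add e1 e2) ?_)
          rw [norm_mul]; gcongr
      _ ≤ 4 * M / R ^ 2 * N ^ 2 + 4 * M / R ^ 2 * N ^ 2 + 4 * M / R ^ 2 * N * N := by gcongr
      _ = _ := by rw [Real.norm_of_nonneg (by positivity)]; ring
  refine hO.trans_isLittleO ?_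
  have := Asymptotics.isLittleO_pow_id (𝕜 := ℝ) (n := 2) (by norm_num)
  exact (this.comp_tendsto (continuous_norm.tendsto' (0 : ℂ × ℂ) 0 norm_zero)).trans_isBigO
    (Asymptotics.isBigO_norm_left.2 (Asymptotics.isBigO_refl _ _))

theorem hasDerivAt_slice_fst {F : ℂ × ℂ → ℂ} {p : ℂ × ℂ} (h : DifferentiableAt ℂ F p) :
    HasDerivAt (fun ζ => F (ζ, p.2)) (fderiv ℂ F p (1, 0)) p.1 := by
  have := h.hasFDerivAt.comp_hasDerivAt p.1 ((hasDerivAt_id p.1).prodMk (hasDerivAt_const p.1 p.2))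
  exact this

theorem hasDerivAt_slice_snd {F : ℂ × ℂ → ℂ} {p : ℂ × ℂ} (h : DifferentiableAt ℂ F p) :
    HasDerivAt (fun ω => F (p.1, ω)) (fderiv ℂ F p (0, 1)) p.2 := by
  have := h.hasFDerivAt.comp_hasDerivAt p.2 ((hasDerivAt_const p.2 p.1).prodMk (hasDerivAt_id p.2))
  exact this

theorem pz_eq {F : ℂ × ℂ → ℂ} {p : ℂ × ℂ} (h : DifferentiableAt ℂ F p) :
    pz F p = fderiv ℂ F p (1, 0) := (hasDerivAt_slice_fst h).deriv

theorem pw_eq {F : ℂ × ℂ → ℂ} {p : ℂ × ℂ} (h : DifferentiableAt ℂ F p) :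
    pw F p = fderiv ℂ F p (0, 1) := (hasDerivAt_slice_snd h).deriv

theorem hasDerivAt_pz {F : ℂ × ℂ → ℂ} {p : ℂ × ℂ} (h : DifferentiableAt ℂ F p) :
    HasDerivAt (fun ζ => F (ζ, p.2)) (pz F p) p.1 := by
  rw [pz_eq h]; exact hasDerivAt_slice_fst h

theorem hasDerivAt_pw {F : ℂ × ℂ → ℂ} {p : ℂ × ℂ} (h : DifferentiableAt ℂ F p) :
    HasDerivAt (fun ω => F (p.1, ω)) (pw F p) p.2 := by
  rw [pw_eq h]; exact hasDerivAt_slice_snd h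

theorem fderiv_apply_eq {F : ℂ × ℂ → ℂ} {p : ℂ × ℂ} (h : DifferentiableAt ℂ F p) (u v : ℂ) :
    fderiv ℂ F p (u, v) = pz F p * u + pw F p * v := by
  rw [pz_eq h, pw_eq h]
  have : ((u, v) : ℂ × ℂ) = u • (1, 0) + v • (0, 1) := by simp
  rw [this, map_add, map_smul, map_smul]; simp [mul_comm]

/-- The exchange of the two variables. -/
theorem pw_swap (F : ℂ × ℂ → ℂ) (p : ℂ × ℂ) : pw F p = pz (F ∘ Prod.swap) p.swap := rfl

/-- Near a point of differentiability in an open set, a bidisc where `F` is bounded. -/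
theorem exists_bidisc {F : ℂ × ℂ → ℂ} {W : Set (ℂ × ℂ)} (hW : IsOpen W) (hF : ContinuousOn F W)
    {p : ℂ × ℂ} (hp : p ∈ W) :
    ∃ R > 0, ∃ M, (∀ z ∈ ball p.1 R, ∀ w ∈ ball p.2 R, (z, w) ∈ W ∧ ‖F (z, w)‖ ≤ M) := by
  have hc : ContinuousAt F p := hF.continuousAt (hW.mem_nhds hp)
  have h1 : ∀ᶠ q in 𝓝 p, q ∈ W ∧ ‖F q‖ < ‖F p‖ + 1 :=
    (show ∀ᶠ q in 𝓝 p, q ∈ W from hW.mem_nhds hp).and (hc.norm.eventually (gt_mem_nhds (by linarith)))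
  obtain ⟨R, hR, h⟩ := Metric.eventually_nhds_iff_ball.1 h1
  refine ⟨R, hR, ‖F p‖ + 1, fun z hz w hw => ?_⟩
  have : (z, w) ∈ ball p R := by
    rw [← ball_prod_same]; exact ⟨hz, hw⟩
  exact ⟨(h _ this).1, (h _ this).2.le⟩

/-- Partial derivatives of a holomorphic function are holomorphic. -/
theorem differentiableOn_pz {F : ℂ × ℂ → ℂ} {W : Set (ℂ × ℂ)} (hW : IsOpen W)
    (hF : DifferentiableOn ℂ F W) : DifferentiableOn ℂ (pz F) W := by
  intro p hp
  obtain ⟨R, hR, M, hB⟩ := exists_bidisc hW hF.continuousOn hp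
  have hd : ∀ z ∈ ball p.1 R, ∀ w ∈ ball p.2 R, DifferentiableAt ℂ F (z, w) := fun z hz w hw =>
    hF.differentiableAt (hW.mem_nhds (hB z hz w hw).1)
  have hs1 : ∀ w ∈ ball p.2 R, DifferentiableOn ℂ (fun z => F (z, w)) (ball p.1 R) := fun w hw z hz =>
    (hasDerivAt_pz (hd z hz w hw)).differentiableAt.differentiableWithinAt
  have hs2 : ∀ z ∈ ball p.1 R, DifferentiableOn ℂ (fun w => F (z, w)) (ball p.2 R) := fun z hz w hw =>
    (hasDerivAt_pw (hd z hz w hw)).differentiableAt.differentiableWithinAt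
  have hR2 : 0 < R / 2 := by positivity
  have hsub : ∀ c : ℂ, ∀ z ∈ ball c (R / 2), ball z (R / 2) ⊆ ball c R := fun c z hz =>
    ball_subset_ball' (by rw [mem_ball] at hz; linarith)
  have hss : ∀ c : ℂ, ball c (R / 2) ⊆ ball c R := fun c => ball_subset_ball (by linarith)
  refine (hasFDerivAt_of_separately (M := 4 * M / R) hR2 ?_ ?_ ?_).differentiableAt.differentiableWithinAt
  · intro w hw
    exact ((hs1 w (hss _ hw)).deriv isOpen_ball).mono (hss _)
  · intro z hz
    have hzR := hss _ hz
    -- Holomorphy of the z-derivative in w: it is a uniform limit of difference quotients in z, each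
    -- holomorphic in w. The offset n + 2 keeps every increment strictly below R/2.
    set ε : ℕ → ℂ := fun n => ((R / 2 / (n + 2) : ℝ) : ℂ)
    have hεpos : ∀ n : ℕ, 0 < R / 2 / (n + 2 : ℝ) := fun n => by positivity
    have hεn : ∀ n : ℕ, ‖ε n‖ = R / 2 / (n + 2) := fun n => by
      rw [Complex.norm_of_nonneg (hεpos n).le]
    have hεlt : ∀ n : ℕ, ‖ε n‖ < R / 2 := fun n => by
      rw [hεn]; exact div_lt_self hR2 (by have : (0 : ℝ) ≤ n := n.cast_nonneg; linarith)
    have hε0 : ∀ n, ε n ≠ 0 := fun n => by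
      rw [← norm_ne_zero_iff, hεn]; exact (hεpos n).ne'
    have hmem : ∀ n, z + ε n ∈ ball z (R / 2) := fun n => by
      simpa using hεlt n
    have hlim : Tendsto (fun n => ‖ε n‖) atTop (𝓝 0) := by
      simp_rw [hεn]
      exact Tendsto.div_atTop tendsto_const_nhds
        (tendsto_atTop_add_const_right _ _ tendsto_natCast_atTop_atTop)
    have hconv : TendstoUniformlyOn (fun n w => (F (z + ε n, w) - F (z, w)) / ε n)
        (fun w => pz F (z, w)) atTop (ball p.2 (R / 2)) := by
      rw [Metric.tendstoUniformlyOn_iff]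
      intro δ hδ
      have hM0 : 0 ≤ M := (norm_nonneg _).trans (hB p.1 (mem_ball_self hR) p.2 (mem_ball_self hR)).2
      have h0 : Tendsto (fun n => 4 * M / (R / 2) ^ 2 * ‖ε n‖) atTop (𝓝 0) := by
        simpa using hlim.const_mul (4 * M / (R / 2) ^ 2)
      filter_upwards [h0.eventually (gt_mem_nhds hδ)] with n hn w hw
      have hwR := hss _ hw
      have := norm_sub_sub_deriv_le ((hs1 w hwR).mono (hsub _ z hz))
        (fun x hx => (hB x (hsub _ z hz hx) w hwR).2) (hmem n)
      rw [add_sub_cancel_left] at this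
      rw [dist_comm, dist_eq_norm]
      have e : (F (z + ε n, w) - F (z, w)) / ε n - pz F (z, w)
          = (F (z + ε n, w) - F (z, w) - deriv (fun z => F (z, w)) z * ε n) / ε n := by
        change _ - deriv (fun z => F (z, w)) z = _
        field_simp [hε0 n]
      rw [e, norm_div, div_lt_iff₀ (norm_pos_iff.2 (hε0 n))]
      calc _ ≤ _ := this
        _ = 4 * M / (R / 2) ^ 2 * ‖ε n‖ * ‖ε n‖ := by ring
        _ < _ := by have := norm_pos_iff.2 (hε0 n); gcongr
    refine hconv.tendstoLocallyUniformlyOn.differentiableOn (Eventually.of_forall fun n => ?_)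
      isOpen_ball
    have := ((hs2 _ (hsub _ z hz (hmem n))).sub (hs2 z hzR)).div_const (ε n)
    exact this.mono (hss _)
  · intro z hz w hw
    refine (norm_deriv_le_of_ball hR2 ((hs1 w (hss _ hw)).mono (hsub _ z hz))
      (fun x hx => (hB x (hsub _ z hz hx) w (hss _ hw)).2)).trans_eq ?_
    field_simp; ring

theorem differentiableOn_pw {F : ℂ × ℂ → ℂ} {W : Set (ℂ × ℂ)} (hW : IsOpen W)
    (hF : DifferentiableOn ℂ F W) : DifferentiableOn ℂ (pw F) W := by
  have h1 : DifferentiableOn ℂ (F ∘ Prod.swap) (Prod.swap ⁻¹' W) :=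
    hF.comp (differentiable_snd.prodMk differentiable_fst).differentiableOn (mapsTo_preimage _ _)
  have h2 := differentiableOn_pz (hW.preimage continuous_swap) h1
  exact h2.comp (f := Prod.swap) (differentiable_snd.prodMk differentiable_fst).differentiableOn fun p hp => by simpa using hp

/-- Separately holomorphic, locally bounded functions are holomorphic. -/
theorem differentiableOn_of_separately {F : ℂ × ℂ → ℂ} {W : Set (ℂ × ℂ)}
    (h : ∀ p ∈ W, ∃ R > 0, ∃ M, (∀ w ∈ ball p.2 R, DifferentiableOn ℂ (fun z => F (z, w)) (ball p.1 R)) ∧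
      (∀ z ∈ ball p.1 R, DifferentiableOn ℂ (fun w => F (z, w)) (ball p.2 R)) ∧
      ∀ z ∈ ball p.1 R, ∀ w ∈ ball p.2 R, ‖F (z, w)‖ ≤ M) : DifferentiableOn ℂ F W := fun p hp => by
  obtain ⟨R, hR, M, h1, h2, h3⟩ := h p hp
  exact (hasFDerivAt_of_separately hR h1 h2 h3).differentiableAt.differentiableWithinAt

end PlanarOP

end

open Filter Topology

noncomputable section

namespace PlanarOP

open Metric Set ComplexConjugate

/-! ### Restriction to the antidiagonal -/

/-- In this form, a combination of the identity and of conjugation, the two coefficients are the two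
Wirtinger derivatives. -/
theorem hasFDerivAt_antidiag {F : ℂ × ℂ → ℂ} {φ : ℂ → ℂ} {a z : ℂ} (hφ : HasDerivAt φ a z)
    (hF : DifferentiableAt ℂ F (φ z, conj (φ z))) :
    HasFDerivAt (𝕜 := ℝ) (fun ζ => F (φ ζ, conj (φ ζ)))
      ((pz F (φ z, conj (φ z)) * a) • (1 : ℂ →L[ℝ] ℂ) +
        (pw F (φ z, conj (φ z)) * conj a) • (Complex.conjCLE : ℂ →L[ℝ] ℂ)) z := by
  have h1 : HasFDerivAt (𝕜 := ℝ) φ (a • (1 : ℂ →L[ℝ] ℂ)) z := hφ.complexToReal_fderiv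
  have h2 : HasFDerivAt (𝕜 := ℝ) (fun ζ => conj (φ ζ))
      ((Complex.conjCLE : ℂ →L[ℝ] ℂ).comp (a • (1 : ℂ →L[ℝ] ℂ))) z :=
    (Complex.conjCLE : ℂ →L[ℝ] ℂ).hasFDerivAt.comp z h1
  have h3 := (hF.hasFDerivAt.restrictScalars ℝ).comp z (h1.prodMk h2)
  refine h3.congr_fderiv ?_
  ext v
  all_goals
    simp [fderiv_apply_eq hF]
    try ring

/-- The antidiagonal is maximally totally real: the real derivative, evaluated at 1 and at i, gives
the sum and (up to i) the difference of the two partial derivatives. -/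
theorem pz_pw_eq_zero_of_antidiag {H : ℂ × ℂ → ℂ} {z : ℂ}
    (hH : DifferentiableAt ℂ H (z, conj z))
    (h0 : fderiv ℝ (fun ζ => H (ζ, conj ζ)) z = 0) :
    pz H (z, conj z) = 0 ∧ pw H (z, conj z) = 0 := by
  have h := (hasFDerivAt_antidiag (φ := id) (hasDerivAt_id z) hH).fderiv
  simp only [id] at h
  rw [h0] at h
  have e1 := congrArg (fun L : ℂ →L[ℝ] ℂ => L 1) h
  have eI := congrArg (fun L : ℂ →L[ℝ] ℂ => L Complex.I) h
  simp at e1 eI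
  have hI := Complex.I_ne_zero
  have e2 : pz H (z, conj z) - pw H (z, conj z) = 0 := by
    have : (pz H (z, conj z) - pw H (z, conj z)) * Complex.I = 0 := by linear_combination -eI
    exact (mul_eq_zero.1 this).resolve_right hI
  constructor
  · linear_combination (-e1 + e2) / 2
  · linear_combination (-e1 - e2) / 2

/-- A holomorphic function vanishing on the antidiagonal vanishes, if the slices are connected. -/
theorem eq_zero_of_antidiag {H : ℂ × ℂ → ℂ} {W : Set (ℂ × ℂ)} (hW : IsOpen W)
    (hH : DifferentiableOn ℂ H W) (h0 : ∀ z, (z, conj z) ∈ W → H (z, conj z) = 0)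
    {z w : ℂ} (hconn : IsPreconnected {ω | (z, ω) ∈ W}) (hz : (z, conj z) ∈ W) (hw : (z, w) ∈ W) :
    H (z, w) = 0 := by
  have hcont : Continuous fun ω : ℂ => (z, ω) := by fun_prop
  have hS : IsOpen {ω | (z, ω) ∈ W} := hW.preimage hcont
  -- The w-derivative of a function vanishing on the antidiagonal vanishes there again. By induction
  -- all Taylor coefficients of the slice at conj z are zero.
  have hit : ∀ n : ℕ, DifferentiableOn ℂ (pw^[n] H) W ∧
      (∀ z, (z, conj z) ∈ W → (pw^[n] H) (z, conj z) = 0) ∧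
      ∀ ω, (z, ω) ∈ W → iteratedDeriv n (fun ω => H (z, ω)) ω = (pw^[n] H) (z, ω) := by
    intro n
    induction n with
    | zero => exact ⟨hH, h0, fun ω _ => by simp⟩
    | succ n ih =>
      obtain ⟨i1, i2, i3⟩ := ih
      simp only [Function.iterate_succ_apply']
      refine ⟨differentiableOn_pw hW i1, fun ζ hζ => ?_, fun ω hω => ?_⟩
      · refine (pz_pw_eq_zero_of_antidiag (i1.differentiableAt (hW.mem_nhds hζ)) ?_).2
        have hc : Continuous fun ζ : ℂ => (ζ, conj ζ) := by fun_prop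
        have : (fun ζ => (pw^[n] H) (ζ, conj ζ)) =ᶠ[𝓝 ζ] fun _ => 0 := by
          filter_upwards [(hW.preimage hc).mem_nhds hζ] with x hx using i2 x hx
        rw [this.fderiv_eq]; simp
      · rw [iteratedDeriv_succ]
        have : iteratedDeriv n (fun ω => H (z, ω)) =ᶠ[𝓝 ω] fun ω => (pw^[n] H) (z, ω) := by
          filter_upwards [hS.mem_nhds hω] with x hx using i3 x hx
        rw [this.deriv_eq]; rfl
  have hd : DifferentiableOn ℂ (fun ω => H (z, ω)) {ω | (z, ω) ∈ W} := fun ω hω =>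
    (hasDerivAt_pw (hH.differentiableAt (hW.mem_nhds hω))).differentiableAt.differentiableWithinAt
  refine (hd.analyticOnNhd hS).eqOn_zero_of_preconnected_of_eventuallyEq_zero hconn hz ?_ hw
  obtain ⟨r, hr, hball⟩ := Metric.isOpen_iff.1 hS _ hz
  filter_upwards [ball_mem_nhds _ hr] with ω hω
  have := Complex.hasSum_taylorSeries_on_ball (hd.mono hball) hω
  refine this.unique ?_
  have e : ∀ n : ℕ, (n.factorial : ℂ)⁻¹ • (ω - conj z) ^ n • iteratedDeriv n (fun ω => H (z, ω)) (conj z)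
      = 0 := fun n => by rw [(hit n).2.2 _ hz, (hit n).2.1 _ hz]; simp
  simp_rw [e]; exact hasSum_zero

/-! ### Division by `1 - z w` -/

open Classical in
/-- The quotient `F / (1 - z w)` for `F` vanishing on `z w = 1`. -/
def divDiag (F : ℂ × ℂ → ℂ) (p : ℂ × ℂ) : ℂ :=
  if p.1 * p.2 = 1 then -pz F p / p.2 else F p / (1 - p.1 * p.2)

theorem mul_divDiag {F : ℂ × ℂ → ℂ} {p : ℂ × ℂ} (h0 : p.1 * p.2 = 1 → F p = 0) :
    (1 - p.1 * p.2) * divDiag F p = F p := by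
  unfold divDiag
  split_ifs with h
  · rw [h0 h, h]; simp
  · have : 1 - p.1 * p.2 ≠ 0 := sub_ne_zero.2 (Ne.symm h)
    field_simp

/-- In a slice 1 - zw = -w(z - 1/w), so the quotient is a difference quotient with a removable
singularity at 1/w. -/
theorem divDiag_eq_dslope {F : ℂ × ℂ → ℂ} {w z : ℂ} (hw : w ≠ 0) (h0 : F (w⁻¹, w) = 0) :
    divDiag F (z, w) = -w⁻¹ * dslope (fun z => F (z, w)) w⁻¹ z := by
  unfold divDiag
  by_cases h : z * w = 1
  · obtain rfl : z = w⁻¹ := eq_inv_of_mul_eq_one_left h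
    simp [hw, pz]; ring
  · have hz : z ≠ w⁻¹ := fun e => h (by rw [e, inv_mul_cancel₀ hw])
    have h1 : 1 - z * w ≠ 0 := sub_ne_zero.2 (Ne.symm h)
    have h2 : z - w⁻¹ ≠ 0 := sub_ne_zero.2 hz
    simp only [h, if_false]
    rw [dslope_of_ne _ hz, slope_def_field, h0, sub_zero]
    have h3 : z * w - 1 ≠ 0 := sub_ne_zero.2 h
    have h4 : z - w⁻¹ = (z * w - 1) / w := by field_simp
    rw [h4]
    field_simp
    ring

/-- The value of `divDiag` on zw = 1 is defined with the z-derivative. Differentiating F(ζ, 1/ζ) = 0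
shows that the w-derivative gives the same value, which makes the other slices accessible. -/
theorem divDiag_swap {F : ℂ × ℂ → ℂ} {W : Set (ℂ × ℂ)} (hW : IsOpen W)
    (hF : DifferentiableOn ℂ F W) (h0 : ∀ p ∈ W, p.1 * p.2 = 1 → F p = 0) {p : ℂ × ℂ} (hp : p ∈ W) :
    divDiag F p = divDiag (F ∘ Prod.swap) p.swap := by
  unfold divDiag
  obtain ⟨z, w⟩ := p
  simp only [Prod.swap, Function.comp]
  rw [mul_comm w z]
  split_ifs with h
  · have hz : z ≠ 0 := left_ne_zero_of_mul_eq_one h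
    have hw : w ≠ 0 := right_ne_zero_of_mul_eq_one h
    obtain rfl : w = z⁻¹ := eq_inv_of_mul_eq_one_right h
    have hd := hF.differentiableAt (hW.mem_nhds hp)
    have hi : HasDerivAt (fun ζ : ℂ => (ζ, ζ⁻¹)) (1, -(z ^ 2)⁻¹) z :=
      (hasDerivAt_id z).prodMk (hasDerivAt_inv hz)
    have h1 := hd.hasFDerivAt.comp_hasDerivAt z hi
    have h2 : (F ∘ fun ζ : ℂ => (ζ, ζ⁻¹)) =ᶠ[𝓝 z] fun _ => 0 := by
      have : ∀ᶠ ζ in 𝓝 z, (ζ, ζ⁻¹) ∈ W := hi.continuousAt.eventually (hW.mem_nhds hp)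
      filter_upwards [this, isOpen_ne.mem_nhds hz] with ζ h3 h4 using h0 _ h3 (mul_inv_cancel₀ h4)
    have h3 := (h1.congr_of_eventuallyEq h2.symm).unique (hasDerivAt_const z 0)
    rw [fderiv_apply_eq hd] at h3
    have h4 : pw F (z, z⁻¹) = pz (F ∘ Prod.swap) (z⁻¹, z) := rfl
    change -pz F (z, z⁻¹) / z⁻¹ = -pz (F ∘ Prod.swap) (z⁻¹, z) / z
    rw [← h4]
    field_simp at h3 ⊢
    linear_combination -h3
  · rfl

/-- The Schwarz bound is taken on a disc centred at the zero 1/w, which moves with w. This makes it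
uniform for w near a given point. -/
theorem divDiag_slice {F : ℂ × ℂ → ℂ} {W : Set (ℂ × ℂ)} (hW : IsOpen W)
    (hF : DifferentiableOn ℂ F W) (h0 : ∀ p ∈ W, p.1 * p.2 = 1 → F p = 0) {w a : ℂ} {R M : ℝ}
    (hw : w ≠ 0) (hsub : ∀ z ∈ ball w⁻¹ R, (z, w) ∈ W ∧ ‖F (z, w)‖ ≤ M) {r : ℝ}
    (hr : ball a r ⊆ ball w⁻¹ R) :
    DifferentiableOn ℂ (fun z => divDiag F (z, w)) (ball a r) ∧
      ∀ z ∈ ball a r, ‖divDiag F (z, w)‖ ≤ ‖w⁻¹‖ * (M / R) := by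
  rcases (ball a r).eq_empty_or_nonempty with he | ⟨x, hx⟩
  · rw [he]; exact ⟨differentiableOn_empty, by simp⟩
  have hR : 0 < R := pos_of_mem_ball (hr hx)
  have hc : w⁻¹ ∈ ball w⁻¹ R := mem_ball_self hR
  have hz0 : F (w⁻¹, w) = 0 := h0 _ (hsub _ hc).1 (inv_mul_cancel₀ hw)
  have hd : DifferentiableOn ℂ (fun z => F (z, w)) (ball w⁻¹ R) := fun z hz =>
    (hasDerivAt_pz (p := (z, w)) (hF.differentiableAt
      (hW.mem_nhds (hsub z hz).1))).differentiableAt.differentiableWithinAt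
  simp_rw [divDiag_eq_dslope hw hz0]
  refine ⟨(((Complex.differentiableOn_dslope (ball_mem_nhds _ hR)).2 hd).mono hr).const_mul _,
    fun z hz => ?_⟩
  rw [norm_mul, norm_neg]
  gcongr
  refine Complex.norm_dslope_le_div_of_mapsTo_ball hd (fun y hy => ?_) (hr hz)
  rw [mem_closedBall, dist_eq_norm, hz0, sub_zero]
  exact (hsub y hy).2

/-- Off the curve zw = 1 this is an ordinary quotient. On the curve, boundedness together with
holomorphy in each variable suffices. -/
theorem differentiableOn_divDiag {F : ℂ × ℂ → ℂ} {W : Set (ℂ × ℂ)} (hW : IsOpen W)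
    (hF : DifferentiableOn ℂ F W) (h0 : ∀ p ∈ W, p.1 * p.2 = 1 → F p = 0) :
    DifferentiableOn ℂ (divDiag F) W := by
  intro p hp
  by_cases hp1 : p.1 * p.2 = 1
  swap
  · have hc : Continuous fun q : ℂ × ℂ => q.1 * q.2 := by fun_prop
    have : divDiag F =ᶠ[𝓝 p] fun q => F q / (1 - q.1 * q.2) := by
      filter_upwards [hc.continuousAt.eventually_ne hp1] with q hq
      simp [divDiag, hq]
    refine (DifferentiableAt.congr_of_eventuallyEq ?_ this).differentiableWithinAt
    simp_rw [div_eq_mul_inv]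
    have hd : DifferentiableAt ℂ (fun q : ℂ × ℂ => 1 - q.1 * q.2) p := by fun_prop
    exact (hF.differentiableAt (hW.mem_nhds hp)).mul (hd.fun_inv (sub_ne_zero.2 (Ne.symm hp1)))
  · obtain ⟨a, b⟩ := p
    simp only at hp1
    have ha : a ≠ 0 := left_ne_zero_of_mul_eq_one hp1
    have hb : b ≠ 0 := right_ne_zero_of_mul_eq_one hp1
    have hab : b⁻¹ = a := (eq_inv_of_mul_eq_one_left hp1).symm
    have hba : a⁻¹ = b := (eq_inv_of_mul_eq_one_right hp1).symm
    obtain ⟨R, hR, M, hB⟩ := exists_bidisc hW hF.continuousOn hp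
    simp only at hB
    have hR4 : 0 < R / 4 := by positivity
    -- Inversion carries points near c to points within R/4 of d. The discs of radius R/2 about
    -- these moving centres then contain a fixed small disc and stay inside the disc of radius R.
    have key : ∀ c d : ℂ, c ≠ 0 → c⁻¹ = d →
        ∀ᶠ x in 𝓝 c, x ≠ 0 ∧ x⁻¹ ∈ ball d (R / 4) ∧ ‖x⁻¹‖ < ‖d‖ + 1 := by
      rintro c d hc rfl
      have hi : ContinuousAt (fun x : ℂ => x⁻¹) c := continuousAt_inv₀ hc
      filter_upwards [isOpen_ne.mem_nhds hc, hi.eventually (ball_mem_nhds _ hR4),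
        hi.norm.eventually (gt_mem_nhds (lt_add_one _))] with x h1 h2 h3 using ⟨h1, h2, h3⟩
    obtain ⟨r1, hr1, k1⟩ := Metric.eventually_nhds_iff_ball.1 (key b a hb hab)
    obtain ⟨r2, hr2, k2⟩ := Metric.eventually_nhds_iff_ball.1 (key a b ha hba)
    set r := min (R / 4) (min r1 r2)
    have hr : 0 < r := by positivity
    have hrR : r ≤ R / 4 := min_le_left _ _
    have hrr1 : r ≤ r1 := (min_le_right _ _).trans (min_le_left _ _)
    have hrr2 : r ≤ r2 := (min_le_right _ _).trans (min_le_right _ _)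
    have hMpos : 0 ≤ M := (norm_nonneg _).trans (hB a (mem_ball_self hR) b (mem_ball_self hR)).2
    have sub1 : ∀ c x : ℂ, x ∈ ball c (R / 4) → ball c r ⊆ ball x (R / 2) := fun c x hx =>
      ball_subset_ball' (by rw [mem_ball, dist_comm] at hx; linarith)
    have sub2 : ∀ c x : ℂ, x ∈ ball c (R / 4) → ball x (R / 2) ⊆ ball c R := fun c x hx =>
      ball_subset_ball' (by rw [mem_ball] at hx; linarith)
    have hs1 : ∀ w ∈ ball b r, DifferentiableOn ℂ (fun z => divDiag F (z, w)) (ball a r) ∧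
        ∀ z ∈ ball a r, ‖divDiag F (z, w)‖ ≤ (‖a‖ + 1) * (M / (R / 2)) := fun w hw => by
      obtain ⟨g1, g2, g3⟩ := k1 w (ball_subset_ball hrr1 hw)
      obtain ⟨s1, s2⟩ := divDiag_slice (R := R / 2) (M := M) hW hF h0 g1
        (fun z hz => hB z (sub2 _ _ g2 hz) w (ball_subset_ball (by linarith) hw)) (sub1 _ _ g2)
      exact ⟨s1, fun z hz => (s2 z hz).trans (by gcongr)⟩
    have hs2 : ∀ z ∈ ball a r, DifferentiableOn ℂ (fun w => divDiag F (z, w)) (ball b r) := fun z hz => by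
      obtain ⟨g1, g2, g3⟩ := k2 z (ball_subset_ball hrr2 hz)
      have hFs : DifferentiableOn ℂ (F ∘ Prod.swap) (Prod.swap ⁻¹' W) :=
        hF.comp (differentiable_snd.prodMk differentiable_fst).differentiableOn (mapsTo_preimage _ _)
      have := (divDiag_slice (R := R / 2) (M := M) (hW.preimage continuous_swap) hFs
        (fun p hp h => h0 _ hp (by simpa [mul_comm] using h)) g1
        (fun w hw => hB z (ball_subset_ball (by linarith) hz) w (sub2 _ _ g2 hw)) (sub1 _ _ g2)).1
      refine this.congr fun w hw => ?_
      exact divDiag_swap hW hF h0 (hB z (ball_subset_ball (by linarith) hz) w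
        (ball_subset_ball (by linarith) hw)).1
    exact (hasFDerivAt_of_separately hr (fun w hw => (hs1 w hw).1) hs2
      fun z hz w hw => (hs1 w hw).2 z hz).differentiableAt.differentiableWithinAt

end PlanarOP

end

open Filter Topology

noncomputable section

namespace PlanarOP

open Metric Set ComplexConjugate

/-! ### Geometry of the fattened diagonal annulus -/

theorem rho_pos {σ : ℝ} (h : 0 < σ) : 0 < rho σ := by unfold rho; positivity

theorem rho_inv {σ : ℝ} : (rho σ)⁻¹ = σ + √(1 + σ ^ 2) := by simp [rho]

theorem rho_eq {σ : ℝ} (h : 0 < σ) : rho σ = √(1 + σ ^ 2) - σ := by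
  have h1 : √(1 + σ ^ 2) ^ 2 = 1 + σ ^ 2 := Real.sq_sqrt (by positivity)
  rw [rho, div_eq_iff (by positivity)]
  linear_combination -h1

/-- The annulus has width exactly 2σ, the thickness of the fattened diagonal. Two points on one ray
in the annulus are therefore automatically less than 2σ apart. -/
theorem rho_inv_sub {σ : ℝ} (h : 0 < σ) : (rho σ)⁻¹ - rho σ = 2 * σ := by
  rw [rho_inv, rho_eq h]; ring

theorem one_le_sqrt_one_add_sq (σ : ℝ) : 1 ≤ √(1 + σ ^ 2) :=
  Real.one_le_sqrt.2 (by nlinarith [sq_nonneg σ])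

theorem one_sub_le_rho {σ : ℝ} (h : 0 < σ) : 1 - σ ≤ rho σ := by
  rw [rho_eq h]; linarith [one_le_sqrt_one_add_sq σ]

theorem one_add_le_rho_inv (σ : ℝ) : 1 + σ ≤ (rho σ)⁻¹ := by
  rw [rho_inv]; linarith [one_le_sqrt_one_add_sq σ]

theorem rho_lt_one {σ : ℝ} (h : 0 < σ) : rho σ < 1 :=
  (inv_lt_inv₀ zero_lt_one (rho_pos h)).1 (by rw [inv_one]; linarith [one_add_le_rho_inv σ])

theorem one_lt_rho_inv {σ : ℝ} (h : 0 < σ) : 1 < (rho σ)⁻¹ := by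
  linarith [one_add_le_rho_inv σ]

/-- The derivative of √(1 + x²) is at most x ≤ 1/8. This is why parameters are kept below 1/8: both
radii of the annulus then move at speed at least 7/8 in σ. -/
theorem sqrt_sub_bounds {a b : ℝ} (ha : 0 < a) (hab : a ≤ b) (hb : b ≤ 1 / 8) :
    0 ≤ √(1 + b ^ 2) - √(1 + a ^ 2) ∧ √(1 + b ^ 2) - √(1 + a ^ 2) ≤ (b - a) / 8 := by
  have h1 := one_le_sqrt_one_add_sq a
  have h2 := one_le_sqrt_one_add_sq b
  have s1 : √(1 + a ^ 2) ^ 2 = 1 + a ^ 2 := Real.sq_sqrt (by positivity)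
  have s2 : √(1 + b ^ 2) ^ 2 = 1 + b ^ 2 := Real.sq_sqrt (by positivity)
  have h3 : 0 ≤ √(1 + b ^ 2) - √(1 + a ^ 2) := by
    rw [sub_nonneg]; apply Real.sqrt_le_sqrt; gcongr
  refine ⟨h3, ?_⟩
  nlinarith [mul_nonneg h3 (by linarith : 0 ≤ √(1 + b ^ 2) + √(1 + a ^ 2) - 2),
    mul_nonneg (sub_nonneg.2 hab) (by linarith : 0 ≤ 1 / 8 - b),
    mul_nonneg (sub_nonneg.2 hab) (by linarith : 0 ≤ 1 / 8 - a)]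

theorem rho_sub_le {a b : ℝ} (ha : 0 < a) (hab : a ≤ b) (hb : b ≤ 1 / 8) :
    7 / 8 * (b - a) ≤ rho a - rho b := by
  rw [rho_eq ha, rho_eq (ha.trans_le hab)]
  linarith [(sqrt_sub_bounds ha hab hb).2]

theorem rho_inv_sub_le {a b : ℝ} (ha : 0 < a) (hab : a ≤ b) (hb : b ≤ 1 / 8) :
    7 / 8 * (b - a) ≤ (rho b)⁻¹ - (rho a)⁻¹ := by
  rw [rho_inv, rho_inv]
  linarith [(sqrt_sub_bounds ha hab hb).1]

theorem rho_anti {a b : ℝ} (ha : 0 < a) (hab : a ≤ b) : rho b ≤ rho a := by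
  unfold rho; gcongr

theorem annulus_mono {a b : ℝ} (ha : 0 < a) (hab : a ≤ b) : annulus a ⊆ annulus b := fun _ hz =>
  ⟨(rho_anti ha hab).trans_lt hz.1,
    hz.2.trans_le (inv_anti₀ (rho_pos (ha.trans_le hab)) (rho_anti ha hab))⟩

theorem isOpen_annulus (σ : ℝ) : IsOpen (annulus σ) :=
  (isOpen_lt continuous_const continuous_norm).inter (isOpen_lt continuous_norm continuous_const)

theorem mem_annulus_of_norm_one {σ : ℝ} (h : 0 < σ) {c : ℂ} (hc : ‖c‖ = 1) : c ∈ annulus σ :=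
  ⟨by rw [hc]; exact rho_lt_one h, by rw [hc]; exact one_lt_rho_inv h⟩

theorem ne_zero_of_mem_annulus {σ : ℝ} (h : 0 < σ) {z : ℂ} (hz : z ∈ annulus σ) : z ≠ 0 :=
  norm_pos_iff.1 ((rho_pos h).trans hz.1)

theorem conj_mem_annulus {σ : ℝ} {z : ℂ} : conj z ∈ annulus σ ↔ z ∈ annulus σ := by
  simp [annulus]

theorem inv_mem_annulus {σ : ℝ} (h : 0 < σ) {z : ℂ} (hz : z ∈ annulus σ) : z⁻¹ ∈ annulus σ := by
  have hz0 := norm_pos_iff.2 (ne_zero_of_mem_annulus h hz)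
  refine ⟨?_, ?_⟩ <;> rw [norm_inv]
  · have := (inv_lt_inv₀ (inv_pos.2 (rho_pos h)) hz0).2 hz.2
    rwa [inv_inv] at this
  · exact (inv_lt_inv₀ hz0 (rho_pos h)).2 hz.1

/-- The domain of the polarizations in the variables `(z, conj w)`. -/
def Dh (σ : ℝ) : Set (ℂ × ℂ) := {p | (p.1, conj p.2) ∈ fatAnnulus σ}

theorem mem_Dh {σ : ℝ} {p : ℂ × ℂ} :
    p ∈ Dh σ ↔ p.1 ∈ annulus σ ∧ p.2 ∈ annulus σ ∧ ‖p.1 - conj p.2‖ < 2 * σ := by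
  simp only [Dh, fatAnnulus, mem_ofPred_eq, conj_mem_annulus]

theorem isOpen_Dh (σ : ℝ) : IsOpen (Dh σ) := by
  have : Dh σ = (Prod.fst ⁻¹' annulus σ) ∩ ((Prod.snd ⁻¹' annulus σ) ∩
      {p : ℂ × ℂ | ‖p.1 - conj p.2‖ < 2 * σ}) := by
    ext p; exact mem_Dh
  rw [this]
  refine ((isOpen_annulus σ).preimage continuous_fst).inter
    (((isOpen_annulus σ).preimage continuous_snd).inter (isOpen_lt (by fun_prop) continuous_const))

theorem Dh_mono {a b : ℝ} (ha : 0 < a) (hab : a ≤ b) : Dh a ⊆ Dh b := fun p hp => by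
  rw [mem_Dh] at hp ⊢
  exact ⟨annulus_mono ha hab hp.1, annulus_mono ha hab hp.2.1, by linarith [hp.2.2]⟩

theorem swap_mem_Dh {σ : ℝ} {p : ℂ × ℂ} (hp : p ∈ Dh σ) : p.swap ∈ Dh σ := by
  rw [mem_Dh] at hp ⊢
  refine ⟨hp.2.1, hp.1, ?_⟩
  have : ‖p.2 - conj p.1‖ = ‖p.1 - conj p.2‖ := by
    rw [← Complex.norm_conj, map_sub, Complex.conj_conj, norm_sub_rev]
  exact this ▸ hp.2.2

theorem diag_mem_Dh {σ : ℝ} (h : 0 < σ) {z : ℂ} (hz : z ∈ annulus σ) : (z, conj z) ∈ Dh σ := by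
  rw [mem_Dh]
  exact ⟨hz, conj_mem_annulus.2 hz, by simpa using h⟩

/-- The reflection 1/conj z lies on the ray of z, at distance | |z| - 1/|z| |, which is less than
the width 2σ. So `Dh σ` contains the whole complexified circle over the annulus, on which the
Laurent expansion lives. -/
theorem inv_mem_Dh {σ : ℝ} (h : 0 < σ) {z : ℂ} (hz : z ∈ annulus σ) : (z, z⁻¹) ∈ Dh σ := by
  rw [mem_Dh]
  have hz0 := ne_zero_of_mem_annulus h hz
  refine ⟨hz, inv_mem_annulus h hz, ?_⟩
  have hn : 0 < ‖z‖ := norm_pos_iff.2 hz0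
  have e : z - conj z⁻¹ = z * ((1 - (‖z‖ ^ 2)⁻¹ : ℝ) : ℂ) := by
    have : z * conj z = ((‖z‖ ^ 2 : ℝ) : ℂ) := by rw [Complex.mul_conj, Complex.normSq_eq_norm_sq]
    have h2 : conj z ≠ 0 := by simpa using hz0
    rw [Complex.ofReal_sub, Complex.ofReal_inv, ← this, map_inv₀]
    simp only [Complex.ofReal_one]
    field_simp
  simp only
  rw [e, norm_mul, Complex.norm_real, Real.norm_eq_abs]
  have e2 : ‖z‖ * |1 - (‖z‖ ^ 2)⁻¹| = |‖z‖ - ‖z‖⁻¹| := by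
    rw [← abs_of_pos hn, ← abs_mul, abs_of_pos hn]; congr 1; field_simp
  have h1 := inv_mem_annulus h hz
  rw [e2, ← rho_inv_sub h, abs_lt]
  have h3 := h1.1; have h4 := h1.2
  rw [norm_inv] at h3 h4
  constructor <;> linarith [hz.1, hz.2]

/-- Passing from a to b enlarges the annulus by at least 7/8 (b - a) on each side and the diagonal
thickness by 2(b - a). Cauchy discs of radius 7/8 (b - a) therefore fit. -/
theorem fst_step_mem_Dh {a b : ℝ} (ha : 0 < a) (hab : a ≤ b) (hb : b ≤ 1 / 8) {p : ℂ × ℂ}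
    (hp : p ∈ Dh a) {z : ℂ} (hz : z ∈ ball p.1 (7 / 8 * (b - a))) : (z, p.2) ∈ Dh b := by
  rw [mem_ball, dist_eq_norm] at hz
  rw [mem_Dh] at hp ⊢
  have h1 := norm_sub_norm_le p.1 z
  have h2 := norm_sub_norm_le z p.1
  rw [norm_sub_rev] at h1
  refine ⟨⟨?_, ?_⟩, annulus_mono ha hab hp.2.1, ?_⟩
  · linarith [rho_sub_le ha hab hb, hp.1.1]
  · linarith [rho_inv_sub_le ha hab hb, hp.1.2]
  · have : z - conj p.2 = (z - p.1) + (p.1 - conj p.2) := by ring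
    simp only
    rw [this]
    linarith [norm_add_le (z - p.1) (p.1 - conj p.2), hp.2.2]

/-- The slices of the fattened diagonal are connected: rotate, then move radially. -/
theorem isPreconnected_slice {σ : ℝ} (h : 0 < σ) {z : ℂ} (hz : z ∈ annulus σ) :
    IsPreconnected {ω | (z, ω) ∈ Dh σ} := by
  have hz0 := ne_zero_of_mem_annulus h hz
  have hzn : 0 < ‖z‖ := norm_pos_iff.2 hz0
  set S : Set ℂ := {x | x ∈ annulus σ ∧ ‖z - x‖ < 2 * σ}
  have hS : {ω | (z, ω) ∈ Dh σ} = (fun x => conj x) '' S := by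
    ext ω
    simp only [mem_ofPred_eq, mem_Dh, mem_image, S]
    constructor
    · rintro ⟨-, h2, h3⟩
      exact ⟨conj ω, ⟨conj_mem_annulus.2 h2, h3⟩, Complex.conj_conj ω⟩
    · rintro ⟨x, ⟨h1, h2⟩, rfl⟩
      exact ⟨hz, conj_mem_annulus.2 h1, by rwa [Complex.conj_conj]⟩
  rw [hS]
  refine IsPreconnected.image ?_ _ (by fun_prop)
  refine isPreconnected_of_forall z fun x hx => ?_
  have hx0 : x ≠ 0 := ne_zero_of_mem_annulus h hx.1
  set a := Complex.log (x / z)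
  have hxz : z * Complex.exp a = x := by
    rw [Complex.exp_log (div_ne_zero hx0 hz0)]; field_simp
  -- The path from z to x follows `γ2` along the ray of z to the modulus of x, then `γ1` along a
  -- circle to x.
  set γ1 : ℝ → ℂ := fun v => z * Complex.exp (a.re + v * Complex.I)
  set γ2 : ℝ → ℂ := fun u => z * Complex.exp (u : ℂ)
  have n1 : ∀ v, ‖γ1 v‖ = ‖x‖ := fun v => by
    rw [← hxz]; simp [γ1, Complex.norm_exp]
  have n2 : ∀ u, ‖γ2 u‖ = ‖z‖ * Real.exp u := fun u => by
    simp [γ2, Complex.norm_exp]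
  have nx : ‖x‖ = ‖z‖ * Real.exp a.re := by rw [← hxz, norm_mul, Complex.norm_exp]
  have d1 : ∀ v : ℝ, ‖z - γ1 v‖ ^ 2
      = ‖z‖ ^ 2 * (1 + Real.exp a.re ^ 2 - 2 * Real.exp a.re * Real.cos v) := fun v => by
    have : z - γ1 v = z * (1 - Complex.exp (a.re + v * Complex.I)) := by simp only [γ1]; ring
    rw [this, norm_mul, mul_pow, ← Complex.normSq_eq_norm_sq (1 - _), Complex.normSq_apply]
    simp [Complex.exp_re, Complex.exp_im]
    left
    linear_combination Real.exp a.re ^ 2 * Real.sin_sq_add_cos_sq v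
  have hab : |a.im| ≤ Real.pi := Complex.abs_arg_le_pi _ |> fun h => by rwa [Complex.log_im]
  refine ⟨γ2 '' uIcc 0 a.re ∪ γ1 '' uIcc 0 a.im, ?_, Or.inl ⟨0, left_mem_uIcc, by simp [γ2]⟩,
    Or.inr ⟨a.im, right_mem_uIcc, by simp only [γ1]; rw [Complex.re_add_im]; exact hxz⟩, ?_⟩
  · rintro y (⟨u, hu, rfl⟩ | ⟨v, hv, rfl⟩)
    · have hb : min ‖z‖ ‖x‖ ≤ ‖γ2 u‖ ∧ ‖γ2 u‖ ≤ max ‖z‖ ‖x‖ := by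
        rw [n2, nx]
        rcases le_total 0 a.re with h0 | h0
        · rw [uIcc_of_le h0] at hu
          exact ⟨(min_le_left _ _).trans (le_mul_of_one_le_right hzn.le (Real.one_le_exp hu.1)),
            le_max_of_le_right (by gcongr; exact hu.2)⟩
        · rw [uIcc_of_ge h0] at hu
          exact ⟨(min_le_right _ _).trans (by gcongr; exact hu.1),
            le_max_of_le_left (mul_le_of_le_one_right hzn.le (Real.exp_le_one_iff.2 hu.2))⟩
      have hA : γ2 u ∈ annulus σ :=
        ⟨(lt_min hz.1 hx.1.1).trans_le hb.1, hb.2.trans_lt (max_lt hz.2 hx.1.2)⟩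
      refine ⟨hA, ?_⟩
      have e : z - γ2 u = z * ((1 - Real.exp u : ℝ) : ℂ) := by simp [γ2]; ring
      rw [e, norm_mul, Complex.norm_real, Real.norm_eq_abs,
        show ‖z‖ * |1 - Real.exp u| = |‖z‖ * (1 - Real.exp u)| by rw [abs_mul, abs_of_pos hzn], mul_sub, mul_one, ← n2, ← rho_inv_sub h, abs_lt]
      constructor <;> linarith [hA.1, hA.2, hz.1, hz.2]
    · refine ⟨⟨by rw [n1]; exact hx.1.1, by rw [n1]; exact hx.1.2⟩, ?_⟩
      refine lt_of_le_of_lt ?_ hx.2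
      have hx' : x = γ1 a.im := by simp only [γ1]; rw [Complex.re_add_im]; exact hxz.symm
      rw [hx', ← sq_le_sq₀ (norm_nonneg _) (norm_nonneg _), d1, d1]
      -- On the circular arc the distance to z increases with the angle, so the endpoint x is the
      -- farthest point from z.
      have hcos : Real.cos a.im ≤ Real.cos v := by
        rw [← Real.cos_abs a.im, ← Real.cos_abs v]
        refine Real.cos_le_cos_of_nonneg_of_le_pi (abs_nonneg _) hab ?_
        rcases le_total 0 a.im with h0 | h0
        · rw [uIcc_of_le h0] at hv
          rw [abs_of_nonneg hv.1, abs_of_nonneg h0]; exact hv.2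
        · rw [uIcc_of_ge h0] at hv
          rw [abs_of_nonpos hv.2, abs_of_nonpos h0]; linarith [hv.1]
      have := Real.exp_pos a.re
      gcongr
  · refine IsPreconnected.union (γ2 a.re) ⟨a.re, right_mem_uIcc, rfl⟩ ⟨0, left_mem_uIcc, ?_⟩
      (isPreconnected_uIcc.image _ ?_) (isPreconnected_uIcc.image _ ?_)
    · simp [γ1, γ2]
    · exact Continuous.continuousOn (by fun_prop)
    · exact Continuous.continuousOn (by fun_prop)

/-- The polarization of the unit circle. -/
def circK : Set (ℂ × ℂ) := (fun c : ℂ => (c, conj c)) '' sphere 0 1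

theorem isCompact_circK : IsCompact circK :=
  (isCompact_sphere 0 1).image (by fun_prop)

theorem mem_circK {c : ℂ} (hc : ‖c‖ = 1) : (c, conj c) ∈ circK := ⟨c, by simpa using hc, rfl⟩

theorem conj_eq_inv {c : ℂ} (hc : ‖c‖ = 1) : conj c = c⁻¹ := (Complex.inv_eq_conj hc).symm

/-- `Dh σ` shrinks to the compact set `circK`: p.1 is within 2σ of its radial projection c, and conj
p.2 is within 2σ of p.1, hence p is within 4σ of (c, conj c). This turns any local property along
the circle into a uniform one. -/
theorem exists_Dh_of_eventually {P : ℂ × ℂ → Prop} (h : ∀ᶠ p in 𝓝ˢ circK, P p) :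
    ∃ σ₀, 0 < σ₀ ∧ σ₀ ≤ 1 / 8 ∧ ∀ σ, 0 < σ → σ ≤ σ₀ → ∀ p ∈ Dh σ, P p := by
  rw [eventually_nhdsSet_iff_exists] at h
  obtain ⟨t, ht, hKt, hP⟩ := h
  obtain ⟨δ, hδ, hsub⟩ := isCompact_circK.exists_thickening_subset_open ht hKt
  refine ⟨min (1 / 8) (δ / 8), by positivity, min_le_left _ _, fun σ hσ hσ0 p hp =>
    hP _ (hsub ?_)⟩
  have hσδ : σ ≤ δ / 8 := hσ0.trans (min_le_right _ _)
  rw [mem_Dh] at hp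
  have hz0 := ne_zero_of_mem_annulus hσ hp.1
  have hzn : 0 < ‖p.1‖ := norm_pos_iff.2 hz0
  set c : ℂ := p.1 / ‖p.1‖
  have hc : ‖c‖ = 1 := by simp [c, hzn.ne']
  have hpc : ‖p.1 - c‖ ≤ 2 * σ := by
    have : p.1 - c = c * ((‖p.1‖ - 1 : ℝ) : ℂ) := by
      simp only [c]; push_cast; have : (‖p.1‖ : ℂ) ≠ 0 := by exact_mod_cast hzn.ne'
      field_simp
    rw [this, norm_mul, hc, one_mul, Complex.norm_real, Real.norm_eq_abs, abs_le]
    have h1 := rho_inv_sub hσ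
    have h2 := rho_lt_one hσ
    have h3 := one_lt_rho_inv hσ
    constructor <;> linarith [hp.1.1, hp.1.2]
  rw [mem_thickening_iff]
  refine ⟨_, mem_circK hc, ?_⟩
  rw [Prod.dist_eq, max_lt_iff]
  refine ⟨by rw [dist_eq_norm]; linarith, ?_⟩
  rw [dist_eq_norm, ← Complex.norm_conj, map_sub, Complex.conj_conj]
  have : conj p.2 - c = (p.1 - c) - (p.1 - conj p.2) := by ring
  rw [this]
  linarith [norm_sub_le (p.1 - c) (p.1 - conj p.2), hp.2.2]

theorem exists_annulus_of_eventually {P : ℂ → Prop} (h : ∀ c : ℂ, ‖c‖ = 1 → ∀ᶠ z in 𝓝 c, P z) :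
    ∃ σ₀, 0 < σ₀ ∧ σ₀ ≤ 1 / 8 ∧ ∀ σ, 0 < σ → σ ≤ σ₀ → ∀ z ∈ annulus σ, P z := by
  have : ∀ᶠ p in 𝓝ˢ circK, P p.1 := by
    rw [eventually_nhdsSet_iff_forall]
    rintro _ ⟨c, hc, rfl⟩
    exact (continuous_fst.tendsto (c, conj c)).eventually (h c (by simpa using hc))
  obtain ⟨σ₀, h1, h2, h3⟩ := exists_Dh_of_eventually this
  exact ⟨σ₀, h1, h2, fun σ hσ hσ0 z hz => h3 σ hσ hσ0 _ (diag_mem_Dh hσ hz)⟩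

/-! ### Cauchy estimates and division -/

theorem slice_fst_ball {G : ℂ × ℂ → ℂ} {a b : ℝ} (ha : 0 < a) (hab : a ≤ b) (hb : b ≤ 1 / 8)
    (hG : DifferentiableOn ℂ G (Dh b)) {p : ℂ × ℂ} (hp : p ∈ Dh a) :
    DifferentiableOn ℂ (fun z => G (z, p.2)) (ball p.1 (7 / 8 * (b - a))) := fun z hz =>
  (hasDerivAt_pz (p := (z, p.2)) (hG.differentiableAt ((isOpen_Dh b).mem_nhds
    (fst_step_mem_Dh ha hab hb hp hz)))).differentiableAt.differentiableWithinAt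

/-- Cauchy's estimate on a disc of radius 7/8 (b - a) gives 16/7, rounded up to 3. -/
theorem norm_pz_le {G : ℂ × ℂ → ℂ} {a b M : ℝ} (ha : 0 < a) (hab : a < b) (hb : b ≤ 1 / 8)
    (hG : DifferentiableOn ℂ G (Dh b)) (hM : ∀ p ∈ Dh b, ‖G p‖ ≤ M) :
    ∀ p ∈ Dh a, ‖pz G p‖ ≤ 3 * M / (b - a) := fun p hp => by
  have hM0 : 0 ≤ M := (norm_nonneg _).trans (hM p (Dh_mono ha hab.le hp))
  have hd : 0 < b - a := sub_pos.2 hab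
  refine (norm_deriv_le_of_ball (by positivity) (slice_fst_ball ha hab.le hb hG hp)
    fun z hz => hM _ (fst_step_mem_Dh ha hab.le hb hp hz)).trans ?_
  rw [div_le_div_iff₀ (by positivity) hd]
  nlinarith [mul_nonneg hM0 hd.le]

theorem comp_swap_Dh {G : ℂ × ℂ → ℂ} {b : ℝ} (hG : DifferentiableOn ℂ G (Dh b)) :
    DifferentiableOn ℂ (G ∘ Prod.swap) (Dh b) :=
  hG.comp (differentiable_snd.prodMk differentiable_fst).differentiableOn fun _ hp => swap_mem_Dh hp

theorem norm_pw_le {G : ℂ × ℂ → ℂ} {a b M : ℝ} (ha : 0 < a) (hab : a < b) (hb : b ≤ 1 / 8)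
    (hG : DifferentiableOn ℂ G (Dh b)) (hM : ∀ p ∈ Dh b, ‖G p‖ ≤ M) :
    ∀ p ∈ Dh a, ‖pw G p‖ ≤ 3 * M / (b - a) := fun p hp => by
  rw [pw_swap]
  exact norm_pz_le ha hab hb (comp_swap_Dh hG) (fun q hq => hM _ (swap_mem_Dh hq)) _
    (swap_mem_Dh hp)

/-- The quotient by `1 - z w` costs the width of the collar. -/
theorem norm_quotient_le {G H : ℂ × ℂ → ℂ} {a b M : ℝ} (ha : 0 < a) (hab : a < b) (hb : b ≤ 1 / 8)
    (hH : DifferentiableOn ℂ H (Dh b)) (hGH : ∀ p ∈ Dh b, (1 - p.1 * p.2) * H p = G p)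
    (hM : ∀ p ∈ Dh b, ‖G p‖ ≤ M) : ∀ p ∈ Dh a, ‖H p‖ ≤ 3 * M / (b - a) := fun p hp => by
  have hpb := Dh_mono ha hab.le hp
  have hM0 : 0 ≤ M := (norm_nonneg _).trans (hM p hpb)
  have hd : 0 < b - a := sub_pos.2 hab
  -- Where the divisor is at least (b - a)/3 the bound is immediate. Elsewhere the maximum principle
  -- reduces to such points.
  have key : ∀ q ∈ Dh b, (b - a) / 3 ≤ ‖1 - q.1 * q.2‖ → ‖H q‖ ≤ 3 * M / (b - a) := by
    intro q hq h1
    have h2 := hM q hq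
    rw [← hGH q hq, norm_mul] at h2
    rw [le_div_iff₀ hd]
    nlinarith [norm_nonneg (H q)]
  by_cases hcase : (b - a) / 3 ≤ ‖1 - p.1 * p.2‖
  · exact key p hpb hcase
  push Not at hcase
  -- On the circle of this radius in z the divisor has changed by at least 6/7 · 7/8 (b - a) = 3/4
  -- (b - a), since ‖w‖ ≥ 7/8, from a value below (b - a)/3. It is therefore at least 5/12 (b - a).
  set r := 6 / 7 * (b - a)
  have hr : 0 < r := by positivity
  have hrR : r < 7 / 8 * (b - a) := by simp only [r]; linarith
  have hcl : closedBall p.1 r ⊆ ball p.1 (7 / 8 * (b - a)) := closedBall_subset_ball hrR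
  have hdc : DiffContOnCl ℂ (fun z => H (z, p.2)) (ball p.1 r) := by
    refine DifferentiableOn.diffContOnCl ?_
    rw [closure_ball _ hr.ne']
    exact (slice_fst_ball ha hab.le hb hH hp).mono hcl
  refine Complex.norm_le_of_forall_mem_frontier_norm_le isBounded_ball hdc (fun z hz => ?_)
    (subset_closure (mem_ball_self hr))
  rw [frontier_ball _ hr.ne', mem_sphere, dist_eq_norm] at hz
  refine key (z, p.2) (fst_step_mem_Dh ha hab.le hb hp
    (hcl (by rw [mem_closedBall, dist_eq_norm, hz]))) ?_
  have hw : 7 / 8 ≤ ‖p.2‖ := by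
    have h1 := (mem_Dh.1 hpb).2.1.1
    linarith [one_sub_le_rho (ha.trans hab)]
  have e : (z - p.1) * p.2 = (1 - p.1 * p.2) - (1 - z * p.2) := by ring
  have h3 := norm_sub_le (1 - p.1 * p.2) (1 - z * p.2)
  rw [← e, norm_mul, hz] at h3
  have : r * (7 / 8) ≤ r * ‖p.2‖ := by gcongr
  simp only [r] at this h3 ⊢
  linarith

end PlanarOP

end

open Filter Topology

noncomputable section

namespace PlanarOP

open Metric Set ComplexConjugate

/-! ### Laurent splitting -/

/-- The Cauchy integral of `G` over the circle of radius `r` about the origin. -/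
def cauchyInt (G : ℂ → ℂ) (r : ℝ) (z : ℂ) : ℂ :=
  (2 * Real.pi * Complex.I : ℂ)⁻¹ • ∮ η in C(0, r), (η - z)⁻¹ • G η

theorem sphere_sub_ne_zero {r : ℝ} {z η : ℂ} (hη : η ∈ sphere (0 : ℂ) r) (hz : ‖z‖ ≠ r) :
    η - z ≠ 0 := fun h => hz (by rw [← sub_eq_zero.1 h]; simpa using hη)

theorem norm_cauchyInt_le {G : ℂ → ℂ} {r M : ℝ} {z : ℂ} (hz : ‖z‖ < r)
    (hM : ∀ η ∈ sphere (0 : ℂ) r, ‖G η‖ ≤ M) : ‖cauchyInt G r z‖ ≤ r * (M / (r - ‖z‖)) := by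
  have hr : 0 < r := (norm_nonneg z).trans_lt hz
  refine circleIntegral.norm_two_pi_i_inv_smul_integral_le_of_norm_le_const hr.le fun η hη => ?_
  have h1 : r - ‖z‖ ≤ ‖η - z‖ := by
    have := norm_sub_norm_le η z
    rw [mem_sphere_zero_iff_norm] at hη
    rwa [hη] at this
  have h2 : 0 < r - ‖z‖ := sub_pos.2 hz
  rw [norm_smul, norm_inv, div_eq_inv_mul]
  exact mul_le_mul (inv_anti₀ h2 h1) (hM η hη) (norm_nonneg _) (inv_nonneg.2 h2.le)

theorem cauchyInt_radius {G : ℂ → ℂ} {s r : ℝ} {z : ℂ} (hs : 0 < s) (hsr : s ≤ r) (hz : ‖z‖ < s)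
    (hG : DifferentiableOn ℂ G {η | s ≤ ‖η‖ ∧ ‖η‖ ≤ r}) : cauchyInt G r z = cauchyInt G s z := by
  unfold cauchyInt
  congr 1
  have hd : DifferentiableOn ℂ (fun η => (η - z)⁻¹ • G η) {η | s ≤ ‖η‖ ∧ ‖η‖ ≤ r} := fun η hη =>
    ((differentiableWithinAt_id.sub_const z).inv
      (sub_ne_zero.2 fun h => by
        have h : η = z := h
        rw [← h] at hz; exact absurd hη.1 (not_le.2 hz))).smul (hG η hη)
  have hsub : closedBall (0 : ℂ) r \ ball 0 s = {η | s ≤ ‖η‖ ∧ ‖η‖ ≤ r} := by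
    ext η; simp [and_comm]
  refine Complex.circleIntegral_eq_of_differentiable_on_annulus_off_countable hs hsr countable_empty
    (hsub ▸ hd.continuousOn) fun η hη => ?_
  have hη' : s < ‖η‖ ∧ ‖η‖ < r := by simpa [and_comm] using hη
  refine hd.differentiableAt ?_
  filter_upwards [(isOpen_lt continuous_const continuous_norm).mem_nhds hη'.1,
    (isOpen_lt continuous_norm continuous_const).mem_nhds hη'.2] with y h1 h2 using ⟨h1.le, h2.le⟩

theorem differentiableOn_cauchyInt {G : ℂ → ℂ} {r : ℝ} (hr : 0 < r)
    (hG : ContinuousOn G (sphere 0 r)) : DifferentiableOn ℂ (cauchyInt G r) (ball 0 r) := by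
  have hi : CircleIntegrable G 0 r := hG.circleIntegrable hr.le
  lift r to NNReal using hr.le
  have := (hasFPowerSeriesOn_cauchy_integral hi (by exact_mod_cast hr)).analyticOnNhd.differentiableOn
  rwa [Metric.eball_coe] at this

/-- The part of the Laurent series with nonnegative powers, on a disc. -/
theorem exists_cauchy_plus {G : ℂ → ℂ} {ρ R : ℝ} (hρ : 0 < ρ) (hρ1 : ρ < 1) (hR : 1 < R)
    (hG : DifferentiableOn ℂ G {η | ρ < ‖η‖ ∧ ‖η‖ < R}) :
    ∃ g : ℂ → ℂ, DifferentiableOn ℂ g (ball 0 R) ∧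
      ∀ r z, ρ < r → r < R → ‖z‖ < r → g z = cauchyInt G r z := by
  have hr1 : ∀ z : ℂ, ‖z‖ < R → 1 ≤ max 1 ((‖z‖ + R) / 2) ∧ max 1 ((‖z‖ + R) / 2) < R ∧
      ‖z‖ < max 1 ((‖z‖ + R) / 2) := fun z hz =>
    ⟨le_max_left _ _, max_lt hR (by linarith), lt_max_of_lt_right (by linarith)⟩
  have hind : ∀ s r z, ρ < s → s ≤ r → r < R → ‖z‖ < s → cauchyInt G r z = cauchyInt G s z :=
    fun s r z h1 h2 h3 h4 => cauchyInt_radius (hρ.trans h1) h2 h4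
      (hG.mono fun η hη => ⟨h1.trans_le hη.1, hη.2.trans_lt h3⟩)
  have hval : ∀ r z, ρ < r → r < R → ‖z‖ < r →
      cauchyInt G (max 1 ((‖z‖ + R) / 2)) z = cauchyInt G r z := by
    intro r z h1 h2 h3
    obtain ⟨k1, k2, k3⟩ := hr1 z (h3.trans h2)
    rcases le_total r (max 1 ((‖z‖ + R) / 2)) with h | h
    · exact hind _ _ z h1 h k2 h3
    · exact (hind _ _ z (hρ1.trans_le k1) h h2 k3).symm
  -- The radius varies with z, but the integral does not depend on it, so near each point the
  -- function agrees with the Cauchy integral over one fixed circle.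
  refine ⟨fun z => cauchyInt G (max 1 ((‖z‖ + R) / 2)) z, fun z hz => ?_, hval⟩
  rw [mem_ball_zero_iff] at hz
  obtain ⟨k1, k2, k3⟩ := hr1 z hz
  set r := max 1 ((‖z‖ + R) / 2)
  have hd := differentiableOn_cauchyInt (G := G) (r := r) (by linarith) (hG.continuousOn.mono
    fun η hη => by
      rw [mem_sphere_zero_iff_norm] at hη
      exact ⟨by rw [hη]; linarith, by rw [hη]; exact k2⟩)
  have hzr : z ∈ ball (0 : ℂ) r := by simpa using k3
  refine (DifferentiableAt.congr_of_eventuallyEq (hd.differentiableAt (isOpen_ball.mem_nhds hzr))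
    ?_).differentiableWithinAt
  filter_upwards [isOpen_ball.mem_nhds hzr] with y hy
  exact hval r y (by linarith) k2 (by simpa using hy)

theorem cauchyInt_eq_circleAverage {G : ℂ → ℂ} {r : ℝ} {z : ℂ} (hr : 0 < r) :
    cauchyInt G r z = Real.circleAverage (fun η => η * ((η - z)⁻¹ * G η)) 0 r := by
  rw [Real.circleAverage_eq_circleIntegral hr.ne', cauchyInt]
  congr 1
  refine circleIntegral.integral_congr hr.le fun η hη => ?_
  have : η ≠ 0 := by
    rintro rfl
    simp at hη; exact hr.ne hη
  simp [this]

/-- The substitution η ↦ 1/η turns the inner Cauchy integral into an outer one. The principal part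
is thus treated by the same lemma as the regular part. -/
theorem cauchyInt_inv {G : ℂ → ℂ} {s : ℝ} {z : ℂ} (hs : 0 < s) (hz : s < ‖z‖) :
    z⁻¹ * cauchyInt (fun ξ => ξ⁻¹ * G ξ⁻¹) s⁻¹ z⁻¹ = - cauchyInt G s z := by
  rw [cauchyInt_eq_circleAverage (inv_pos.2 hs), cauchyInt_eq_circleAverage hs,
    Real.circleAverage_eq_circleAverage_zero_one, Real.circleAverage_eq_circleAverage_zero_one (R := s),
    ← Real.circleAverage_zero_one_congr_inv, ← smul_eq_mul, ← Real.circleAverage_fun_smul,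
    ← neg_one_smul ℂ, ← Real.circleAverage_fun_smul]
  refine Real.circleAverage_congr_sphere fun η hη => ?_
  have hη1 : ‖η‖ = 1 := by simpa using hη
  have hη0 : η ≠ 0 := norm_ne_zero_iff.1 (by rw [hη1]; exact one_ne_zero)
  have hs0 : (s : ℂ) ≠ 0 := by exact_mod_cast hs.ne'
  have hz0 : z ≠ 0 := norm_ne_zero_iff.1 (hs.trans hz).ne'
  have h1 : (s : ℂ) * η - z ≠ 0 := fun h => by
    have := congrArg norm (sub_eq_zero.1 h)
    rw [norm_mul, hη1, mul_one, Complex.norm_of_nonneg hs.le] at this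
    exact hz.ne this
  have h2 : z - (s : ℂ) * η ≠ 0 := by rw [← neg_sub]; exact neg_ne_zero.2 h1
  have e : ((s⁻¹ : ℝ) : ℂ) * η⁻¹ + 0 = ((s : ℂ) * η)⁻¹ := by push_cast; rw [mul_inv, add_zero]
  simp only [smul_eq_mul, e, inv_inv, add_zero]
  have e3 : ((s : ℂ) * η)⁻¹ - z⁻¹ = (z - s * η) / (s * η * z) := by field_simp
  rw [e3, show (s : ℂ) * η - z = -(z - s * η) by ring]
  field_simp

/-- Laurent splitting on the annulus, in a form symmetric under inversion. -/
theorem exists_laurent_split {σ : ℝ} (hσ : 0 < σ) (hσ1 : σ ≤ 1 / 8) {G : ℂ → ℂ}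
    (hG : DifferentiableOn ℂ G (annulus σ)) :
    ∃ g h : ℂ → ℂ, DifferentiableOn ℂ g (ball 0 (rho σ)⁻¹) ∧ DifferentiableOn ℂ h (ball 0 (rho σ)⁻¹) ∧
      (∀ z ∈ annulus σ, G z = g z + h z⁻¹) ∧
      ∀ M, (∀ z ∈ annulus σ, ‖G z‖ ≤ M) → ∀ z ∈ annulus σ, ‖g z‖ ≤ 2 * M / σ ∧ ‖h z‖ ≤ 2 * M / σ := by
  have hρ := rho_pos hσ
  have hρ1 := rho_lt_one hσ
  have hR := one_lt_rho_inv hσ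
  have hσR : 1 + σ < (rho σ)⁻¹ := by
    rw [rho_inv]
    have : 1 < √(1 + σ ^ 2) := by
      rw [Real.lt_sqrt zero_le_one]; nlinarith [sq_pos_of_pos hσ]
    linarith
  obtain ⟨g, hg, hgC⟩ := exists_cauchy_plus hρ hρ1 hR hG
  set G' : ℂ → ℂ := fun ξ => ξ⁻¹ * G ξ⁻¹
  have hG' : DifferentiableOn ℂ G' (annulus σ) := by
    have h1 : DifferentiableOn ℂ (fun ξ : ℂ => ξ⁻¹) (annulus σ) := fun x hx =>
      (differentiableAt_inv (ne_zero_of_mem_annulus hσ hx)).differentiableWithinAt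
    exact h1.mul (hG.comp h1 fun x hx => inv_mem_annulus hσ hx)
  obtain ⟨k, hk, hkC⟩ := exists_cauchy_plus hρ hρ1 hR hG'
  have hsplit : ∀ z ∈ annulus σ, G z = g z + z⁻¹ * k z⁻¹ := by
    intro z hz
    obtain ⟨s, hs1, hs2⟩ := exists_between hz.1
    obtain ⟨r, hr1, hr2⟩ := exists_between hz.2
    have hs0 : 0 < s := hρ.trans hs1
    have hr0 : 0 < r := (norm_nonneg z).trans_lt hr1
    have hz0 := ne_zero_of_mem_annulus hσ hz
    have hkz : k z⁻¹ = cauchyInt G' s⁻¹ z⁻¹ := by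
      refine hkC _ _ ?_ ((inv_lt_inv₀ hs0 hρ).2 hs1) ?_
      · have : s < (rho σ)⁻¹ := (hs2.trans hr1).trans hr2
        have := (inv_lt_inv₀ (inv_pos.2 hρ) hs0).2 this
        rwa [inv_inv] at this
      · rw [norm_inv]; exact (inv_lt_inv₀ (norm_pos_iff.2 hz0) hs0).2 hs2
    rw [hkz, cauchyInt_inv hs0 hs2, hgC r z (hz.1.trans hr1) hr2 hr1]
    -- Cauchy's theorem for the difference quotient
    have hsubA : {η : ℂ | s ≤ ‖η‖ ∧ ‖η‖ ≤ r} ⊆ annulus σ := fun η hη =>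
      ⟨hs1.trans_le hη.1, hη.2.trans_lt hr2⟩
    have hds : DifferentiableOn ℂ (dslope G z) (annulus σ) :=
      (Complex.differentiableOn_dslope ((isOpen_annulus σ).mem_nhds hz)).2 hG
    have hcirc : (∮ η in C(0, r), dslope G z η) = ∮ η in C(0, s), dslope G z η := by
      refine Complex.circleIntegral_eq_of_differentiable_on_annulus_off_countable hs0
        (hs2.trans hr1).le countable_empty (hds.continuousOn.mono fun η hη => hsubA ?_) fun η hη => ?_
      · simpa [and_comm] using hη
      · have hη' : s < ‖η‖ ∧ ‖η‖ < r := by simpa [and_comm] using hη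
        exact hds.differentiableAt ((isOpen_annulus σ).mem_nhds (hsubA ⟨hη'.1.le, hη'.2.le⟩))
    have hex : ∀ t, 0 < t → rho σ < t → t < (rho σ)⁻¹ → ‖z‖ ≠ t → (∮ η in C(0, t), dslope G z η)
        = (∮ η in C(0, t), (η - z)⁻¹ • G η) - (∮ η in C(0, t), (η - z)⁻¹) * G z := by
      intro t ht ht1 ht2 htz
      have c1 : ContinuousOn (fun η : ℂ => (η - z)⁻¹) (sphere 0 t) :=
        (continuousOn_id.sub continuousOn_const).inv₀ fun η hη => sphere_sub_ne_zero hη htz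
      have c2 : ContinuousOn G (sphere 0 t) := hG.continuousOn.mono fun η hη => by
        rw [mem_sphere_zero_iff_norm] at hη
        exact ⟨by rwa [hη], by rwa [hη]⟩
      have c3 : ContinuousOn (fun η : ℂ => G z • (η - z)⁻¹) (sphere 0 t) := c1.const_smul (G z)
      have c4 : ContinuousOn (fun η : ℂ => (η - z)⁻¹ • G η) (sphere 0 t) := c1.smul c2
      rw [mul_comm, ← smul_eq_mul, ← circleIntegral.integral_smul, ← circleIntegral.integral_sub
        (c4.circleIntegrable ht.le) (c3.circleIntegrable ht.le)]
      refine circleIntegral.integral_congr ht.le fun η hη => ?_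
      have hne : η ≠ z := sub_ne_zero.1 (sphere_sub_ne_zero hη htz)
      rw [dslope_of_ne _ hne, slope_def_field, smul_eq_mul, smul_eq_mul]
      have := sphere_sub_ne_zero hη htz
      field_simp
    rw [hex r hr0 (hz.1.trans hr1) hr2 hr1.ne, hex s hs0 hs1 ((hs2.trans hr1).trans hr2) hs2.ne'] at hcirc
    have i1 : (∮ η in C(0, r), (η - z)⁻¹) = 2 * Real.pi * Complex.I :=
      circleIntegral.integral_sub_inv_of_mem_ball (by simpa using hr1)
    have i2 : (∮ η in C(0, s), (η - z)⁻¹) = 0 := by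
      refine DiffContOnCl.circleIntegral_eq_zero hs0.le (DifferentiableOn.diffContOnCl ?_)
      rw [closure_ball _ hs0.ne']
      exact (differentiableOn_id.sub_const z).inv fun η hη => sub_ne_zero.2 fun h => by
        have h : η = z := h
        rw [h] at hη; simp at hη; linarith
    rw [i1, i2] at hcirc
    have hpi : (2 * Real.pi * Complex.I : ℂ) ≠ 0 := Complex.two_pi_I_ne_zero
    simp only [cauchyInt, smul_eq_mul] at hcirc ⊢
    generalize (∮ (η : ℂ) in C(0, r), (η - z)⁻¹ * G η) = I1 at hcirc ⊢
    generalize (∮ (η : ℂ) in C(0, s), (η - z)⁻¹ * G η) = I2 at hcirc ⊢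
    field_simp
    linear_combination -hcirc
  -- The factor u puts the constant term of the Laurent series into g.
  refine ⟨g, fun u => u * k u, hg, differentiableOn_id.mul hk, hsplit, fun M hM => ?_⟩
  have hM0 : 0 ≤ M := (norm_nonneg _).trans (hM 1 (mem_annulus_of_norm_one hσ (by simp)))
  have sph : ∀ η ∈ sphere (0 : ℂ) (1 + σ), η ∈ annulus σ := fun η hη => by
    rw [mem_sphere_zero_iff_norm] at hη
    exact ⟨by rw [hη]; linarith, by rw [hη]; exact hσR⟩
  have hMσ : M ≤ 1 / 8 * (M / σ) := by
    rw [← mul_div_assoc, le_div_iff₀ hσ]; nlinarith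
  have hMσ0 : 0 ≤ M / σ := by positivity
  -- Inside the closed unit disc the circle of radius 1 + σ stays at distance at least σ, which
  -- gives a bound of order M/σ. Outside it, each part is G minus the other part, and the other part
  -- is evaluated at a point of the disc.
  have hg1 : ∀ z : ℂ, ‖z‖ ≤ 1 → ‖g z‖ ≤ 9 / 8 * (M / σ) := fun z hz => by
    rw [hgC (1 + σ) z (by linarith) hσR (by linarith)]
    refine (norm_cauchyInt_le (by linarith) fun η hη => hM η (sph η hη)).trans ?_
    have h0 : 0 ≤ M / (1 + σ - ‖z‖) := div_nonneg hM0 (by linarith)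
    gcongr <;> linarith
  have hk1 : ∀ z : ℂ, ‖z‖ ≤ 1 → ‖z * k z‖ ≤ M / σ := fun z hz => by
    rw [norm_mul, hkC (1 + σ) z (by linarith) hσR (by linarith)]
    have := norm_cauchyInt_le (z := z) (G := G') (r := 1 + σ) (M := M / (1 + σ)) (by linarith) fun η hη => by
      have h1 := hM _ (inv_mem_annulus hσ (sph η hη))
      rw [mem_sphere_zero_iff_norm] at hη
      simp only [G', norm_mul, norm_inv, hη]
      rw [div_eq_inv_mul]
      gcongr
    have h2 : 1 * ((1 + σ) * (M / (1 + σ) / (1 + σ - ‖z‖))) = M / (1 + σ - ‖z‖) := by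
      have : 1 + σ - ‖z‖ ≠ 0 := by linarith
      field_simp
    refine (mul_le_mul hz this (norm_nonneg _) zero_le_one).trans (h2.le.trans ?_)
    gcongr
    linarith
  intro z hz
  have hz0 := ne_zero_of_mem_annulus hσ hz
  have hzi := inv_mem_annulus hσ hz
  have e : 2 * M / σ = 2 * (M / σ) := by ring
  rw [e]
  rcases le_total ‖z‖ 1 with h | h
  · exact ⟨by linarith [hg1 z h], by linarith [hk1 z h]⟩
  · have hi : ‖z⁻¹‖ ≤ 1 := by rw [norm_inv]; exact inv_le_one_of_one_le₀ h
    have a1 := hk1 _ hi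
    have a2 := hg1 _ hi
    constructor
    · have : g z = G z - z⁻¹ * k z⁻¹ := by rw [hsplit z hz]; ring
      rw [this]
      linarith [norm_sub_le (G z) (z⁻¹ * k z⁻¹), hM z hz]
    · have := hsplit _ hzi
      rw [inv_inv] at this
      have : z * k z = G z⁻¹ - g z⁻¹ := by rw [this]; ring
      simp only
      rw [this]
      linarith [norm_sub_le (G z⁻¹) (g z⁻¹), hM _ hzi]

end PlanarOP

end

open Filter Topology

noncomputable section

namespace PlanarOP

open Metric Set ComplexConjugate

/-! ### The Poisson extension in terms of a Laurent splitting -/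

theorem isPreconnected_norm_gt {s : ℝ} (hs : 0 < s) : IsPreconnected {ζ : ℂ | s < ‖ζ‖} := by
  have : {ζ : ℂ | s < ‖ζ‖} = Complex.exp '' {a | Real.log s < a.re} := by
    ext ζ
    simp only [mem_ofPred_eq, mem_image]
    constructor
    · intro h
      have h0 : 0 < ‖ζ‖ := hs.trans h
      exact ⟨Complex.log ζ, by rw [Complex.log_re]; exact Real.log_lt_log hs h,
        Complex.exp_log (norm_pos_iff.1 h0)⟩
    · rintro ⟨a, ha, rfl⟩
      rw [Complex.norm_exp]
      exact (Real.log_lt_iff_lt_exp hs).1 ha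
  rw [this]
  exact (convex_halfSpace_re_gt _).isPreconnected.image _ Complex.continuous_exp.continuousOn

/-- The exterior kernel at ζ is the interior Poisson kernel at the reflected point w = 1/conj ζ. The
interior formula reproduces g at w. For h(1/η), the change η ↦ 1/η conjugates the point and gives
the value at conj w = 1/ζ. -/
theorem poissonExt_eq {R : ℝ} (hR : 1 < R) {f g h : ℂ → ℂ} (hg : DifferentiableOn ℂ g (ball 0 R))
    (hh : DifferentiableOn ℂ h (ball 0 R)) (hf : ∀ c : ℂ, ‖c‖ = 1 → f c = g c + h c⁻¹) {ζ : ℂ}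
    (hζ : 1 < ‖ζ‖) : poissonExt f ζ = h ζ⁻¹ + g (conj ζ)⁻¹ := by
  have hζ0 : 0 < ‖ζ‖ := zero_lt_one.trans hζ
  have hcl : closedBall (0 : ℂ) 1 ⊆ ball 0 R := closedBall_subset_ball hR
  have hdc : ∀ k : ℂ → ℂ, DifferentiableOn ℂ k (ball 0 R) → DiffContOnCl ℂ k (ball 0 1) := fun k hk => by
    refine DifferentiableOn.diffContOnCl ?_
    rw [closure_ball _ one_ne_zero]; exact hk.mono hcl
  set w : ℂ := (conj ζ)⁻¹
  have hw : w ∈ ball (0 : ℂ) 1 := by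
    rw [mem_ball_zero_iff, norm_inv, Complex.norm_conj]; exact inv_lt_one_of_one_lt₀ hζ
  have hcw : conj w = ζ⁻¹ := by simp [w]
  have hcwm : conj w ∈ ball (0 : ℂ) 1 := by simpa using hw
  have hker : ∀ η : ℂ, ‖η‖ = 1 → ((‖ζ‖ ^ 2 - 1) / ‖η - ζ‖ ^ 2 : ℝ) = poissonKernel 0 w η := by
    intro η hη
    have hη0 : η ≠ 0 := norm_ne_zero_iff.1 (by rw [hη]; exact one_ne_zero)
    have e : ‖η - w‖ = ‖η - ζ‖ / ‖ζ‖ := by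
      have : conj (η - w) = -(η - ζ) / (η * ζ) := by
        rw [map_sub, hcw, conj_eq_inv hη]
        have : ζ ≠ 0 := norm_pos_iff.1 hζ0
        field_simp
        ring
      rw [← Complex.norm_conj, this, norm_div, norm_neg, norm_mul, hη, one_mul]
    have hw' : ‖w‖ = ‖ζ‖⁻¹ := by simp [w]
    have : ‖η - ζ‖ ≠ 0 := norm_ne_zero_iff.2 (sub_ne_zero.2 (by rintro rfl; linarith))
    simp only [poissonKernel, sub_zero]
    rw [e, hη, hw']
    field_simp
  have hker2 : ∀ η : ℂ, ‖η‖ = 1 → poissonKernel 0 w η⁻¹ = poissonKernel 0 (conj w) η := by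
    intro η hη
    have : ‖η⁻¹ - w‖ = ‖η - conj w‖ := by
      rw [← Complex.norm_conj, map_sub, ← conj_eq_inv hη, Complex.conj_conj]
    simp only [poissonKernel, sub_zero, this, norm_inv, hη, Complex.norm_conj, inv_one]
  have i1 := (hdc g hg).circleAverage_poissonKernel_smul hw
  have i2 := (hdc h hh).circleAverage_poissonKernel_smul hcwm
  have hKc : ContinuousOn (poissonKernel 0 w) (sphere 0 1) := by
    unfold poissonKernel
    refine ContinuousOn.div (by fun_prop) (by fun_prop) fun η hη => ?_
    simp only [sub_zero]
    exact pow_ne_zero _ (norm_ne_zero_iff.2 (sphere_sub_ne_zero hη (by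
      rw [mem_ball_zero_iff] at hw; exact hw.ne)))
  have hgc : ContinuousOn g (sphere 0 1) := hg.continuousOn.mono (sphere_subset_closedBall.trans hcl)
  have hhc : ContinuousOn (fun η => h η⁻¹) (sphere 0 1) := by
    refine hh.continuousOn.comp (continuousOn_id.inv₀ fun x hx => ?_) fun x hx => ?_
    · simp only [id]; rintro rfl; simp at hx
    · apply hcl; rw [mem_sphere_zero_iff_norm] at hx
      simp [hx]
  have e1 : poissonExt f ζ = Real.circleAverage
      (fun η => poissonKernel 0 w η • g η + poissonKernel 0 w η • h η⁻¹) 0 1 := by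
    refine Real.circleAverage_congr_sphere fun η hη => ?_
    have hη1 : ‖η‖ = 1 := by simpa using hη
    rw [hker η hη1, hf η hη1, smul_add]
  have c1 : ContinuousOn (fun η => poissonKernel 0 w η • g η) (sphere 0 1) := hKc.smul hgc
  have c2 : ContinuousOn (fun η => poissonKernel 0 w η • h η⁻¹) (sphere 0 1) := hKc.smul hhc
  rw [e1, Real.circleAverage_fun_add (c1.circleIntegrable zero_le_one)
    (c2.circleIntegrable zero_le_one), add_comm, ← hcw]
  refine congrArg₂ (· + ·) ?_ i1
  rw [← i2, ← Real.circleAverage_zero_one_congr_inv]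
  refine Real.circleAverage_congr_sphere fun η hη => ?_
  have hη1 : ‖η‖ = 1 := by simpa using hη
  simp only [inv_inv, hker2 η hη1, Pi.smul_apply']

/-- The first summand is holomorphic in ζ and the second antiholomorphic: the conjugate of g(1/conj
ζ) is holomorphic. -/
theorem harmonicOnNhd_split {R : ℝ} (hR : 1 < R) {g h : ℂ → ℂ} (hg : DifferentiableOn ℂ g (ball 0 R))
    (hh : DifferentiableOn ℂ h (ball 0 R)) :
    InnerProductSpace.HarmonicOnNhd (fun ζ => h ζ⁻¹ + g (conj ζ)⁻¹) {ζ | R⁻¹ < ‖ζ‖} := by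
  intro ζ hζ
  have hR0 : 0 < R := zero_lt_one.trans hR
  have hζ' : R⁻¹ < ‖ζ‖ := hζ
  have hζ0 : 0 < ‖ζ‖ := (inv_pos.2 hR0).trans hζ'
  have hζne := norm_pos_iff.1 hζ0
  have hin : ζ⁻¹ ∈ ball (0 : ℂ) R := by
    rw [mem_ball_zero_iff, norm_inv]; exact inv_lt_of_inv_lt₀ hR0 hζ'
  have hinv : AnalyticAt ℂ (fun ζ : ℂ => ζ⁻¹) ζ := analyticAt_inv hζne
  have key : ∀ k : ℂ → ℂ, DifferentiableOn ℂ k (ball 0 R) → AnalyticAt ℂ (fun ζ => k ζ⁻¹) ζ :=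
    fun k hk => (hk.analyticAt (isOpen_ball.mem_nhds hin)).fun_comp hinv
  have hgc : DifferentiableOn ℂ (conj ∘ g ∘ conj) (ball 0 R) := fun x hx => by
    have hx' : conj x ∈ ball (0 : ℂ) R := by simpa using hx
    have := (hg.differentiableAt (isOpen_ball.mem_nhds hx')).conj_conj
    rw [Complex.conj_conj] at this
    exact this.differentiableWithinAt
  have h2 := (key _ hgc).harmonicAt.comp_CLM (Complex.conjCLE : ℂ →L[ℝ] ℂ)
  have e : ((Complex.conjCLE : ℂ →L[ℝ] ℂ) ∘ fun ζ => (conj ∘ g ∘ conj) ζ⁻¹) = fun ζ => g (conj ζ)⁻¹ := by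
    ext x; simp
  rw [e] at h2
  exact (key h hh).harmonicAt.add h2

/-- Identity principle for real-analytic functions on a connected region, applied to real and
imaginary parts. -/
theorem eqOn_of_harmonic {u v : ℂ → ℂ} {s : ℝ} (hs : 0 < s)
    (hu : InnerProductSpace.HarmonicOnNhd u {ζ | s < ‖ζ‖})
    (hv : InnerProductSpace.HarmonicOnNhd v {ζ | s < ‖ζ‖}) (huv : ∀ ζ, 1 < ‖ζ‖ → u ζ = v ζ)
    {ζ : ℂ} (hζ : s < ‖ζ‖) : u ζ = v ζ := by
  obtain ⟨t, ht⟩ : ∃ t : ℝ, max s 1 < t := ⟨_, lt_add_one _⟩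
  have ht0 : 0 < t := hs.trans ((le_max_left _ _).trans_lt ht)
  have key : ∀ l : ℂ →L[ℝ] ℝ, l (u ζ) = l (v ζ) := by
    intro l
    have ha : ∀ k : ℂ → ℂ, InnerProductSpace.HarmonicOnNhd k {ζ | s < ‖ζ‖} →
        AnalyticOnNhd ℝ (l ∘ k) {ζ | s < ‖ζ‖} := fun k hk x hx => HarmonicAt.analyticAt ((hk x hx).comp_CLM l)
    refine (ha u hu).eqOn_of_preconnected_of_eventuallyEq (ha v hv) (isPreconnected_norm_gt hs)
      (z₀ := (t : ℂ)) ?_ ?_ hζ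
    · simp only [mem_ofPred_eq, Complex.norm_of_nonneg ht0.le]
      exact (le_max_left _ _).trans_lt ht
    · have h1 : 1 < ‖(t : ℂ)‖ := by
        rw [Complex.norm_of_nonneg ht0.le]; exact (le_max_right _ _).trans_lt ht
      filter_upwards [(isOpen_lt continuous_const continuous_norm).mem_nhds h1] with x hx
      simp [huv x hx]
  exact Complex.ext (key Complex.reCLM) (key Complex.imCLM)

/-- Inside the unit circle `P` is a choice among harmonic continuations. The explicit formula is one
of them, and uniqueness of the continuation identifies the chosen value with it. -/
theorem ExteriorData.P_eq (D : ExteriorData) {R : ℝ} (hR : 1 < R) {f g h : ℂ → ℂ}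
    (hg : DifferentiableOn ℂ g (ball 0 R)) (hh : DifferentiableOn ℂ h (ball 0 R))
    (hf : ∀ c : ℂ, ‖c‖ = 1 → f (D.psi c) = g c + h c⁻¹) {x : ℂ} (hx : R⁻¹ < ‖D.φ x‖) :
    D.P f x = h (D.φ x)⁻¹ + g (conj (D.φ x))⁻¹ := by
  unfold ExteriorData.P
  have hext : ∀ ζ : ℂ, 1 < ‖ζ‖ → h ζ⁻¹ + g (conj ζ)⁻¹ = poissonExt (f ∘ D.psi) ζ := fun ζ hζ =>
    (poissonExt_eq hR hg hh hf hζ).symm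
  split_ifs with h1
  · exact (hext _ h1).symm
  · have hex : ∃ y : ℂ, ∃ (r : ℝ) (u : ℂ → ℂ), r < ‖D.φ x‖ ∧
        InnerProductSpace.HarmonicOnNhd u {ζ | r < ‖ζ‖} ∧
        (∀ ζ, 1 < ‖ζ‖ → u ζ = poissonExt (f ∘ D.psi) ζ) ∧ y = u (D.φ x) :=
      ⟨_, R⁻¹, _, hx, harmonicOnNhd_split hR hg hh, hext, rfl⟩
    obtain ⟨r, u, hr, hu, hu1, hy⟩ := Classical.epsilon_spec hex
    rw [hy]
    refine eqOn_of_harmonic (v := fun ζ => h ζ⁻¹ + g (conj ζ)⁻¹) (s := max r R⁻¹)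
      (lt_max_of_lt_right (inv_pos.2 (zero_lt_one.trans hR)))
      (hu.mono fun ζ hζ => (le_max_left r R⁻¹).trans_lt hζ)
      ((harmonicOnNhd_split hR hg hh).mono fun ζ hζ => (le_max_right r R⁻¹).trans_lt hζ)
      (fun ζ hζ => (hu1 ζ hζ).trans (hext ζ hζ).symm) (max_lt hr hx)

end PlanarOP

end

open Filter Topology

noncomputable section

namespace PlanarOP

open Metric Set ComplexConjugate

/-! ### Complexification of real-analytic functions near the unit circle -/

/-- The complexified homogeneous term of a power series, in the variables `z` and `conj z`. -/
def complexTerm (p : FormalMultilinearSeries ℝ ℂ ℂ) (n : ℕ) (u v : ℂ) : ℂ :=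
  ∑ s : Fin n → Bool, (∏ i, if s i then (u + v) / 2 else (u - v) / (2 * Complex.I)) *
    p n fun i => if s i then 1 else Complex.I

/-- At v = conj u the two complex coordinates are the real and imaginary parts of u, so the sum is
the multilinear expansion over the real basis 1, i. -/
theorem complexTerm_conj (p : FormalMultilinearSeries ℝ ℂ ℂ) (n : ℕ) (u : ℂ) :
    complexTerm p n u (conj u) = p n fun _ => u := by
  have e1 : (u + conj u) / 2 = (u.re : ℂ) := by rw [Complex.add_conj]; simp
  have e2 : (u - conj u) / (2 * Complex.I) = (u.im : ℂ) := by
    rw [Complex.sub_conj]; push_cast; field_simp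
  have hu : (fun _ : Fin n => u) = fun _ => ∑ t : Bool,
      (if t then u.re else u.im) • (if t then (1 : ℂ) else Complex.I) := by
    ext i; simp
  rw [hu, ContinuousMultilinearMap.map_sum]
  unfold complexTerm
  refine Finset.sum_congr rfl fun s _ => ?_
  rw [e1, e2, ContinuousMultilinearMap.map_smul_univ, Complex.real_smul, Complex.ofReal_prod]
  congr 1
  refine Finset.prod_congr rfl fun i _ => ?_
  split_ifs <;> rfl

/-- There are 2ⁿ terms, each at most δⁿ‖p n‖. The polydisc of convergence therefore has half the
real radius. -/
theorem norm_complexTerm_le (p : FormalMultilinearSeries ℝ ℂ ℂ) (n : ℕ) {u v : ℂ} {δ : ℝ}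
    (hu : ‖u‖ ≤ δ) (hv : ‖v‖ ≤ δ) : ‖complexTerm p n u v‖ ≤ ‖p n‖ * (2 * δ) ^ n := by
  have hδ : 0 ≤ δ := (norm_nonneg u).trans hu
  have h1 : ‖(u + v) / 2‖ ≤ δ := by
    rw [norm_div, Complex.norm_ofNat, div_le_iff₀ two_pos]; linarith [norm_add_le u v]
  have h2 : ‖(u - v) / (2 * Complex.I)‖ ≤ δ := by
    rw [norm_div, norm_mul, Complex.norm_ofNat, Complex.norm_I, mul_one, div_le_iff₀ two_pos]
    linarith [norm_sub_le u v]
  have h3 : ∀ s : Fin n → Bool, ‖(∏ i, if s i then (u + v) / 2 else (u - v) / (2 * Complex.I)) *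
      p n fun i => if s i then 1 else Complex.I‖ ≤ δ ^ n * ‖p n‖ := fun s => by
    rw [norm_mul, norm_prod]
    have a1 : ∏ i, ‖if s i then (u + v) / 2 else (u - v) / (2 * Complex.I)‖ ≤ δ ^ n := by
      refine (Finset.prod_le_prod (fun i _ => norm_nonneg _) fun i _ => ?_).trans_eq
        (b := ∏ _i : Fin n, δ) (by simp)
      split_ifs
      exacts [h1, h2]
    have a2 : ‖p n fun i => if s i then 1 else Complex.I‖ ≤ ‖p n‖ := by
      refine ((p n).le_opNorm _).trans_eq ?_
      rw [Finset.prod_eq_one, mul_one]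
      intro i _
      split_ifs <;> simp
    gcongr
  refine (norm_sum_le _ _).trans ((Finset.sum_le_sum fun s _ => h3 s).trans_eq ?_)
  simp [mul_pow]; ring

theorem differentiable_complexTerm (p : FormalMultilinearSeries ℝ ℂ ℂ) (n : ℕ) {a b : ℂ → ℂ}
    (ha : Differentiable ℂ a) (hb : Differentiable ℂ b) :
    Differentiable ℂ fun x => complexTerm p n (a x) (b x) := by
  unfold complexTerm
  refine Differentiable.fun_sum fun s _ => Differentiable.mul_const ?_ _
  refine Differentiable.fun_finsetProd fun i _ => ?_
  split_ifs <;> fun_prop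

/-- A real-analytic function is the restriction of a holomorphic function of `(z, conj z)`. -/
theorem exists_local_complexification {f : ℂ → ℂ} {c : ℂ} (hf : AnalyticAt ℝ f c) :
    ∃ r > 0, ∃ F : ℂ × ℂ → ℂ, DifferentiableOn ℂ F (ball c r ×ˢ ball (conj c) r) ∧
      ∀ z ∈ ball c r, F (z, conj z) = f z := by
  obtain ⟨p, R, hp⟩ := hf
  obtain ⟨t, ht0, htR⟩ := ENNReal.lt_iff_exists_nnreal_btwn.1 hp.r_pos
  have ht : 0 < (t : ℝ) := by exact_mod_cast ht0
  have hsum : Summable fun n => ‖p n‖ * (t : ℝ) ^ n := p.summable_norm_mul_pow (htR.trans_le hp.r_le)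
  set δ : ℝ := t / 2
  have hδ : 2 * δ = t := by simp only [δ]; ring
  have hb : ∀ n u v, ‖u‖ < δ → ‖v‖ < δ → ‖complexTerm p n u v‖ ≤ ‖p n‖ * (t : ℝ) ^ n :=
    fun n u v hu hv => hδ ▸ norm_complexTerm_le p n hu.le hv.le
  have hsubr : ∀ a x : ℂ, x ∈ ball a δ → ‖x - a‖ < δ := fun a x hx => by rwa [← dist_eq_norm]
  refine ⟨δ, by positivity, fun q => ∑' n, complexTerm p n (q.1 - c) (q.2 - conj c), ?_, ?_⟩
  · refine differentiableOn_of_separately fun q hq => ?_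
    obtain ⟨r, hr, hball⟩ := Metric.isOpen_iff.1 (isOpen_ball.prod isOpen_ball) q hq
    rw [← ball_prod_same] at hball
    have hin : ∀ z ∈ ball q.1 r, ∀ w ∈ ball q.2 r, ‖z - c‖ < δ ∧ ‖w - conj c‖ < δ := fun z hz w hw =>
      ⟨hsubr _ _ (hball (mk_mem_prod hz hw)).1, hsubr _ _ (hball (mk_mem_prod hz hw)).2⟩
    refine ⟨r, hr, ∑' n, ‖p n‖ * (t : ℝ) ^ n, fun w hw => ?_, fun z hz => ?_, fun z hz w hw => ?_⟩
    · exact Complex.differentiableOn_tsum_of_summable_norm hsum (fun n =>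
        (differentiable_complexTerm p n (by fun_prop) (by fun_prop)).differentiableOn) isOpen_ball
        fun n z hz => hb n _ _ (hin z hz w hw).1 (hin z hz w hw).2
    · exact Complex.differentiableOn_tsum_of_summable_norm hsum (fun n =>
        (differentiable_complexTerm p n (by fun_prop) (by fun_prop)).differentiableOn) isOpen_ball
        fun n w hw => hb n _ _ (hin z hz w hw).1 (hin z hz w hw).2
    · exact tsum_of_norm_bounded hsum.hasSum fun n => hb n _ _ (hin z hz w hw).1 (hin z hz w hw).2
  · intro z hz
    simp only
    rw [← map_sub]
    simp_rw [complexTerm_conj]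
    have hz' : z - c ∈ Metric.eball (0 : ℂ) R := by
      rw [Metric.mem_eball, edist_zero_right, ← ofReal_norm]
      refine lt_of_lt_of_le ?_ htR.le
      rw [← ENNReal.ofReal_coe_nnreal]
      have := hsubr _ _ hz
      exact (ENNReal.ofReal_lt_ofReal_iff ht).2 (by simp only [δ] at this; linarith)
    have := (hp.hasSum hz').tsum_eq
    rwa [add_sub_cancel] at this

/-- The overlap of two bidiscs is a product of convex lenses, so its slices are connected and two
local extensions of one function agree there. -/
theorem eq_of_eq_antidiag_lens {F G : ℂ × ℂ → ℂ} {a b : ℂ} {δ : ℝ}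
    (hF : DifferentiableOn ℂ F (ball a δ ×ˢ ball (conj a) δ))
    (hG : DifferentiableOn ℂ G (ball b δ ×ˢ ball (conj b) δ))
    (h : ∀ z ∈ ball a δ ∩ ball b δ, F (z, conj z) = G (z, conj z)) {z w : ℂ}
    (hz : z ∈ ball a δ ∩ ball b δ) (hw : w ∈ ball (conj a) δ ∩ ball (conj b) δ) :
    F (z, w) = G (z, w) := by
  set W : Set (ℂ × ℂ) := (ball a δ ∩ ball b δ) ×ˢ (ball (conj a) δ ∩ ball (conj b) δ)
  have hW : IsOpen W := (isOpen_ball.inter isOpen_ball).prod (isOpen_ball.inter isOpen_ball)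
  have hconj : ∀ x y : ℂ, x ∈ ball y δ → conj x ∈ ball (conj y) δ := fun x y hx => by
    rw [mem_ball, dist_eq_norm] at hx ⊢
    rwa [← map_sub, Complex.norm_conj]
  have hslice : {ω | (z, ω) ∈ W} = ball (conj a) δ ∩ ball (conj b) δ := by
    ext ω; simp only [W, mem_ofPred_eq, mem_prod, hz, true_and]
  refine sub_eq_zero.1 (eq_zero_of_antidiag (H := fun p => F p - G p) hW
    ((hF.mono (prod_mono inter_subset_left inter_subset_left)).sub
      (hG.mono (prod_mono inter_subset_right inter_subset_right)))
    (fun x hx => sub_eq_zero.2 (h x hx.1)) ?_ ⟨hz, hconj _ _ hz.1, hconj _ _ hz.2⟩ ⟨hz, hw⟩)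
  rw [hslice]
  exact ((convex_ball _ _).inter (convex_ball _ _)).isPreconnected

/-- A Lebesgue number gives extensions on bidiscs of one radius δ about all points of the circle.
They are glued by using at p the extension centred at the radial projection of p.1; near (c, conj c)
this agrees with the extension centred at c. -/
theorem exists_complexification {f : ℂ → ℂ} (hf : ∀ c : ℂ, ‖c‖ = 1 → AnalyticAt ℝ f c) :
    ∃ F : ℂ × ℂ → ℂ, (∀ᶠ p in 𝓝ˢ circK, DifferentiableAt ℂ F p) ∧
      ∀ c : ℂ, ‖c‖ = 1 → ∀ᶠ z in 𝓝 c, F (z, conj z) = f z := by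
  have hloc : ∀ c : sphere (0 : ℂ) 1, ∃ r > 0, ∃ F : ℂ × ℂ → ℂ,
      DifferentiableOn ℂ F (ball (c : ℂ) r ×ˢ ball (conj (c : ℂ)) r) ∧
      ∀ z ∈ ball (c : ℂ) r, F (z, conj z) = f z := fun c =>
    exists_local_complexification (hf c (by simp))
  choose r hr F hF hFf using hloc
  obtain ⟨δ, hδ, hleb⟩ := lebesgue_number_lemma_of_metric (isCompact_sphere (0 : ℂ) 1)
    (c := fun i : sphere (0 : ℂ) 1 => ball (i : ℂ) (r i)) (fun i => isOpen_ball)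
    (fun c hc => mem_iUnion.2 ⟨⟨c, hc⟩, mem_ball_self (hr _)⟩)
  have hex : ∀ c : ℂ, ∃ G : ℂ × ℂ → ℂ, ‖c‖ = 1 → DifferentiableOn ℂ G (ball c δ ×ˢ ball (conj c) δ) ∧
      ∀ z ∈ ball c δ, G (z, conj z) = f z := by
    intro c
    by_cases hc : ‖c‖ = 1
    · obtain ⟨i, hi⟩ := hleb c (by simpa using hc)
      refine ⟨F i, fun _ => ⟨(hF i).mono (prod_mono hi fun w hw => ?_), fun z hz => hFf i z (hi hz)⟩⟩
      have : conj w ∈ ball c δ := by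
        rw [mem_ball, dist_eq_norm] at hw ⊢
        rwa [← Complex.norm_conj, map_sub, Complex.conj_conj]
      have := hi this
      rw [mem_ball, dist_eq_norm] at this ⊢
      rwa [← Complex.norm_conj, map_sub, Complex.conj_conj]
    · exact ⟨0, fun h => absurd h hc⟩
  choose G hG using hex
  have hnear : ∀ c : ℂ, ‖c‖ = 1 → (fun p : ℂ × ℂ => G (p.1 / ‖p.1‖) p) =ᶠ[𝓝 (c, conj c)] G c := by
    intro c hc
    have hc0 : c ≠ 0 := norm_ne_zero_iff.1 (by rw [hc]; exact one_ne_zero)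
    have hproj : ContinuousAt (fun p : ℂ × ℂ => p.1 / (‖p.1‖ : ℂ)) (c, conj c) := by
      refine ContinuousAt.div (by fun_prop) (by fun_prop) ?_
      simpa using hc0
    have hp0 : (fun p : ℂ × ℂ => p.1 / (‖p.1‖ : ℂ)) (c, conj c) = c := by simp [hc]
    have e1 : ∀ᶠ p : ℂ × ℂ in 𝓝 (c, conj c), ‖p.1 - p.1 / ‖p.1‖‖ < δ := by
      have : ContinuousAt (fun p : ℂ × ℂ => ‖p.1 - p.1 / (‖p.1‖ : ℂ)‖) (c, conj c) :=
        (continuousAt_fst.sub hproj).norm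
      refine this.eventually (gt_mem_nhds ?_)
      simpa [hc] using hδ
    have e2 : ∀ᶠ p : ℂ × ℂ in 𝓝 (c, conj c), ‖p.2 - conj (p.1 / (‖p.1‖ : ℂ))‖ < δ := by
      have : ContinuousAt (fun p : ℂ × ℂ => ‖p.2 - conj (p.1 / (‖p.1‖ : ℂ))‖) (c, conj c) :=
        (continuousAt_snd.sub (Complex.continuous_conj.continuousAt.comp hproj)).norm
      refine this.eventually (gt_mem_nhds ?_)
      simpa [hc] using hδ
    have e3 : ∀ᶠ p : ℂ × ℂ in 𝓝 (c, conj c), p ∈ ball c δ ×ˢ ball (conj c) δ :=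
      (isOpen_ball.prod isOpen_ball).mem_nhds ⟨mem_ball_self hδ, mem_ball_self hδ⟩
    have e4 : ∀ᶠ p : ℂ × ℂ in 𝓝 (c, conj c), p.1 ≠ 0 := continuousAt_fst.eventually_ne hc0
    filter_upwards [e1, e2, e3, e4] with p h1 h2 h3 h4
    have hn : ‖p.1 / (‖p.1‖ : ℂ)‖ = 1 := by
      have := norm_ne_zero_iff.2 h4
      simp [this]
    refine eq_of_eq_antidiag_lens (z := p.1) (w := p.2) (hG _ hn).1 (hG _ hc).1 (fun z hz => ?_)
      ⟨by rwa [mem_ball, dist_eq_norm], h3.1⟩ ⟨by rwa [mem_ball, dist_eq_norm], h3.2⟩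
    rw [(hG _ hn).2 z hz.1, (hG _ hc).2 z hz.2]
  refine ⟨fun p => G (p.1 / ‖p.1‖) p, ?_, fun c hc => ?_⟩
  · rw [eventually_nhdsSet_iff_forall]
    rintro _ ⟨c, hc, rfl⟩
    have hc : ‖c‖ = 1 := by simpa using hc
    have ho : IsOpen (ball c δ ×ˢ ball (conj c) δ) := isOpen_ball.prod isOpen_ball
    filter_upwards [(hnear c hc).eventuallyEq_nhds, ho.mem_nhds ⟨mem_ball_self hδ, mem_ball_self hδ⟩]
      with p h1 h2
    exact ((hG c hc).1.differentiableAt (ho.mem_nhds h2)).congr_of_eventuallyEq h1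
  · have hcont : Continuous fun z : ℂ => (z, conj z) := by fun_prop
    filter_upwards [(hcont.tendsto c).eventually (hnear c hc), ball_mem_nhds c hδ] with z h1 h2
    exact h1.trans ((hG c hc).2 z h2)

end PlanarOP

end

open Filter Topology

noncomputable section

namespace PlanarOP

open Metric Set ComplexConjugate

namespace ExteriorData

variable (D : ExteriorData)

/-! ### The exterior conformal map and its inverse -/

theorem psi_mem {ζ : ℂ} (h : ζ ∈ D.φ '' D.U) : D.psi ζ ∈ D.U := Function.invFunOn_mem h

theorem phi_psi {ζ : ℂ} (h : ζ ∈ D.φ '' D.U) : D.φ (D.psi ζ) = ζ := Function.invFunOn_eq h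

theorem psi_phi {z : ℂ} (h : z ∈ D.U) : D.psi (D.φ z) = z :=
  D.injOn (D.psi_mem ⟨z, h, rfl⟩) h (D.phi_psi ⟨z, h, rfl⟩)

theorem analyticAt_phi {z : ℂ} (h : z ∈ D.U) : AnalyticAt ℂ D.φ z :=
  D.differentiableOn.analyticAt (D.isOpen_U.mem_nhds h)

/-- Open mapping theorem; injectivity excludes the locally constant case. -/
theorem nhds_le_map_phi {z : ℂ} (h : z ∈ D.U) : 𝓝 (D.φ z) ≤ map D.φ (𝓝 z) := by
  refine (D.analyticAt_phi h).eventually_constant_or_nhds_le_map_nhds.resolve_left fun hc => ?_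
  have h1 : ∀ᶠ w in 𝓝[≠] z, w = z := by
    filter_upwards [nhdsWithin_le_nhds hc, nhdsWithin_le_nhds (D.isOpen_U.mem_nhds h)] with w h1 h2
      using D.injOn h2 h h1
  obtain ⟨w, hw1, hw2⟩ := (h1.and self_mem_nhdsWithin).exists
  exact hw2 hw1

theorem isOpen_image : IsOpen (D.φ '' D.U) := by
  rw [isOpen_iff_mem_nhds]
  rintro _ ⟨z, hz, rfl⟩
  exact D.nhds_le_map_phi hz (image_mem_map (D.isOpen_U.mem_nhds hz))

theorem continuousAt_psi {ζ : ℂ} (h : ζ ∈ D.φ '' D.U) : ContinuousAt D.psi ζ := by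
  obtain ⟨z, hz, rfl⟩ := h
  rw [ContinuousAt, D.psi_phi hz]
  intro N hN
  have h1 : D.φ '' (N ∩ D.U) ∈ 𝓝 (D.φ z) :=
    D.nhds_le_map_phi hz (image_mem_map (inter_mem hN (D.isOpen_U.mem_nhds hz)))
  refine mem_map.2 (mem_of_superset h1 ?_)
  rintro _ ⟨w, ⟨hw1, hw2⟩, rfl⟩
  rw [mem_preimage, D.psi_phi hw2]; exact hw1

theorem eventually_phi_psi {ζ : ℂ} (h : ζ ∈ D.φ '' D.U) : ∀ᶠ x in 𝓝 ζ, D.φ (D.psi x) = x := by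
  filter_upwards [D.isOpen_image.mem_nhds h] with x hx using D.phi_psi hx

/-- Zeros of φ' are isolated, so the inverse is differentiable on a punctured neighbourhood. It is
continuous at the point, so the singularity is removable. That φ' has no zeros follows afterwards
from the chain rule. -/
theorem analyticAt_psi {ζ : ℂ} (h : ζ ∈ D.φ '' D.U) : AnalyticAt ℂ D.psi ζ := by
  obtain ⟨z, hz, rfl⟩ := h
  have ha := (D.analyticAt_phi hz).deriv
  have hne : ∀ᶠ w in 𝓝[≠] z, deriv D.φ w ≠ 0 := by
    refine ha.eventually_eq_zero_or_eventually_ne_zero.resolve_left fun h0 => ?_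
    obtain ⟨r, hr, hball⟩ := Metric.eventually_nhds_iff_ball.1 (h0.and (D.isOpen_U.mem_nhds hz))
    have hc : ∀ w ∈ ball z r, D.φ w = D.φ z := fun w hw =>
      isOpen_ball.is_const_of_deriv_eq_zero (convex_ball z r).isPreconnected
        (D.differentiableOn.mono fun x hx => (hball x hx).2) (fun x hx => (hball x hx).1) hw
        (mem_ball_self hr)
    have h1 : ∀ᶠ w in 𝓝[≠] z, w = z := by
      filter_upwards [nhdsWithin_le_nhds (ball_mem_nhds z hr)] with w hw
        using D.injOn (hball w hw).2 hz (hc w hw)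
    obtain ⟨w, hw1, hw2⟩ := (h1.and self_mem_nhdsWithin).exists
    exact hw2 hw1
  have him : D.φ z ∈ D.φ '' D.U := ⟨z, hz, rfl⟩
  refine Complex.analyticAt_of_differentiable_on_punctured_nhds_of_continuousAt ?_
    (D.continuousAt_psi him)
  have ht : Tendsto D.psi (𝓝[≠] (D.φ z)) (𝓝[≠] z) := by
    refine tendsto_nhdsWithin_iff.2 ⟨?_, ?_⟩
    · have := (D.continuousAt_psi him).tendsto
      rw [D.psi_phi hz] at this
      exact this.mono_left nhdsWithin_le_nhds
    · filter_upwards [nhdsWithin_le_nhds (D.isOpen_image.mem_nhds him), self_mem_nhdsWithin]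
        with x hx hx2 hx3
      exact hx2 (by rw [← (hx3 : D.psi x = z), D.phi_psi hx]; rfl)
  filter_upwards [ht.eventually hne, nhdsWithin_le_nhds (D.isOpen_image.mem_nhds him)] with x hx1 hx2
  have hd : HasDerivAt D.φ (deriv D.φ (D.psi x)) (D.psi x) :=
    (D.analyticAt_phi (D.psi_mem hx2)).differentiableAt.hasDerivAt
  exact (hd.of_local_left_inverse (D.continuousAt_psi hx2) hx1 (D.eventually_phi_psi hx2)).differentiableAt

theorem deriv_phi_ne_zero {z : ℂ} (hz : z ∈ D.U) : deriv D.φ z ≠ 0 := by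
  intro h0
  have him : D.φ z ∈ D.φ '' D.U := ⟨z, hz, rfl⟩
  have h1 := (D.analyticAt_psi him).differentiableAt.hasDerivAt.comp z
    (D.analyticAt_phi hz).differentiableAt.hasDerivAt
  rw [h0, mul_zero] at h1
  have h2 : (D.psi ∘ D.φ) =ᶠ[𝓝 z] id := by
    filter_upwards [D.isOpen_U.mem_nhds hz] with x hx using D.psi_phi hx
  exact one_ne_zero ((hasDerivAt_id z).unique (h1.congr_of_eventuallyEq h2.symm))

theorem subset_U : D.Ω ⊆ D.U := subset_closure.trans D.closure_subset

theorem mem_Ω_iff {z : ℂ} (hz : z ∈ D.U) : z ∈ D.Ω ↔ 1 < ‖D.φ z‖ := by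
  constructor
  · intro h
    have : D.φ z ∈ D.φ '' D.Ω := ⟨z, h, rfl⟩
    rwa [D.image_eq] at this
  · intro h
    have : D.φ z ∈ D.φ '' D.Ω := by rw [D.image_eq]; exact h
    obtain ⟨w, hw, e⟩ := this
    rwa [← D.injOn (D.subset_U hw) hz e]

theorem isOpen_Ω : IsOpen D.Ω := by
  rw [isOpen_iff_mem_nhds]
  intro z hz
  have hU := D.subset_U hz
  have hc := (D.analyticAt_phi hU).continuousAt.norm
  filter_upwards [D.isOpen_U.mem_nhds hU, hc.eventually (lt_mem_nhds ((D.mem_Ω_iff hU).1 hz))]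
    with w h1 h2 using (D.mem_Ω_iff h1).2 h2

theorem notMem_closure_Ω {z : ℂ} (hz : z ∈ D.U) (h : ‖D.φ z‖ < 1) : z ∉ closure D.Ω := by
  rw [mem_closure_iff_frequently, not_frequently]
  have hc := (D.analyticAt_phi hz).continuousAt.norm
  filter_upwards [D.isOpen_U.mem_nhds hz, hc.eventually (gt_mem_nhds h)] with w h1 h2 h3
  exact absurd ((D.mem_Ω_iff h1).1 h3) (not_lt.2 h2.le)

/-- The exterior map is proper: every unimodular number is a boundary value. -/
theorem exists_frontier {c : ℂ} (hc : ‖c‖ = 1) : ∃ z ∈ frontier D.Ω, z ∈ D.U ∧ D.φ z = c := by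
  obtain ⟨k, hk, hlim⟩ := D.normalized
  have hlarge : ∀ᶠ z in cocompact ℂ, 2 < ‖D.φ z‖ := by
    have h1 : ∀ᶠ z in cocompact ℂ, k / 2 < ‖D.φ z / z‖ := by
      refine hlim.norm.eventually (lt_mem_nhds ?_)
      rw [Complex.norm_of_nonneg hk.le]; linarith
    have h2 : ∀ᶠ z in cocompact ℂ, 4 / k < ‖z‖ :=
      (tendsto_norm_cocompact_atTop (E := ℂ)).eventually (eventually_gt_atTop _)
    filter_upwards [h1, h2] with z h1 h2
    have hz : 0 < ‖z‖ := (by positivity : 0 < 4 / k).trans h2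
    rw [norm_div, lt_div_iff₀ hz] at h1
    rw [div_lt_iff₀ hk] at h2
    linarith
  obtain ⟨K, hK, hKsub⟩ := mem_cocompact.1 hlarge
  -- Preimages of points tending radially to c have ‖φ‖ ≤ 2, whereas ‖φ‖ > 2 off a compact set. They
  -- accumulate at a boundary point, where φ = c.
  have hex : ∀ n : ℕ, ∃ z ∈ D.Ω, D.φ z = c * ((1 + 1 / ((n : ℝ) + 1) : ℝ) : ℂ) := fun n => by
    have : c * ((1 + 1 / ((n : ℝ) + 1) : ℝ) : ℂ) ∈ D.φ '' D.Ω := by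
      rw [D.image_eq, mem_ofPred_eq, norm_mul, hc, one_mul, Complex.norm_of_nonneg (by positivity)]
      have : 0 < 1 / ((n : ℝ) + 1) := by positivity
      linarith
    obtain ⟨z, h1, h2⟩ := this
    exact ⟨z, h1, h2⟩
  choose z hzΩ hz using hex
  have hzK : ∀ n, z n ∈ K := fun n => by
    by_contra h
    have : 2 < ‖D.φ (z n)‖ := hKsub h
    rw [hz, norm_mul, hc, one_mul, Complex.norm_of_nonneg (by positivity)] at this
    have : 1 / ((n : ℝ) + 1) ≤ 1 := by
      rw [div_le_one (by positivity)]; linarith [(n.cast_nonneg : (0 : ℝ) ≤ n)]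
    linarith
  obtain ⟨a, -, s, hs, hlim2⟩ := hK.tendsto_subseq hzK
  have hacl : a ∈ closure D.Ω :=
    mem_closure_of_tendsto hlim2 (Eventually.of_forall fun n => hzΩ _)
  have haU := D.closure_subset hacl
  have hφa : D.φ a = c := by
    have t1 : Tendsto (fun n => D.φ (z (s n))) atTop (𝓝 (D.φ a)) :=
      (D.analyticAt_phi haU).continuousAt.tendsto.comp hlim2
    have t2 : Tendsto (fun n => D.φ (z (s n))) atTop (𝓝 c) := by
      simp_rw [hz]
      have h1 : Tendsto (fun n : ℕ => (1 + 1 / ((n : ℝ) + 1) : ℝ)) atTop (𝓝 1) := by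
        simpa using tendsto_one_div_add_atTop_nhds_zero_nat.const_add (1 : ℝ)
      have h2 : Tendsto (fun n : ℕ => c * ((1 + 1 / ((n : ℝ) + 1) : ℝ) : ℂ)) atTop (𝓝 c) := by
        simpa using ((Complex.continuous_ofReal.tendsto 1).comp h1).const_mul c
      exact h2.comp hs.tendsto_atTop
    exact tendsto_nhds_unique t1 t2
  refine ⟨a, ⟨hacl, ?_⟩, haU, hφa⟩
  rw [D.isOpen_Ω.interior_eq, D.mem_Ω_iff haU, hφa, hc]
  exact lt_irrefl _

theorem circle_mem_image {c : ℂ} (hc : ‖c‖ = 1) : c ∈ D.φ '' D.U := by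
  obtain ⟨z, -, h1, h2⟩ := D.exists_frontier hc
  exact ⟨z, h1, h2⟩

theorem psi_mem_frontier {c : ℂ} (hc : ‖c‖ = 1) : D.psi c ∈ frontier D.Ω := by
  obtain ⟨z, h0, h1, rfl⟩ := D.exists_frontier hc
  rwa [D.psi_phi h1]

/-- The annulus of parameter `σ` lies in the range of the continued conformal map. -/
structure Fits (σ : ℝ) : Prop where
  pos : 0 < σ
  le : σ ≤ 1 / 8
  subset : annulus σ ⊆ D.φ '' D.U

variable {D}

theorem Fits.mono {σ σ' : ℝ} (h : D.Fits σ) (h0 : 0 < σ') (h1 : σ' ≤ σ) : D.Fits σ' :=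
  ⟨h0, h1.trans h.le, (annulus_mono h0 h1).trans h.subset⟩

variable (D)

theorem exists_fits : ∃ σ, D.Fits σ := by
  obtain ⟨σ, h0, h1, h2⟩ := exists_annulus_of_eventually (P := fun z => z ∈ D.φ '' D.U)
    fun c hc => D.isOpen_image.mem_nhds (D.circle_mem_image hc)
  exact ⟨σ, h0, h1, h2 σ h0 le_rfl⟩

/-! ### The sign of `V` -/

theorem continuousOn_V : ContinuousOn D.V D.U := by
  obtain ⟨Q, τ, Qb, -, h⟩ := D.exists_potential
  exact h.contDiffOn.continuousOn

theorem contDiffAt_V {z : ℂ} (hz : z ∈ D.U) : ContDiffAt ℝ 2 D.V z := by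
  obtain ⟨Q, τ, Qb, -, h⟩ := D.exists_potential
  exact h.contDiffOn.contDiffAt (D.isOpen_U.mem_nhds hz)

theorem V_pos {z : ℂ} (hz : z ∈ D.U) (h : 1 < ‖D.φ z‖) : 0 < D.V z := by
  obtain ⟨Q, τ, Qb, -, hs⟩ := D.exists_potential
  exact hs.pos z ((D.mem_Ω_iff hz).2 h)

theorem V_neg {z : ℂ} (hz : z ∈ D.U) (h : ‖D.φ z‖ < 1) : D.V z < 0 := by
  obtain ⟨Q, τ, Qb, -, hs⟩ := D.exists_potential
  exact hs.neg z ⟨hz, D.notMem_closure_Ω hz h⟩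

theorem continuousAt_V_psi {ζ : ℂ} (h : ζ ∈ D.φ '' D.U) : ContinuousAt (fun x => D.V (D.psi x)) ζ :=
  ContinuousAt.comp (f := D.psi) (g := D.V)
    (D.continuousOn_V.continuousAt (D.isOpen_U.mem_nhds (D.psi_mem h))) (D.continuousAt_psi h)

theorem tendsto_radial (c : ℂ) : Tendsto (fun t : ℝ => c * (t : ℂ)) (𝓝 1) (𝓝 c) := by
  have : Continuous fun t : ℝ => c * (t : ℂ) := by fun_prop
  exact this.tendsto' 1 c (by simp)

/-- V is positive outside and negative inside; the radial limits from both sides agree by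
continuity. -/
theorem V_psi_circle {c : ℂ} (hc : ‖c‖ = 1) : D.V (D.psi c) = 0 := by
  have him := D.circle_mem_image hc
  have hlim := (D.continuousAt_V_psi him).tendsto.comp (tendsto_radial c)
  have hin := (tendsto_radial c).eventually (D.isOpen_image.mem_nhds him)
  refine le_antisymm ?_ ?_
  · refine le_of_tendsto (hlim.mono_left (nhdsWithin_le_nhds (s := Iio 1))) ?_
    filter_upwards [nhdsWithin_le_nhds hin, self_mem_nhdsWithin,
      nhdsWithin_le_nhds (lt_mem_nhds (zero_lt_one : (0 : ℝ) < 1))] with t h1 h2 h3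
    refine (D.V_neg (D.psi_mem h1) ?_).le
    rw [D.phi_psi h1, norm_mul, hc, one_mul, Complex.norm_of_nonneg h3.le]; exact h2
  · refine ge_of_tendsto (hlim.mono_left (nhdsWithin_le_nhds (s := Ioi 1))) ?_
    filter_upwards [nhdsWithin_le_nhds hin, self_mem_nhdsWithin] with t h1 h2
    refine (D.V_pos (D.psi_mem h1) ?_).le
    rw [D.phi_psi h1, norm_mul, hc, one_mul, Complex.norm_of_nonneg (zero_le_one.trans (le_of_lt h2))]
    exact h2

theorem V_psi_eq_zero_iff {ζ : ℂ} (h : ζ ∈ D.φ '' D.U) : D.V (D.psi ζ) = 0 ↔ ‖ζ‖ = 1 := by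
  refine ⟨fun h0 => ?_, D.V_psi_circle⟩
  have h1 := D.psi_mem h
  rcases lt_trichotomy ‖ζ‖ 1 with h2 | h2 | h2
  · exact absurd h0 (D.V_neg h1 (by rwa [D.phi_psi h])).ne
  · exact h2
  · exact absurd h0 (D.V_pos h1 (by rwa [D.phi_psi h])).ne'

end ExteriorData

/-! ### Vanishing on the circle -/

theorem isPreconnected_annulus {σ : ℝ} (h : 0 < σ) : IsPreconnected (annulus σ) := by
  have : annulus σ = Complex.exp '' {a | Real.log (rho σ) < a.re ∧ a.re < Real.log (rho σ)⁻¹} := by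
    ext ζ
    simp only [mem_image]
    constructor
    · intro hz
      have h0 : 0 < ‖ζ‖ := (rho_pos h).trans hz.1
      exact ⟨Complex.log ζ, ⟨by rw [Complex.log_re]; exact Real.log_lt_log (rho_pos h) hz.1,
        by rw [Complex.log_re]; exact Real.log_lt_log h0 hz.2⟩, Complex.exp_log (norm_pos_iff.1 h0)⟩
    · rintro ⟨a, ha, rfl⟩
      refine ⟨?_, ?_⟩ <;> rw [Complex.norm_exp]
      · exact (Real.log_lt_iff_lt_exp (rho_pos h)).1 ha.1
      · exact (Real.lt_log_iff_exp_lt (inv_pos.2 (rho_pos h))).1 ha.2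
  rw [this]
  exact ((convex_halfSpace_re_gt _).inter (convex_halfSpace_re_lt _)).isPreconnected.image _
    Complex.continuous_exp.continuousOn

theorem differentiableOn_inv_slice {σ : ℝ} (h : 0 < σ) {G : ℂ × ℂ → ℂ}
    (hG : DifferentiableOn ℂ G (Dh σ)) : DifferentiableOn ℂ (fun z => G (z, z⁻¹)) (annulus σ) :=
  hG.comp (differentiableOn_id.prodMk fun _ hx =>
    (differentiableAt_inv (ne_zero_of_mem_annulus h hx)).differentiableWithinAt)
    fun _ hz => inv_mem_Dh h hz

theorem frequently_norm_eq_one {c : ℂ} (hc : ‖c‖ = 1) : ∃ᶠ z in 𝓝[≠] c, ‖z‖ = 1 := by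
  have hc0 : c ≠ 0 := norm_ne_zero_iff.1 (by rw [hc]; exact one_ne_zero)
  have hd : HasDerivAt (fun t : ℝ => c * Complex.exp (t * Complex.I))
      (c * (Complex.exp ((0 : ℝ) * Complex.I) * (1 * Complex.I))) 0 :=
    (((hasDerivAt_id (0 : ℝ)).ofReal_comp.mul_const Complex.I).cexp).const_mul c
  have ht := hd.tendsto_nhdsNE (by simpa using hc0)
  simp only [Complex.ofReal_zero, zero_mul, Complex.exp_zero, mul_one] at ht
  refine ht.frequently (Eventually.frequently (Eventually.of_forall fun t => ?_))
  rw [norm_mul, hc, Complex.norm_exp_ofReal_mul_I, one_mul]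

/-- The function G(z, 1/z) is holomorphic on the connected annulus and vanishes on the unit circle,
whose points accumulate. Divisibility by 1 - zw thus needs checking only for unimodular z. -/
theorem eq_zero_of_circle {σ : ℝ} (h : 0 < σ) {G : ℂ × ℂ → ℂ} (hG : DifferentiableOn ℂ G (Dh σ))
    (h0 : ∀ c : ℂ, ‖c‖ = 1 → G (c, conj c) = 0) {p : ℂ × ℂ} (hp : p ∈ Dh σ) (hp1 : p.1 * p.2 = 1) :
    G p = 0 := by
  obtain ⟨z, w⟩ := p
  obtain rfl : w = z⁻¹ := eq_inv_of_mul_eq_one_right hp1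
  have ha := (differentiableOn_inv_slice h hG).analyticOnNhd (isOpen_annulus σ)
  refine ha.eqOn_zero_of_preconnected_of_frequently_eq_zero (isPreconnected_annulus h)
    (mem_annulus_of_norm_one h (norm_one (α := ℂ))) ?_ (mem_Dh.1 hp).1
  refine (frequently_norm_eq_one (norm_one (α := ℂ))).mono fun z hz => ?_
  rw [← conj_eq_inv hz]; exact h0 z hz

end PlanarOP

end

open Filter Topology

noncomputable section

namespace PlanarOP

open Metric Set ComplexConjugate

namespace ExteriorData

variable (D : ExteriorData)

/-! ### Polarizations -/

/-- `G(z, w)` is the holomorphic polarization of `f ∘ φ⁻¹`, in the variables `z` and `conj w`. -/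
def Pol (σ : ℝ) (f : ℂ → ℂ) (G : ℂ × ℂ → ℂ) : Prop :=
  DifferentiableOn ℂ G (Dh σ) ∧ ∀ z ∈ annulus σ, G (z, conj z) = f (D.psi z)

variable {D} {σ : ℝ} {f f₁ f₂ u : ℂ → ℂ} {F G G₁ G₂ : ℂ × ℂ → ℂ}

theorem Pol.isPolarization (h : D.Pol σ f G) : D.IsPolarization σ f fun z w => G (z, conj w) := by
  refine ⟨?_, h.2⟩
  simp only [Complex.conj_conj]
  exact h.1

theorem pol_of_isPolarization {F : ℂ → ℂ → ℂ} (h : D.IsPolarization σ f F) :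
    D.Pol σ f fun p => F p.1 (conj p.2) := by
  refine ⟨h.1, fun z hz => ?_⟩
  simp only [Complex.conj_conj]
  exact h.2 z hz

theorem Pol.unique (hσ : 0 < σ) (h₁ : D.Pol σ f G₁) (h₂ : D.Pol σ f G₂) {p : ℂ × ℂ} (hp : p ∈ Dh σ) :
    G₁ p = G₂ p := by
  have hz := (mem_Dh.1 hp).1
  refine sub_eq_zero.1 (eq_zero_of_antidiag (H := fun p => G₁ p - G₂ p) (isOpen_Dh σ)
    (h₁.1.sub h₂.1) (fun z hz => ?_) (isPreconnected_slice hσ hz) (diag_mem_Dh hσ hz) hp)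
  rw [h₁.2 z (mem_Dh.1 hz).1, h₂.2 z (mem_Dh.1 hz).1, sub_self]

theorem mem_Dh_conj {z w : ℂ} : (z, conj w) ∈ Dh σ ↔ (z, w) ∈ fatAnnulus σ := by
  simp [Dh]

/-- Uniqueness lets norms, which are defined through a chosen polarization, be computed from any
explicit one. -/
theorem Pol.polarization_eq (hσ : 0 < σ) (h : D.Pol σ f G) {p : ℂ × ℂ} (hp : p ∈ fatAnnulus σ) :
    D.polarization σ f p.1 p.2 = G (p.1, conj p.2) := by
  have h1 : D.IsPolarization σ f (D.polarization σ f) :=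
    Classical.epsilon_spec (p := D.IsPolarization σ f) ⟨_, h.isPolarization⟩
  have := (pol_of_isPolarization h1).unique hσ h (mem_Dh_conj.2 hp)
  simpa using this

theorem Pol.memH (h : D.Pol σ f G) {M : ℝ} (hM : ∀ p ∈ Dh σ, ‖G p‖ ≤ M) : D.MemH σ f :=
  ⟨_, h.isPolarization, M, fun _ hp => hM _ (mem_Dh_conj.2 hp)⟩

theorem one_mem_Dh (hσ : 0 < σ) : ((1, 1) : ℂ × ℂ) ∈ Dh σ := by
  have := diag_mem_Dh hσ (mem_annulus_of_norm_one hσ (norm_one (α := ℂ)))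
  rwa [map_one] at this

theorem Pol.hNorm_le (hσ : 0 < σ) (h : D.Pol σ f G) {M : ℝ} (hM : ∀ p ∈ Dh σ, ‖G p‖ ≤ M) :
    D.hNorm σ f ≤ M := by
  have h1 : ((1, 1) : ℂ × ℂ) ∈ fatAnnulus σ := by
    rw [← mem_Dh_conj, map_one]; exact one_mem_Dh hσ
  refine csSup_le ⟨_, _, h1, rfl⟩ ?_
  rintro _ ⟨p, hp, rfl⟩
  simp only
  rw [h.polarization_eq hσ hp]
  exact hM _ (mem_Dh_conj.2 hp)

theorem Pol.inBall (hσ : 0 < σ) (h : D.Pol σ f G) {M : ℝ} (hM : ∀ p ∈ Dh σ, ‖G p‖ ≤ M) :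
    D.InBall σ M f := ⟨h.memH hM, h.hNorm_le hσ hM⟩

/-- Membership is needed here: it makes the set of values bounded, so that its supremum dominates
each value. -/
theorem Pol.norm_le_hNorm (hσ : 0 < σ) (h : D.Pol σ f G) (hf : D.MemH σ f) {p : ℂ × ℂ}
    (hp : p ∈ Dh σ) : ‖G p‖ ≤ D.hNorm σ f := by
  obtain ⟨F, hF, M, hM⟩ := hf
  have hp' : (p.1, conj p.2) ∈ fatAnnulus σ := hp
  have e := h.polarization_eq hσ hp'
  simp only [Complex.conj_conj] at e
  have : ‖G p‖ = ‖D.polarization σ f p.1 (conj p.2)‖ := by rw [e]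
  rw [this]
  refine le_csSup ⟨M, ?_⟩ ⟨_, hp', rfl⟩
  rintro _ ⟨q, hq, rfl⟩
  have e1 := h.polarization_eq hσ hq
  have e2 := (pol_of_isPolarization hF).polarization_eq hσ hq
  simp only [Complex.conj_conj] at e2
  simp only
  rw [e2]; exact hM q hq

theorem MemH.exists_pol (hσ : 0 < σ) (hf : D.MemH σ f) :
    ∃ G, D.Pol σ f G ∧ ∀ p ∈ Dh σ, ‖G p‖ ≤ D.hNorm σ f := by
  obtain ⟨F, hF, M, hM⟩ := id hf
  exact ⟨_, pol_of_isPolarization hF, fun p hp => (pol_of_isPolarization hF).norm_le_hNorm hσ hf hp⟩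

theorem hNorm_nonneg (σ : ℝ) (f : ℂ → ℂ) : 0 ≤ D.hNorm σ f := by
  refine Real.sSup_nonneg ?_
  rintro _ ⟨p, -, rfl⟩
  exact norm_nonneg _

theorem Pol.mono (h : D.Pol σ f G) {σ' : ℝ} (h0 : 0 < σ') (h1 : σ' ≤ σ) : D.Pol σ' f G :=
  ⟨h.1.mono (Dh_mono h0 h1), fun z hz => h.2 z (annulus_mono h0 h1 hz)⟩

theorem Pol.congr_left (h : D.Pol σ f₁ G) (he : ∀ z ∈ annulus σ, f₂ (D.psi z) = f₁ (D.psi z)) :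
    D.Pol σ f₂ G := ⟨h.1, fun z hz => (h.2 z hz).trans (he z hz).symm⟩

theorem Pol.congr_right (hσ : 0 < σ) (h : D.Pol σ f G₁) (he : ∀ p ∈ Dh σ, G₂ p = G₁ p) :
    D.Pol σ f G₂ :=
  ⟨h.1.congr he, fun z hz => (he _ (diag_mem_Dh hσ hz)).trans (h.2 z hz)⟩

theorem Pol.add (h₁ : D.Pol σ f₁ G₁) (h₂ : D.Pol σ f₂ G₂) :
    D.Pol σ (fun z => f₁ z + f₂ z) fun p => G₁ p + G₂ p :=
  ⟨h₁.1.add h₂.1, fun z hz => by simp only [h₁.2 z hz, h₂.2 z hz]⟩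

theorem Pol.sub (h₁ : D.Pol σ f₁ G₁) (h₂ : D.Pol σ f₂ G₂) :
    D.Pol σ (fun z => f₁ z - f₂ z) fun p => G₁ p - G₂ p :=
  ⟨h₁.1.sub h₂.1, fun z hz => by simp only [h₁.2 z hz, h₂.2 z hz]⟩

theorem Pol.mul (h₁ : D.Pol σ f₁ G₁) (h₂ : D.Pol σ f₂ G₂) :
    D.Pol σ (fun z => f₁ z * f₂ z) fun p => G₁ p * G₂ p :=
  ⟨h₁.1.mul h₂.1, fun z hz => by simp only [h₁.2 z hz, h₂.2 z hz]⟩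

theorem Pol.const_mul (c : ℂ) (h : D.Pol σ f G) : D.Pol σ (fun z => c * f z) fun p => c * G p :=
  ⟨h.1.const_mul c, fun z hz => by simp only [h.2 z hz]⟩

theorem Pol.inv (h : D.Pol σ f G) (h0 : ∀ p ∈ Dh σ, G p ≠ 0) :
    D.Pol σ (fun z => (f z)⁻¹) fun p => (G p)⁻¹ :=
  ⟨h.1.inv h0, fun z hz => by simp only [h.2 z hz]⟩

theorem Pol.exp (h : D.Pol σ f G) : D.Pol σ (fun z => Complex.exp (f z)) fun p => Complex.exp (G p) :=
  ⟨h.1.cexp, fun z hz => by simp only [h.2 z hz]⟩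

theorem Pol.log (h : D.Pol σ f G) (h0 : ∀ p ∈ Dh σ, G p ∈ Complex.slitPlane) :
    D.Pol σ (fun z => Complex.log (f z)) fun p => Complex.log (G p) :=
  ⟨h.1.clog h0, fun z hz => by simp only [h.2 z hz]⟩

theorem pol_zero (σ : ℝ) : D.Pol σ 0 0 := ⟨differentiableOn_const 0, fun _ _ => rfl⟩

/-! ### Differentiation -/

theorem Pol.eventuallyEq (hs : D.Fits σ) (h : D.Pol σ f G) {z : ℂ} (hz : z ∈ annulus σ) :
    f =ᶠ[𝓝 (D.psi z)] fun y => G (D.φ y, conj (D.φ y)) := by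
  have him := hs.subset hz
  have hU := D.psi_mem him
  have hc := (D.analyticAt_phi hU).continuousAt
  have hin : annulus σ ∈ 𝓝 (D.φ (D.psi z)) := by
    rw [D.phi_psi him]; exact (isOpen_annulus σ).mem_nhds hz
  filter_upwards [D.isOpen_U.mem_nhds hU, hc hin] with y h1 h2
  rw [h.2 _ h2, D.psi_phi h1]

theorem Pol.hasFDerivAt (hs : D.Fits σ) (h : D.Pol σ f G) {z : ℂ} (hz : z ∈ annulus σ) :
    HasFDerivAt (𝕜 := ℝ) f
      ((pz G (z, conj z) * deriv D.φ (D.psi z)) • (1 : ℂ →L[ℝ] ℂ) +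
        (pw G (z, conj z) * conj (deriv D.φ (D.psi z))) • (Complex.conjCLE : ℂ →L[ℝ] ℂ))
      (D.psi z) := by
  have him := hs.subset hz
  have hd := (D.analyticAt_phi (D.psi_mem him)).differentiableAt.hasDerivAt
  have hG : DifferentiableAt ℂ G (z, conj z) :=
    h.1.differentiableAt ((isOpen_Dh σ).mem_nhds (diag_mem_Dh hs.pos hz))
  have := hasFDerivAt_antidiag (F := G) hd (by rwa [D.phi_psi him])
  rw [D.phi_psi him] at this
  exact this.congr_of_eventuallyEq (h.eventuallyEq hs hz)

variable (D) in
/-- The polarization of `φ'`. -/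
def derivPol (p : ℂ × ℂ) : ℂ := deriv D.φ (D.psi p.1)

variable (D) in
/-- The polarization of the conjugate of `φ'`. -/
def derivPolConj (p : ℂ × ℂ) : ℂ := conj (deriv D.φ (D.psi (conj p.2)))

theorem differentiableAt_deriv_phi_psi {z : ℂ} (hz : z ∈ D.φ '' D.U) :
    DifferentiableAt ℂ (fun x => deriv D.φ (D.psi x)) z :=
  DifferentiableAt.comp z (D.analyticAt_phi (D.psi_mem hz)).deriv.differentiableAt
    (D.analyticAt_psi hz).differentiableAt

theorem differentiableOn_derivPol (hs : D.Fits σ) : DifferentiableOn ℂ D.derivPol (Dh σ) :=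
  fun p hp => ((differentiableAt_deriv_phi_psi (hs.subset (mem_Dh.1 hp).1)).comp p
    differentiableAt_fst).differentiableWithinAt

theorem differentiableOn_derivPolConj (hs : D.Fits σ) : DifferentiableOn ℂ D.derivPolConj (Dh σ) := by
  intro p hp
  have h1 : conj p.2 ∈ D.φ '' D.U := hs.subset (conj_mem_annulus.2 (mem_Dh.1 hp).2.1)
  have h2 := (differentiableAt_deriv_phi_psi h1).conj_conj
  rw [Complex.conj_conj] at h2
  exact (DifferentiableAt.comp p (f := Prod.snd) h2 differentiableAt_snd).differentiableWithinAt

theorem Pol.dz (hs : D.Fits σ) (h : D.Pol σ f G) :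
    D.Pol σ (dz f) fun p => D.derivPol p * pz G p := by
  refine ⟨(differentiableOn_derivPol hs).mul (differentiableOn_pz (isOpen_Dh σ) h.1), fun z hz => ?_⟩
  unfold PlanarOP.dz
  rw [(h.hasFDerivAt hs hz).fderiv]
  simp [derivPol]
  linear_combination (-1 / 2 : ℂ) * (pz G (z, conj z) * deriv D.φ (D.psi z) -
    pw G (z, conj z) * conj (deriv D.φ (D.psi z))) * -Complex.I_sq

theorem Pol.dzbar (hs : D.Fits σ) (h : D.Pol σ f G) :
    D.Pol σ (dzbar f) fun p => D.derivPolConj p * pw G p := by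
  refine ⟨(differentiableOn_derivPolConj hs).mul (differentiableOn_pw (isOpen_Dh σ) h.1), fun z hz => ?_⟩
  unfold PlanarOP.dzbar
  rw [(h.hasFDerivAt hs hz).fderiv]
  simp [derivPolConj]
  linear_combination (1 / 2 : ℂ) * (pz G (z, conj z) * deriv D.φ (D.psi z) -
    pw G (z, conj z) * conj (deriv D.φ (D.psi z))) * -Complex.I_sq

/-- The conjugate factor depends on w only and passes through the z-derivative. -/
theorem Pol.qLap (hs : D.Fits σ) (h : D.Pol σ f G) :
    D.Pol σ (qLap f) fun p => D.derivPol p * D.derivPolConj p * pz (pw G) p := by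
  refine ((h.dzbar hs).dz hs).congr_right hs.pos fun p hp => ?_
  have hd : DifferentiableAt ℂ (pw G) p :=
    (differentiableOn_pw (isOpen_Dh σ) h.1).differentiableAt ((isOpen_Dh σ).mem_nhds hp)
  have : pz (fun p => D.derivPolConj p * pw G p) p = D.derivPolConj p * pz (pw G) p :=
    ((hasDerivAt_pz hd).const_mul (D.derivPolConj p)).deriv
  rw [this, mul_assoc]

/-! ### Poisson extension -/

/-- A Laurent splitting of the restriction of `G` to the polarized unit circle. -/
structure Split (σ : ℝ) (G : ℂ × ℂ → ℂ) (g h : ℂ → ℂ) : Prop where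
  fst : DifferentiableOn ℂ g (ball 0 (rho σ)⁻¹)
  snd : DifferentiableOn ℂ h (ball 0 (rho σ)⁻¹)
  eq : ∀ z ∈ annulus σ, G (z, z⁻¹) = g z + h z⁻¹

/-- The polarized harmonic extension attached to a splitting. -/
def splitPol (g h : ℂ → ℂ) (p : ℂ × ℂ) : ℂ := h p.1⁻¹ + g p.2⁻¹

variable {g h g₁ h₁ g₂ h₂ : ℂ → ℂ}

theorem Split.mono {σ' : ℝ} (hs : Split σ G g h) (h0 : 0 < σ') (h1 : σ' ≤ σ) : Split σ' G g h := by
  have hb : ball (0 : ℂ) (rho σ')⁻¹ ⊆ ball 0 (rho σ)⁻¹ :=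
    ball_subset_ball (inv_anti₀ (rho_pos (h0.trans_le h1)) (rho_anti h0 h1))
  exact ⟨hs.fst.mono hb, hs.snd.mono hb, fun z hz => hs.eq z (annulus_mono h0 h1 hz)⟩

theorem Split.sub (hs₁ : Split σ G₁ g₁ h₁) (hs₂ : Split σ G₂ g₂ h₂) :
    Split σ (fun p => G₁ p - G₂ p) (fun z => g₁ z - g₂ z) fun z => h₁ z - h₂ z :=
  ⟨hs₁.fst.sub hs₂.fst, hs₁.snd.sub hs₂.snd, fun z hz => by
    simp only [hs₁.eq z hz, hs₂.eq z hz]; ring⟩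

theorem Split.add (hs₁ : Split σ G₁ g₁ h₁) (hs₂ : Split σ G₂ g₂ h₂) :
    Split σ (fun p => G₁ p + G₂ p) (fun z => g₁ z + g₂ z) fun z => h₁ z + h₂ z :=
  ⟨hs₁.fst.add hs₂.fst, hs₁.snd.add hs₂.snd, fun z hz => by
    simp only [hs₁.eq z hz, hs₂.eq z hz]; ring⟩

theorem Split.const_mul (c : ℂ) (hs : Split σ G g h) :
    Split σ (fun p => c * G p) (fun z => c * g z) fun z => c * h z :=
  ⟨hs.fst.const_mul c, hs.snd.const_mul c, fun z hz => by simp only [hs.eq z hz]; ring⟩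

theorem split_zero (σ : ℝ) : Split σ 0 0 0 :=
  ⟨differentiableOn_const 0, differentiableOn_const 0, fun _ _ => by simp⟩

theorem Split.congr (hs : Split σ G₁ g h) (hσ : 0 < σ) (he : ∀ p ∈ Dh σ, G₂ p = G₁ p) :
    Split σ G₂ g h :=
  ⟨hs.fst, hs.snd, fun z hz => (he _ (inv_mem_Dh hσ hz)).trans (hs.eq z hz)⟩

/-- This says that (P - I)f vanishes on the complexified curve, so that it can be divided by V. -/
theorem Split.circle (hs : Split σ G g h) {p : ℂ × ℂ} (hp : p ∈ Dh σ)
    (hp1 : p.1 * p.2 = 1) : splitPol g h p = G p := by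
  obtain ⟨z, w⟩ := p
  obtain rfl : w = z⁻¹ := eq_inv_of_mul_eq_one_right hp1
  rw [hs.eq z (mem_Dh.1 hp).1]
  simp [splitPol, add_comm]

theorem differentiableOn_splitPol (hσ : 0 < σ) (hs : Split σ G g h) :
    DifferentiableOn ℂ (splitPol g h) (Dh σ) := by
  have key : ∀ k : ℂ → ℂ, DifferentiableOn ℂ k (ball 0 (rho σ)⁻¹) →
      DifferentiableOn ℂ (fun z => k z⁻¹) (annulus σ) := fun k hk =>
    hk.comp (fun x hx => (differentiableAt_inv (ne_zero_of_mem_annulus hσ hx)).differentiableWithinAt)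
      fun x hx => by rw [mem_ball_zero_iff]; exact (inv_mem_annulus hσ hx).2
  exact ((key h hs.snd).comp differentiableOn_fst fun p hp => (mem_Dh.1 hp).1).add
    ((key g hs.fst).comp differentiableOn_snd fun p hp => (mem_Dh.1 hp).2.1)

theorem exists_split (hσ : 0 < σ) (hσ1 : σ ≤ 1 / 8) (hG : DifferentiableOn ℂ G (Dh σ)) :
    ∃ g h : ℂ → ℂ, Split σ G g h ∧
      ∀ M, (∀ p ∈ Dh σ, ‖G p‖ ≤ M) → ∀ p ∈ Dh σ, ‖splitPol g h p‖ ≤ 4 * M / σ := by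
  obtain ⟨g, h, h1, h2, h3, h4⟩ := exists_laurent_split hσ hσ1 (differentiableOn_inv_slice hσ hG)
  refine ⟨g, h, ⟨h1, h2, h3⟩, fun M hM p hp => ?_⟩
  have h5 := h4 M (fun z hz => hM _ (inv_mem_Dh hσ hz))
  rw [mem_Dh] at hp
  have a := (h5 _ (inv_mem_annulus hσ hp.1)).2
  have b := (h5 _ (inv_mem_annulus hσ hp.2.1)).1
  calc _ ≤ 2 * M / σ + 2 * M / σ := (norm_add_le _ _).trans (add_le_add a b)
    _ = _ := by ring

theorem Pol.P (hs : D.Fits σ) (hf : D.Pol σ f G) (hsp : Split σ G g h) :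
    D.Pol σ (D.P f) (splitPol g h) := by
  refine ⟨differentiableOn_splitPol hs.pos hsp, fun z hz => ?_⟩
  have him := hs.subset hz
  rw [D.P_eq (one_lt_rho_inv hs.pos) hsp.fst hsp.snd (fun c hc => ?_) (x := D.psi z), D.phi_psi him]
  · rfl
  · rw [D.phi_psi him, inv_inv]; exact hz.1
  · have hc' := mem_annulus_of_norm_one hs.pos hc
    rw [← hf.2 c hc', conj_eq_inv hc, hsp.eq c hc']

/-! ### Division by `V` -/

/-- Off the curve the quotient is -H/k by cancellation. That expression is continuous across the
curve, so it is the extension by continuity. The sign comes from writing V with zw - 1 and the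
divisor with 1 - zw. -/
theorem Pol.divV (hs : D.Fits σ) {k H : ℂ × ℂ → ℂ}
    (hV : D.Pol σ D.Vc fun p => (p.1 * p.2 - 1) * k p) (hk : DifferentiableOn ℂ k (Dh σ))
    (hk0 : ∀ p ∈ Dh σ, k p ≠ 0) (hu : D.Pol σ u G) (hH : DifferentiableOn ℂ H (Dh σ))
    (hGH : ∀ p ∈ Dh σ, (1 - p.1 * p.2) * H p = G p) :
    D.Pol σ (D.divV u) fun p => -(H p * (k p)⁻¹) := by
  have hd : DifferentiableOn ℂ (fun p => -(H p * (k p)⁻¹)) (Dh σ) := (hH.mul (hk.inv hk0)).neg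
  refine ⟨hd, fun z hz => ?_⟩
  set E : ℂ → ℂ := fun x => -(H (D.φ x, conj (D.φ x)) * (k (D.φ x, conj (D.φ x)))⁻¹)
  have him := hs.subset hz
  have hU := D.psi_mem him
  have hE : ContinuousAt E (D.psi z) := by
    have h1 : ContinuousAt (fun x => (D.φ x, conj (D.φ x))) (D.psi z) := by
      have := (D.analyticAt_phi hU).continuousAt
      exact this.prodMk (Complex.continuous_conj.continuousAt.comp this)
    have h2 : ContinuousAt (fun p => -(H p * (k p)⁻¹)) (D.φ (D.psi z), conj (D.φ (D.psi z))) := by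
      rw [D.phi_psi him]
      exact hd.continuousOn.continuousAt ((isOpen_Dh σ).mem_nhds (diag_mem_Dh hs.pos hz))
    exact ContinuousAt.comp (f := fun x => (D.φ x, conj (D.φ x))) h2 h1
  have hEz : E (D.psi z) = -(H (z, conj z) * (k (z, conj z))⁻¹) := by
    simp only [E, D.phi_psi him]
  change -(H (z, conj z) * (k (z, conj z))⁻¹) = _
  rw [← hEz]
  -- Boundary points are limits of points of Ω, where V > 0, so the extension by continuity is
  -- determined there.
  have hcl : D.psi z ∈ closure {x | D.V x ≠ 0} := by
    by_cases h1 : D.V (D.psi z) = 0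
    · have hz1 : ‖z‖ = 1 := (D.V_psi_eq_zero_iff him).1 h1
      refine closure_mono (fun x hx => ?_) (D.psi_mem_frontier hz1).1
      have hxU := D.subset_U hx
      exact (D.V_pos hxU ((D.mem_Ω_iff hxU).1 hx)).ne'
    · exact subset_closure h1
  refine (extendFrom_eq hcl ?_).symm
  refine (hE.tendsto.mono_left nhdsWithin_le_nhds).congr' ?_
  have hin : annulus σ ∈ 𝓝 (D.φ (D.psi z)) := by
    rw [D.phi_psi him]; exact (isOpen_annulus σ).mem_nhds hz
  filter_upwards [nhdsWithin_le_nhds (hu.eventuallyEq hs hz), nhdsWithin_le_nhds (hV.eventuallyEq hs hz),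
    nhdsWithin_le_nhds ((D.analyticAt_phi hU).continuousAt hin), self_mem_nhdsWithin] with x h1 h2 h3 h4
  have hp := diag_mem_Dh hs.pos h3
  have h5 := hGH _ hp
  have h6 := hk0 _ hp
  have h7 : D.Vc x ≠ 0 := Complex.ofReal_ne_zero.2 h4
  rw [h1, h2]
  rw [h2] at h7
  rw [← h5]
  have h8 : D.φ x * conj (D.φ x) - 1 ≠ 0 := left_ne_zero_of_mul h7
  simp only [E]
  field_simp
  ring

end ExteriorData

end PlanarOP

end

open Filter Topology

noncomputable section

namespace PlanarOP

open Metric Set ComplexConjugate InnerProductSpace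
open scoped ComplexOrder

/-! ### Behaviour near the polarized circle -/

theorem circK_subset_Dh {σ : ℝ} (hσ : 0 < σ) : circK ⊆ Dh σ := by
  rintro _ ⟨c, hc, rfl⟩
  exact diag_mem_Dh hσ (mem_annulus_of_norm_one hσ (mem_sphere_zero_iff_norm.1 hc))

theorem eventually_norm_le_circK {σ : ℝ} (hσ : 0 < σ) {F : ℂ × ℂ → ℂ}
    (hF : DifferentiableOn ℂ F (Dh σ)) : ∃ M, ∀ᶠ p in 𝓝ˢ circK, ‖F p‖ ≤ M := by
  obtain ⟨M, hM⟩ := isCompact_circK.exists_bound_of_continuousOn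
    (hF.continuousOn.mono (circK_subset_Dh hσ))
  refine ⟨M + 1, eventually_nhdsSet_iff_forall.2 fun p hp => ?_⟩
  have hc := hF.continuousOn.continuousAt ((isOpen_Dh σ).mem_nhds (circK_subset_Dh hσ hp))
  filter_upwards [hc.norm.eventually_lt_const (lt_of_le_of_lt (hM p hp) (lt_add_one M))] with q hq
  exact hq.le

theorem eventually_lt_re_circK {σ : ℝ} (hσ : 0 < σ) {F : ℂ × ℂ → ℂ}
    (hF : DifferentiableOn ℂ F (Dh σ)) (h0 : ∀ c : ℂ, ‖c‖ = 1 → 0 < F (c, conj c)) :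
    ∃ η > 0, ∀ᶠ p in 𝓝ˢ circK, η < (F p).re := by
  have hc : ContinuousOn (fun p => (F p).re) circK :=
    Complex.continuous_re.comp_continuousOn (hF.continuousOn.mono (circK_subset_Dh hσ))
  have hne : circK.Nonempty := ⟨_, mem_circK (norm_one (α := ℂ))⟩
  obtain ⟨q, hq, hmin⟩ := isCompact_circK.exists_isMinOn hne hc
  have hq0 : 0 < (F q).re := by
    obtain ⟨c, hc1, rfl⟩ := hq
    exact (Complex.pos_iff.1 (h0 c (mem_sphere_zero_iff_norm.1 hc1))).1
  refine ⟨(F q).re / 2, half_pos hq0, eventually_nhdsSet_iff_forall.2 fun p hp => ?_⟩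
  have hc := hF.continuousOn.continuousAt ((isOpen_Dh σ).mem_nhds (circK_subset_Dh hσ hp))
  have h1 : (F q).re ≤ (F p).re := hmin hp
  exact (Complex.continuous_re.continuousAt.comp hc).eventually_const_lt
    (lt_of_lt_of_le (half_lt_self hq0) h1)

theorem mul_conj_of_norm_one {c : ℂ} (hc : ‖c‖ = 1) : c * conj c = 1 := by
  rw [Complex.mul_conj, Complex.normSq_eq_norm_sq, hc]; simp

theorem pos_of_pos_mul {a b : ℂ} (ha : 0 < a) (h : 0 < a * b) : 0 < b := by
  obtain ⟨r, hr, rfl⟩ : ∃ r : ℝ, 0 < r ∧ (r : ℂ) = a := by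
    obtain ⟨h1, h2⟩ := Complex.pos_iff.1 ha
    exact ⟨a.re, h1, Complex.ext rfl (by simpa using h2)⟩
  have : b = ((r⁻¹ : ℝ) : ℂ) * (r * b) := by
    rw [Complex.ofReal_inv, inv_mul_cancel_left₀ ha.ne']
  rw [this]
  exact mul_pos (by exact_mod_cast inv_pos.2 hr) h

/-! ### The Laplacian in Wirtinger form -/

theorem qLap_eq_laplacian {f : ℂ → ℂ} {x : ℂ} (hf : ContDiffAt ℝ 2 f x) :
    qLap f x = Laplacian.laplacian f x / 4 := by
  have h1 : DifferentiableAt ℝ (fderiv ℝ f) x :=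
    (hf.fderiv_right (m := 1) (by norm_num)).differentiableAt (by norm_num)
  have hv : ∀ v w : ℂ, fderiv ℝ (fun y => fderiv ℝ f y v) x w = fderiv ℝ (fderiv ℝ f) x w v := by
    intro v w
    rw [fderiv_clm_apply h1 (differentiableAt_const v)]
    simp
  have hd : ∀ v : ℂ, DifferentiableAt ℝ (fun y => fderiv ℝ f y v) x := fun v =>
    h1.clm_apply (differentiableAt_const v)
  have hz : ∀ w, fderiv ℝ (dzbar f) x w = (fderiv ℝ (fderiv ℝ f) x w 1 +
      Complex.I * fderiv ℝ (fderiv ℝ f) x w Complex.I) / 2 := by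
    intro w
    have : HasFDerivAt (𝕜 := ℝ) (dzbar f) _ x :=
      (((hd 1).hasFDerivAt.add ((hd Complex.I).hasFDerivAt.const_mul Complex.I)).mul_const (2 : ℂ)⁻¹)
    rw [this.fderiv]
    simp [hv]
    ring
  have hs := (hf.isSymmSndFDerivAt (by simp)) 1 Complex.I
  unfold qLap dz
  rw [hz, hz, laplacian_eq_iteratedFDeriv_complexPlane]
  simp only [iteratedFDeriv_two_apply, Matrix.cons_val_zero, Matrix.cons_val_one]
  rw [hs]
  linear_combination (-1 / 4 : ℂ) * fderiv ℝ (fderiv ℝ f) x Complex.I Complex.I * Complex.I_sq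

namespace ExteriorData

variable (D : ExteriorData)

/-- The square `V²` as a complex-valued function. -/
def sqV (x : ℂ) : ℂ := D.Vc x ^ 2

/-- V is only known to be C², but V² = Q - Q̆ is a real-analytic function minus a harmonic one. -/
theorem analyticAt_sqV_psi {c : ℂ} (hc : ‖c‖ = 1) :
    AnalyticAt ℝ (fun ζ => D.sqV (D.psi ζ)) c := by
  obtain ⟨Q, τ, Qb, hQ, hV⟩ := D.exists_potential
  obtain ⟨W, hW, hWf, hQa, -⟩ := hQ.strictly_subharmonic
  have him := D.circle_mem_image hc
  have h1 := hQa _ (hWf (D.psi_mem_frontier hc))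
  have h2 : AnalyticAt ℝ Qb (D.psi c) := HarmonicAt.analyticAt (hV.harmonic _ (D.psi_mem him))
  have h3 : AnalyticAt ℝ D.psi c := (D.analyticAt_psi him).restrictScalars
  have h4 : AnalyticAt ℝ (fun ζ => ((Q (D.psi ζ) - Qb (D.psi ζ) : ℝ) : ℂ)) c :=
    (Complex.ofRealCLM.analyticAt _).fun_comp ((h1.fun_comp h3).sub (h2.fun_comp h3))
  refine h4.congr ?_
  filter_upwards [D.isOpen_image.mem_nhds him] with ζ hζ
  rw [← hV.sq_eq _ (D.psi_mem hζ)]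
  simp [sqV, Vc]

/-- Q̆ is harmonic, so ΔV² = ΔQ, which is positive near the curve. -/
theorem qLap_sqV_pos {c : ℂ} (hc : ‖c‖ = 1) : 0 < qLap D.sqV (D.psi c) := by
  obtain ⟨Q, τ, Qb, hQ, hV⟩ := D.exists_potential
  obtain ⟨W, hW, hWf, hQa, hpos⟩ := hQ.strictly_subharmonic
  have him := D.circle_mem_image hc
  have hU := D.psi_mem him
  have h1 : ContDiffAt ℝ 2 Q (D.psi c) := hQ.contDiff.contDiffAt
  have h2 := hV.harmonic _ hU
  have hh : HarmonicAt Qb (D.psi c) := h2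
  have h3 : ContDiffAt ℝ 2 (Q - Qb) (D.psi c) := h1.sub hh.1
  have e : D.sqV =ᶠ[𝓝 (D.psi c)] (Complex.ofRealCLM ∘ (Q - Qb)) := by
    filter_upwards [D.isOpen_U.mem_nhds hU] with x hx
    simp only [sqV, Vc, Function.comp, Pi.sub_apply, Complex.ofRealCLM_apply]
    rw [← hV.sq_eq _ hx]; simp
  have h4 : ContDiffAt ℝ 2 D.sqV (D.psi c) :=
    (Complex.ofRealCLM.contDiff.contDiffAt.comp _ h3).congr_of_eventuallyEq e
  rw [qLap_eq_laplacian h4, (laplacian_congr_nhds e).eq_of_nhds,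
    h3.laplacian_CLM_comp_left, Function.comp_apply, h1.laplacian_sub hh.1, hh.2.eq_of_nhds]
  have := hpos _ (hWf (D.psi_mem_frontier hc))
  rw [Complex.pos_iff]
  constructor <;> simp [this]

theorem exists_pol_sqV : ∃ σ, D.Fits σ ∧ ∃ F, D.Pol σ D.sqV F := by
  obtain ⟨F, h1, h2⟩ := exists_complexification fun c hc => D.analyticAt_sqV_psi hc
  obtain ⟨σ₁, hσ₁, -, h3⟩ := exists_Dh_of_eventually h1
  obtain ⟨σ₂, hσ₂, -, h4⟩ := exists_annulus_of_eventually h2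
  obtain ⟨σ₃, hs⟩ := D.exists_fits
  refine ⟨min σ₁ (min σ₂ σ₃), hs.mono (lt_min hσ₁ (lt_min hσ₂ hs.pos))
    ((min_le_right _ _).trans (min_le_right _ _)), F, fun p hp => ?_, fun z hz => ?_⟩
  · exact (h3 _ (lt_min hσ₁ (lt_min hσ₂ hs.pos)) (min_le_left _ _) p hp).differentiableWithinAt
  · exact h4 _ (lt_min hσ₁ (lt_min hσ₂ hs.pos)) ((min_le_right _ _).trans (min_le_left _ _)) z hz

variable {D} {σ : ℝ} {F : ℂ × ℂ → ℂ}

theorem derivPol_mul_pos {c : ℂ} (hc : ‖c‖ = 1) :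
    0 < D.derivPol (c, conj c) * D.derivPolConj (c, conj c) := by
  simp only [derivPol, derivPolConj, Complex.conj_conj, Complex.mul_conj]
  rw [Complex.pos_iff]
  have := D.deriv_phi_ne_zero (D.psi_mem (D.circle_mem_image hc))
  simpa using this

theorem Pol.sqV_circle (hs : D.Fits σ) (h : D.Pol σ D.sqV F) {c : ℂ} (hc : ‖c‖ = 1) :
    F (c, conj c) = 0 ∧ pz F (c, conj c) = 0 := by
  have hca := mem_annulus_of_norm_one hs.pos hc
  have him := hs.subset hca
  have hcD := diag_mem_Dh hs.pos hca
  have h0 : D.Vc (D.psi c) = 0 := by simp [Vc, D.V_psi_circle hc]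
  refine ⟨by rw [h.2 c hca, sqV, h0]; simp, ?_⟩
  refine (pz_pw_eq_zero_of_antidiag (h.1.differentiableAt ((isOpen_Dh σ).mem_nhds hcD)) ?_).1
  have h1 : DifferentiableAt ℝ (fun ζ => D.Vc (D.psi ζ)) c := by
    have h2 : DifferentiableAt ℝ D.Vc (D.psi c) := Complex.ofRealCLM.differentiableAt.comp _
      ((D.contDiffAt_V (D.psi_mem him)).differentiableAt (by norm_num))
    exact h2.comp c ((D.analyticAt_psi him).differentiableAt.restrictScalars ℝ)
  have e : (fun ζ => F (ζ, conj ζ)) =ᶠ[𝓝 c] fun ζ => D.Vc (D.psi ζ) * D.Vc (D.psi ζ) := by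
    filter_upwards [(isOpen_annulus σ).mem_nhds hca] with ζ hζ
    rw [h.2 ζ hζ, sqV, sq]
  rw [e.fderiv_eq, fderiv_fun_mul h1 h1, h0]
  simp

/-- V² vanishes to second order on the curve, so 1 - zw divides its polarization twice. -/
theorem exists_sq_factor (hs : D.Fits σ) (h : D.Pol σ D.sqV F) :
    ∃ q, DifferentiableOn ℂ q (Dh σ) ∧ (∀ p ∈ Dh σ, F p = (1 - p.1 * p.2) ^ 2 * q p) ∧
      ∀ c : ℂ, ‖c‖ = 1 → 0 < q (c, conj c) := by
  have hW := isOpen_Dh σ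
  have h1 : ∀ p ∈ Dh σ, p.1 * p.2 = 1 → F p = 0 := fun p hp hp1 =>
    eq_zero_of_circle hs.pos h.1 (fun c hc => (h.sqV_circle hs hc).1) hp hp1
  have h2 : ∀ p ∈ Dh σ, p.1 * p.2 = 1 → divDiag F p = 0 := fun p hp hp1 =>
    eq_zero_of_circle hs.pos (differentiableOn_divDiag hW h.1 h1) (fun c hc => by
      rw [divDiag, if_pos (mul_conj_of_norm_one hc), (h.sqV_circle hs hc).2]; simp) hp hp1
  have hq := differentiableOn_divDiag hW (differentiableOn_divDiag hW h.1 h1) h2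
  have hF : ∀ p ∈ Dh σ, F p = (1 - p.1 * p.2) ^ 2 * divDiag (divDiag F) p := fun p hp => by
    rw [sq, mul_assoc, mul_divDiag (h2 p hp), mul_divDiag (h1 p hp)]
  set q := divDiag (divDiag F)
  refine ⟨q, hq, hF, fun c hc => ?_⟩
  have hca := mem_annulus_of_norm_one hs.pos hc
  have hcD := diag_mem_Dh hs.pos hca
  have hpw : ∀ p ∈ Dh σ, pw F p = (1 - p.1 * p.2) * (-2 * p.1 * q p + (1 - p.1 * p.2) * pw q p) := by
    intro p hp
    have a1 : HasDerivAt (fun w => (1 - p.1 * w) ^ 2 * q (p.1, w)) _ p.2 :=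
      ((((hasDerivAt_id p.2).const_mul p.1).const_sub 1).pow 2).mul
        (hasDerivAt_pw (hq.differentiableAt (hW.mem_nhds hp)))
    have a2 : (fun w => F (p.1, w)) =ᶠ[𝓝 p.2] fun w => (1 - p.1 * w) ^ 2 * q (p.1, w) := by
      have : Continuous fun w : ℂ => (p.1, w) := by fun_prop
      filter_upwards [this.continuousAt.preimage_mem_nhds (hW.mem_nhds hp)] with w hw
      exact hF _ hw
    rw [pw, a2.deriv_eq, a1.deriv]
    simp
    ring
  set K : ℂ × ℂ → ℂ := fun p => -2 * p.1 * q p + (1 - p.1 * p.2) * pw q p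
  have hK : DifferentiableOn ℂ K (Dh σ) :=
    ((differentiableOn_fst.const_mul (-2)).mul hq).add
      (((differentiableOn_fst.mul differentiableOn_snd).const_sub 1).mul (differentiableOn_pw hW hq))
  -- On the circle the mixed derivative of (1 - zw)² q is 2q. Hence ΔV² = 2|φ'|² q, and strict
  -- subharmonicity gives q > 0.
  have hpzpw : pz (pw F) (c, conj c) = 2 * q (c, conj c) := by
    have a1 : HasDerivAt (fun z => (1 - z * conj c) * K (z, conj c)) _ c :=
      (((hasDerivAt_id c).mul_const (conj c)).const_sub 1).mul
        (hasDerivAt_pz (hK.differentiableAt (hW.mem_nhds hcD)))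
    have a2 : (fun z => pw F (z, conj c)) =ᶠ[𝓝 c] fun z => (1 - z * conj c) * K (z, conj c) := by
      have : Continuous fun z : ℂ => (z, conj c) := by fun_prop
      filter_upwards [this.continuousAt.preimage_mem_nhds (hW.mem_nhds hcD)] with z hz
      exact hpw _ hz
    rw [pz]
    rw [a2.deriv_eq, a1.deriv]
    have := mul_conj_of_norm_one hc
    simp only [K, id, this]
    linear_combination 2 * q (c, conj c) * this
  have hl : _ * _ * pz (pw F) (c, conj c) = _ := (h.qLap hs).2 c hca
  rw [hpzpw] at hl
  have hp := D.qLap_sqV_pos hc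
  rw [← hl] at hp
  exact pos_of_pos_mul two_pos (pos_of_pos_mul (derivPol_mul_pos hc) hp)

theorem partials_vanishing_mul (hs : D.Fits σ) {k : ℂ × ℂ → ℂ} (hk : DifferentiableOn ℂ k (Dh σ)) {c : ℂ}
    (hc : ‖c‖ = 1) : pz (fun p => (p.1 * p.2 - 1) * k p) (c, conj c) = conj c * k (c, conj c) ∧
      pw (fun p => (p.1 * p.2 - 1) * k p) (c, conj c) = c * k (c, conj c) := by
  have hcD := diag_mem_Dh hs.pos (mem_annulus_of_norm_one hs.pos hc)
  have hd := hk.differentiableAt ((isOpen_Dh σ).mem_nhds hcD)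
  have h1 := mul_conj_of_norm_one hc
  constructor
  · have : HasDerivAt (fun z => (z * conj c - 1) * k (z, conj c)) _ c :=
      (((hasDerivAt_id c).mul_const (conj c)).sub_const 1).mul (hasDerivAt_pz hd)
    rw [pz, this.deriv]
    simp [h1]
  · have : HasDerivAt (fun w => (c * w - 1) * k (c, w)) _ (conj c) :=
      (((hasDerivAt_id (conj c)).const_mul c).sub_const 1).mul (hasDerivAt_pw hd)
    rw [pw, this.deriv]
    simp [h1]

/-- Near the circle q has positive real part, so its principal square root is a holomorphic,
zero-free choice of k. -/
theorem exists_pol_Vc (D : ExteriorData) : ∃ σ, D.Fits σ ∧ ∃ k : ℂ × ℂ → ℂ,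
    D.Pol σ D.Vc (fun p => (p.1 * p.2 - 1) * k p) ∧ DifferentiableOn ℂ k (Dh σ) ∧
      (∀ p ∈ Dh σ, k p ≠ 0) ∧ ∀ c : ℂ, ‖c‖ = 1 → 0 < k (c, conj c) := by
  obtain ⟨σ₁, hs₁, F, hF⟩ := D.exists_pol_sqV
  obtain ⟨q, hq, hFq, hq0⟩ := exists_sq_factor hs₁ hF
  obtain ⟨η, hη, hre⟩ := eventually_lt_re_circK hs₁.pos hq hq0
  obtain ⟨σ₂, hσ₂, -, h2⟩ := exists_Dh_of_eventually hre
  set σ := min σ₁ σ₂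
  have hσ : 0 < σ := lt_min hs₁.pos hσ₂
  have hs : D.Fits σ := hs₁.mono hσ (min_le_left _ _)
  have hqr : ∀ p ∈ Dh σ, 0 < (q p).re := fun p hp => hη.trans (h2 σ hσ (min_le_right _ _) p hp)
  have hsub := Dh_mono hσ (min_le_left σ₁ σ₂)
  have hk : DifferentiableOn ℂ (fun p => Complex.exp (2⁻¹ * Complex.log (q p))) (Dh σ) :=
    (((hq.mono hsub).clog fun p hp => Or.inl (hqr p hp)).const_mul _).cexp
  have hreal : ∀ z ∈ annulus σ, 0 < q (z, conj z) →
      ∃ r : ℝ, 0 < r ∧ Complex.exp (2⁻¹ * Complex.log (q (z, conj z))) = r ∧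
        q (z, conj z) = (r : ℂ) ^ 2 := by
    intro z hz hp
    obtain ⟨hp1, hp2⟩ := Complex.pos_iff.1 hp
    set r := (q (z, conj z)).re
    have e : q (z, conj z) = (r : ℂ) := Complex.ext rfl (by simpa using hp2.symm)
    refine ⟨Real.exp (2⁻¹ * Real.log r), Real.exp_pos _, ?_, ?_⟩
    · rw [e, ← Complex.ofReal_log hp1.le]; push_cast; rfl
    · rw [e, ← Complex.ofReal_pow, ← Real.exp_nat_mul]
      congr 1
      rw [Nat.cast_ofNat, mul_inv_cancel_left₀ two_ne_zero, Real.exp_log hp1]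
  refine ⟨σ, hs, _, ⟨((differentiableOn_fst.mul differentiableOn_snd).sub_const 1).mul hk, ?_⟩, hk,
    fun p hp => Complex.exp_ne_zero _, fun c hc => ?_⟩
  · intro z hz
    have him := hs.subset hz
    have hU := D.psi_mem him
    have hzD := diag_mem_Dh hσ hz
    by_cases h1 : ‖z‖ = 1
    · simp only [Vc, D.V_psi_circle h1, mul_conj_of_norm_one h1]
      simp
    have e1 : (D.Vc (D.psi z)) ^ 2 = (1 - z * conj z) ^ 2 * q (z, conj z) := by
      rw [← hFq _ (hsub hzD), hF.2 z (annulus_mono hσ (min_le_left _ _) hz), sqV]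
    set v := D.V (D.psi z) with hv
    have hzz : z * conj z = ((‖z‖ ^ 2 : ℝ) : ℂ) := by
      rw [Complex.mul_conj, Complex.normSq_eq_norm_sq]
    have hne : (‖z‖ ^ 2 - 1 : ℝ) ≠ 0 := fun h0 => h1 (by nlinarith [norm_nonneg z])
    have hv0 : v ≠ 0 := fun h0 => h1 ((D.V_psi_eq_zero_iff him).1 h0)
    have hqv : q (z, conj z) = ((v ^ 2 / (‖z‖ ^ 2 - 1) ^ 2 : ℝ) : ℂ) := by
      rw [hzz, Vc, ← hv] at e1
      have : (((‖z‖ ^ 2 - 1 : ℝ) : ℂ)) ≠ 0 := Complex.ofReal_ne_zero.2 hne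
      push_cast at this e1 ⊢
      rw [eq_div_iff (pow_ne_zero 2 this), e1]; ring
    obtain ⟨r, hr, hkr, hqr2⟩ := hreal z hz (by
      rw [hqv]; exact_mod_cast (by positivity : 0 < v ^ 2 / (‖z‖ ^ 2 - 1) ^ 2))
    change (z * conj z - 1) * Complex.exp (2⁻¹ * Complex.log (q (z, conj z))) = D.Vc (D.psi z)
    rw [hkr, Vc, ← hv, hzz]
    rw [hqv] at hqr2
    have e2 : v ^ 2 = ((‖z‖ ^ 2 - 1) * r) ^ 2 := by
      have : v ^ 2 / (‖z‖ ^ 2 - 1) ^ 2 = r ^ 2 := by exact_mod_cast hqr2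
      rw [div_eq_iff (pow_ne_zero 2 hne)] at this
      rw [this]; ring
    -- V is determined up to sign by its square. The sign conventions inside and outside the curve
    -- select (‖z‖² - 1) r, with r > 0.
    have e3 : v = (‖z‖ ^ 2 - 1) * r := by
      rcases sq_eq_sq_iff_eq_or_eq_neg.1 e2 with h | h
      · exact h
      exfalso
      rcases lt_or_gt_of_ne h1 with h3 | h3
      · have := D.V_neg hU (by rwa [D.phi_psi him])
        rw [← hv, h] at this
        nlinarith [norm_nonneg z, mul_pos hr (by nlinarith [norm_nonneg z] : 0 < 1 - ‖z‖ ^ 2)]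
      · have := D.V_pos hU (by rwa [D.phi_psi him])
        rw [← hv, h] at this
        nlinarith [norm_nonneg z, mul_pos hr (by nlinarith [norm_nonneg z] : 0 < ‖z‖ ^ 2 - 1)]
    rw [e3]; push_cast; ring
  · obtain ⟨r, hr, hkr, -⟩ := hreal c (mem_annulus_of_norm_one hσ hc) (hq0 c hc)
    simp only [hkr]
    exact_mod_cast hr

end ExteriorData

end PlanarOP

end

/-! ### Uniform bounds for V, |∂V|² and L near the curve -/

open Filter Topology

noncomputable section

namespace PlanarOP

open Metric Set ComplexConjugate InnerProductSpace
open scoped ComplexOrder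

namespace ExteriorData

variable {D : ExteriorData} {σ : ℝ}

/-- V is real, so ∂bar V is the conjugate of ∂V. The product form is the one that can be polarized.
-/
theorem gradSq_eq {x : ℂ} (h : x ∈ D.U) : D.gradSq x = dz D.Vc x * dzbar D.Vc x := by
  have hd : DifferentiableAt ℝ D.V x := (D.contDiffAt_V h).differentiableAt (by norm_num)
  have h1 : HasFDerivAt (𝕜 := ℝ) D.Vc (Complex.ofRealCLM.comp (fderiv ℝ D.V x)) x :=
    Complex.ofRealCLM.hasFDerivAt.comp x hd.hasFDerivAt
  have h2 : dzbar D.Vc x = conj (dz D.Vc x) := by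
    unfold dz dzbar
    rw [h1.fderiv]
    simp [map_ofNat]
  rw [h2, Complex.mul_conj, Complex.normSq_eq_norm_sq, gradSq]

theorem pol_log_phi (hs : D.Fits σ) (h : ∀ p ∈ Dh σ, p.1 * p.2 ∈ Complex.slitPlane) :
    D.Pol σ (fun x => (Real.log ‖D.φ x‖ : ℂ)) fun p => 2⁻¹ * Complex.log (p.1 * p.2) := by
  refine ⟨((differentiableOn_fst.mul differentiableOn_snd).clog h).const_mul _, fun z hz => ?_⟩
  have him := hs.subset hz
  simp only [D.phi_psi him, Complex.mul_conj, Complex.normSq_eq_norm_sq]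
  rw [← Complex.ofReal_log (by positivity), Real.log_pow]
  push_cast
  ring

theorem pol_one_sub_norm_sq (hs : D.Fits σ) :
    D.Pol σ (fun x => ((1 - ‖D.φ x‖ ^ 2 : ℝ) : ℂ)) fun p => 1 - p.1 * p.2 := by
  refine ⟨(differentiableOn_fst.mul differentiableOn_snd).const_sub 1, fun z hz => ?_⟩
  have him := hs.subset hz
  simp only [D.phi_psi him, Complex.mul_conj, Complex.normSq_eq_norm_sq]
  push_cast
  ring

variable (D) in
/-- Polarizations, with uniform bounds, of the functions from which `S` and `T` are built. -/
structure Model (σ M : ℝ) where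
  fits : D.Fits σ
  one_le : 1 ≤ M
  k : ℂ × ℂ → ℂ
  Γ : ℂ × ℂ → ℂ
  L₀ : ℂ × ℂ → ℂ
  L₁ : ℂ × ℂ → ℂ
  differentiableOn_k : DifferentiableOn ℂ k (Dh σ)
  k_ne_zero : ∀ p ∈ Dh σ, k p ≠ 0
  pol_Vc : D.Pol σ D.Vc fun p => (p.1 * p.2 - 1) * k p
  pol_gradSq : D.Pol σ D.gradSq Γ
  Γ_ne_zero : ∀ p ∈ Dh σ, Γ p ≠ 0
  pol_L : ∀ θ, D.Pol σ (D.L θ) fun p => L₀ p + θ * L₁ p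
  norm_k_inv : ∀ p ∈ Dh σ, ‖(k p)⁻¹‖ ≤ M
  norm_Γ : ∀ p ∈ Dh σ, ‖Γ p‖ ≤ M
  norm_Γ_inv : ∀ p ∈ Dh σ, ‖(Γ p)⁻¹‖ ≤ M
  norm_A : ∀ p ∈ Dh σ, ‖D.derivPol p‖ ≤ M
  norm_B : ∀ p ∈ Dh σ, ‖D.derivPolConj p‖ ≤ M
  norm_dzV : ∀ p ∈ Dh σ, ‖D.derivPol p * pz (fun p => (p.1 * p.2 - 1) * k p) p‖ ≤ M
  norm_dzbarV : ∀ p ∈ Dh σ, ‖D.derivPolConj p * pw (fun p => (p.1 * p.2 - 1) * k p) p‖ ≤ M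
  norm_qLapV : ∀ p ∈ Dh σ,
    ‖D.derivPol p * D.derivPolConj p * pz (pw fun p => (p.1 * p.2 - 1) * k p) p‖ ≤ M
  norm_L₀ : ∀ p ∈ Dh σ, ‖L₀ p‖ ≤ M
  norm_L₁ : ∀ p ∈ Dh σ, ‖L₁ p‖ ≤ M
  le_re_L₀ : ∀ p ∈ Dh σ, M⁻¹ ≤ (L₀ p).re

variable (D) in
theorem exists_model : ∃ σ M, Nonempty (D.Model σ M) := by
  obtain ⟨σ₀, hs₀, k, hV, hk, hk0, hkpos⟩ := D.exists_pol_Vc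
  have hσ₀ := hs₀.pos
  -- shrink so that `z w` stays in the slit plane
  obtain ⟨η₁, hη₁, hre₁⟩ := eventually_lt_re_circK (F := fun p => p.1 * p.2) hσ₀
    (differentiableOn_fst.mul differentiableOn_snd) fun c hc => by
      simp only [mul_conj_of_norm_one hc]; exact one_pos
  obtain ⟨σ₁', hσ₁', -, hsl⟩ := exists_Dh_of_eventually hre₁
  set σ₁ := min σ₀ σ₁'
  have hσ₁ : 0 < σ₁ := lt_min hσ₀ hσ₁'
  have hs : D.Fits σ₁ := hs₀.mono hσ₁ (min_le_left _ _)
  have hsub := Dh_mono hσ₁ (min_le_left σ₀ σ₁')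
  replace hV := hV.mono hσ₁ (min_le_left σ₀ σ₁')
  replace hk := hk.mono hsub
  replace hk0 : ∀ p ∈ Dh σ₁, k p ≠ 0 := fun p hp => hk0 p (hsub hp)
  have hslit : ∀ p ∈ Dh σ₁, p.1 * p.2 ∈ Complex.slitPlane := fun p hp =>
    Or.inl (hη₁.trans (hsl σ₁ hσ₁ (min_le_right _ _) p hp))
  have hW := isOpen_Dh σ₁
  have hcD : ∀ c : ℂ, ‖c‖ = 1 → (c, conj c) ∈ Dh σ₁ := fun c hc =>
    diag_mem_Dh hσ₁ (mem_annulus_of_norm_one hσ₁ hc)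
  set v : ℂ × ℂ → ℂ := fun p => (p.1 * p.2 - 1) * k p with hv
  set Γ : ℂ × ℂ → ℂ := fun p => (D.derivPol p * pz v p) * (D.derivPolConj p * pw v p)
  have hΓ : D.Pol σ₁ D.gradSq Γ := ((hV.dz hs).mul (hV.dzbar hs)).congr_left fun z hz =>
    gradSq_eq (D.psi_mem (hs.subset hz))
  have hΓc : ∀ c : ℂ, ‖c‖ = 1 →
      Γ (c, conj c) = D.derivPol (c, conj c) * D.derivPolConj (c, conj c) * k (c, conj c) ^ 2 := by
    intro c hc
    obtain ⟨e1, e2⟩ := partials_vanishing_mul hs hk hc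
    simp only [Γ, hv, e1, e2]
    linear_combination D.derivPol (c, conj c) * D.derivPolConj (c, conj c) * k (c, conj c) ^ 2 *
      mul_conj_of_norm_one hc
  have hΓpos : ∀ c : ℂ, ‖c‖ = 1 → 0 < Γ (c, conj c) := fun c hc => by
    rw [hΓc c hc, sq]
    exact mul_pos (derivPol_mul_pos hc) (mul_pos (hkpos c hc) (hkpos c hc))
  set N : ℂ × ℂ → ℂ := fun p => 2⁻¹ * Complex.log (p.1 * p.2)
  have hN : D.Pol σ₁ (fun x => (Real.log ‖D.φ x‖ : ℂ)) N := pol_log_phi hs hslit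
  have hN0 : ∀ p ∈ Dh σ₁, p.1 * p.2 = 1 → N p = 0 := fun p _ hp1 => by simp [N, hp1]
  have hH := differentiableOn_divDiag hW hN.1 hN0
  have hℓ := Pol.divV hs hV hk hk0 hN hH fun p hp => mul_divDiag (hN0 p hp)
  set ℓ : ℂ × ℂ → ℂ := fun p => -(divDiag N p * (k p)⁻¹)
  -- On zw = 1 the quotient of ½ log(zw) by zw - 1 tends to ½, which leaves 1/(2k).
  have hℓc : ∀ c : ℂ, ‖c‖ = 1 → ℓ (c, conj c) = 2⁻¹ * (k (c, conj c))⁻¹ := by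
    intro c hc
    have h1 := mul_conj_of_norm_one hc
    have hd : HasDerivAt (fun z => 2⁻¹ * Complex.log (z * conj c)) _ c :=
      (((hasDerivAt_id c).mul_const (conj c)).clog (hslit _ (hcD c hc))).const_mul 2⁻¹
    have hne : conj c ≠ 0 := right_ne_zero_of_mul (h1.symm ▸ one_ne_zero)
    simp only [ℓ, divDiag, h1, if_true]
    rw [show pz N (c, conj c) = _ from hd.deriv]
    simp only [id, h1]
    field_simp
  set L₀ : ℂ × ℂ → ℂ := fun p => 2 * Γ p * ℓ p
  set L₁ : ℂ × ℂ → ℂ := fun p => 2⁻¹ * (D.derivPol p * D.derivPolConj p * pz (pw ℓ) p)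
  have hL : ∀ θ, D.Pol σ₁ (D.L θ) fun p => L₀ p + θ * L₁ p := fun θ =>
    ((((hΓ.const_mul 2).mul hℓ).add ((hℓ.qLap hs).const_mul (θ / 2))).congr_left
      fun z _ => rfl).congr_right hσ₁ fun p _ => by simp only [L₀, L₁]; ring
  have hL₀d : DifferentiableOn ℂ L₀ (Dh σ₁) := (hΓ.1.const_mul 2).mul hℓ.1
  have hL₁d : DifferentiableOn ℂ L₁ (Dh σ₁) := (hℓ.qLap hs).1.const_mul _
  -- On the circle |∂V|² = |φ'|² k² and log|φ|/V = 1/(2k), so L at ϑ = 0 equals |φ'|² k > 0.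
  have hL₀pos : ∀ c : ℂ, ‖c‖ = 1 → 0 < L₀ (c, conj c) := fun c hc => by
    have h1 := (hkpos c hc).ne'
    have : L₀ (c, conj c) = D.derivPol (c, conj c) * D.derivPolConj (c, conj c) * k (c, conj c) := by
      simp only [L₀, hℓc c hc, hΓc c hc]
      field_simp
    rw [this]
    exact mul_pos (derivPol_mul_pos hc) (hkpos c hc)
  obtain ⟨η₂, hη₂, hre₂⟩ := eventually_lt_re_circK hσ₁ hL₀d hL₀pos
  obtain ⟨η₃, hη₃, hre₃⟩ := eventually_lt_re_circK hσ₁ hΓ.1 hΓpos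
  obtain ⟨M₁, hM₁⟩ := eventually_norm_le_circK hσ₁ (hk.inv hk0)
  obtain ⟨M₂, hM₂⟩ := eventually_norm_le_circK hσ₁ hΓ.1
  obtain ⟨M₃, hM₃⟩ := eventually_norm_le_circK hσ₁ (differentiableOn_derivPol hs)
  obtain ⟨M₄, hM₄⟩ := eventually_norm_le_circK hσ₁ (differentiableOn_derivPolConj hs)
  obtain ⟨M₅, hM₅⟩ := eventually_norm_le_circK hσ₁ (hV.dz hs).1
  obtain ⟨M₆, hM₆⟩ := eventually_norm_le_circK hσ₁ (hV.dzbar hs).1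
  obtain ⟨M₇, hM₇⟩ := eventually_norm_le_circK hσ₁ (hV.qLap hs).1
  obtain ⟨M₈, hM₈⟩ := eventually_norm_le_circK hσ₁ hL₀d
  obtain ⟨M₉, hM₉⟩ := eventually_norm_le_circK hσ₁ hL₁d
  have hev := hre₂.and (hre₃.and (hM₁.and (hM₂.and (hM₃.and (hM₄.and (hM₅.and (hM₆.and
    (hM₇.and (hM₈.and hM₉)))))))))
  obtain ⟨σ₂', hσ₂', -, hfin⟩ := exists_Dh_of_eventually hev
  set σ := min σ₁ σ₂'
  have hσ : 0 < σ := lt_min hσ₁ hσ₂'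
  have hle := min_le_left σ₁ σ₂'
  have hsub' := Dh_mono hσ hle
  replace hfin := hfin σ hσ (min_le_right _ _)
  obtain ⟨M, hM⟩ := Finset.exists_le
    ({1, M₁, M₂, M₃, M₄, M₅, M₆, M₇, M₈, M₉, η₂⁻¹, η₃⁻¹} : Finset ℝ)
  simp only [Finset.mem_insert, Finset.mem_singleton, forall_eq_or_imp, forall_eq] at hM
  obtain ⟨b0, b1, b2, b3, b4, b5, b6, b7, b8, b9, b10, b11⟩ := hM
  exact ⟨σ, M, ⟨{
    fits := hs.mono hσ hle
    one_le := b0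
    k := k, Γ := Γ, L₀ := L₀, L₁ := L₁
    differentiableOn_k := hk.mono hsub'
    k_ne_zero := fun p hp => hk0 p (hsub' hp)
    pol_Vc := hV.mono hσ hle
    pol_gradSq := hΓ.mono hσ hle
    Γ_ne_zero := fun p hp h0 => by
      have := hη₃.trans (hfin p hp).2.1
      rw [h0] at this
      exact this.ne' rfl
    pol_L := fun θ => (hL θ).mono hσ hle
    norm_k_inv := fun p hp => (hfin p hp).2.2.1.trans b1
    norm_Γ := fun p hp => (hfin p hp).2.2.2.1.trans b2
    norm_Γ_inv := fun p hp => by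
      rw [norm_inv]
      exact (inv_anti₀ hη₃ ((hfin p hp).2.1.le.trans (Complex.re_le_norm _))).trans b11
    norm_A := fun p hp => (hfin p hp).2.2.2.2.1.trans b3
    norm_B := fun p hp => (hfin p hp).2.2.2.2.2.1.trans b4
    norm_dzV := fun p hp => (hfin p hp).2.2.2.2.2.2.1.trans b5
    norm_dzbarV := fun p hp => (hfin p hp).2.2.2.2.2.2.2.1.trans b6
    norm_qLapV := fun p hp => (hfin p hp).2.2.2.2.2.2.2.2.1.trans b7
    norm_L₀ := fun p hp => (hfin p hp).2.2.2.2.2.2.2.2.2.1.trans b8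
    norm_L₁ := fun p hp => (hfin p hp).2.2.2.2.2.2.2.2.2.2.trans b9
    le_re_L₀ := fun p hp => (inv_le_of_inv_le₀ hη₂ b10).trans (hfin p hp).1.le }⟩⟩

end ExteriorData

end PlanarOP

end

/-! ### Polarizations of S and T, and the norm estimate for S -/

open Filter Topology

noncomputable section

namespace PlanarOP

open Metric Set ComplexConjugate

namespace ExteriorData

variable {D : ExteriorData} {σ σ₁ M : ℝ} {f : ℂ → ℂ} {F W G : ℂ × ℂ → ℂ} {g h : ℂ → ℂ}

theorem norm_splitPol_sub_le {σ K : ℝ} {F : ℂ × ℂ → ℂ} {g h : ℂ → ℂ} (hσ : 0 < σ)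
    (hσ1 : σ ≤ 1 / 8) (hF : ∀ p ∈ Dh σ, ‖F p‖ ≤ K)
    (hsp : ∀ p ∈ Dh σ, ‖splitPol g h p‖ ≤ 4 * K / σ) :
    ∀ p ∈ Dh σ, ‖splitPol g h p - F p‖ ≤ 5 * K / σ := by
  intro p hp
  have hK : 0 ≤ K := (norm_nonneg _).trans (hF p hp)
  have h1 : K ≤ K / σ := le_div_self hK hσ (by linarith)
  calc _ ≤ 4 * K / σ + K := (norm_sub_le _ _).trans (add_le_add (hsp p hp) (hF p hp))
    _ ≤ 4 * K / σ + K / σ := by gcongr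
    _ = _ := by ring

namespace Model

theorem M_pos (m : D.Model σ₁ M) : 0 < M := zero_lt_one.trans_le m.one_le

variable (m : D.Model σ₁ M)

theorem pol_divV (h0 : 0 < σ) (hσ : σ ≤ σ₁) {u : ℂ → ℂ} {H : ℂ × ℂ → ℂ} (hu : D.Pol σ u G)
    (hH : DifferentiableOn ℂ H (Dh σ)) (hGH : ∀ p ∈ Dh σ, (1 - p.1 * p.2) * H p = G p) :
    D.Pol σ (D.divV u) fun p => -(H p * (m.k p)⁻¹) :=
  Pol.divV (m.fits.mono h0 hσ) (m.pol_Vc.mono h0 hσ) (m.differentiableOn_k.mono (Dh_mono h0 hσ))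
    (fun _ hp => m.k_ne_zero _ (Dh_mono h0 hσ hp)) hu hH hGH

theorem pol_defDivV (h0 : 0 < σ) (hσ : σ ≤ σ₁) : D.Pol σ D.defDivV fun p => -(m.k p)⁻¹ := by
  have := m.pol_divV h0 hσ (H := fun _ => 1) (pol_one_sub_norm_sq (m.fits.mono h0 hσ))
    (differentiableOn_const 1) fun p _ => mul_one _
  simp only [one_mul] at this
  exact this

/-- The polarization of `S[f]` in terms of those of `f` and of `(P - I) f / V`. -/
def sPol (θ : ℂ) (F W : ℂ × ℂ → ℂ) (p : ℂ × ℂ) : ℂ :=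
  D.derivPol p * pz (fun p => (p.1 * p.2 - 1) * m.k p) p * (D.derivPolConj p * pw F p)
    + D.derivPolConj p * pw (fun p => (p.1 * p.2 - 1) * m.k p) p * (D.derivPol p * pz F p)
    + F p * (D.derivPol p * D.derivPolConj p * pz (pw fun p => (p.1 * p.2 - 1) * m.k p) p)
    + m.Γ p * W p + θ / 4 * (D.derivPol p * D.derivPolConj p * pz (pw W) p)

theorem exists_quotient (h0 : 0 < σ) (hσ : σ ≤ σ₁) (hF : DifferentiableOn ℂ F (Dh σ))
    (hs : Split σ F g h) :
    ∃ W, DifferentiableOn ℂ W (Dh σ) ∧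
      ∀ p ∈ Dh σ, (1 - p.1 * p.2) * W p = -((splitPol g h p - F p) * (m.k p)⁻¹) := by
  have hk : DifferentiableOn ℂ (fun p => (m.k p)⁻¹) (Dh σ) :=
    (m.differentiableOn_k.mono (Dh_mono h0 hσ)).inv fun p hp => m.k_ne_zero p (Dh_mono h0 hσ hp)
  have hz : ∀ p ∈ Dh σ, p.1 * p.2 = 1 → -((splitPol g h p - F p) * (m.k p)⁻¹) = 0 :=
    fun p hp hp1 => by rw [hs.circle hp hp1, sub_self, zero_mul, neg_zero]
  exact ⟨_, differentiableOn_divDiag (isOpen_Dh σ) (((differentiableOn_splitPol h0 hs).sub hF).mul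
    hk).neg hz, fun p hp => mul_divDiag (hz p hp)⟩

theorem pol_S (h0 : 0 < σ) (hσ : σ ≤ σ₁) (hF : D.Pol σ f F) (hs : Split σ F g h)
    (hW : DifferentiableOn ℂ W (Dh σ))
    (hWF : ∀ p ∈ Dh σ, (1 - p.1 * p.2) * W p = -((splitPol g h p - F p) * (m.k p)⁻¹)) (θ : ℂ) :
    D.Pol σ (D.S θ f) (m.sPol θ F W) := by
  have hfit := m.fits.mono h0 hσ
  have hk0 : ∀ p ∈ Dh σ, m.k p ≠ 0 := fun p hp => m.k_ne_zero p (Dh_mono h0 hσ hp)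
  have hV := m.pol_Vc.mono h0 hσ
  have hdiv : D.Pol σ (D.divV (D.P f - f)) W := by
    refine (m.pol_divV h0 hσ ((hF.P hfit hs).sub hF)
      (hW.mul (m.differentiableOn_k.mono (Dh_mono h0 hσ))).neg fun p hp => ?_).congr_right h0
      fun p hp => ?_
    · have h1 := hk0 p hp
      have h2 := hWF p hp
      calc _ = -((1 - p.1 * p.2) * W p) * m.k p := by simp only [Pi.neg_apply, Pi.mul_apply]; ring
        _ = _ := by rw [h2]; field_simp
    · have h1 := hk0 p hp
      simp only [Pi.neg_apply, Pi.mul_apply]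
      field_simp
  exact ((((((hV.dz hfit).mul (hF.dzbar hfit)).add ((hV.dzbar hfit).mul (hF.dz hfit))).add
    (hF.mul (hV.qLap hfit))).add ((m.pol_gradSq.mono h0 hσ).mul hdiv)).add
    ((hdiv.qLap hfit).const_mul (θ / 4))).congr_left fun z _ => rfl

/-- Linearity of `S` on polarizations: it lets the bound for S[f - g] control S[f] - S[g]. -/
theorem sPol_sub (θ : ℂ) {F₁ F₂ W₁ W₂ : ℂ × ℂ → ℂ} (h1 : DifferentiableOn ℂ F₁ (Dh σ))
    (h2 : DifferentiableOn ℂ F₂ (Dh σ)) (h3 : DifferentiableOn ℂ W₁ (Dh σ))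
    (h4 : DifferentiableOn ℂ W₂ (Dh σ)) {p : ℂ × ℂ} (hp : p ∈ Dh σ) :
    m.sPol θ (fun p => F₁ p - F₂ p) (fun p => W₁ p - W₂ p) p =
      m.sPol θ F₁ W₁ p - m.sPol θ F₂ W₂ p := by
  have hW := isOpen_Dh σ
  have key : ∀ {A B : ℂ × ℂ → ℂ}, DifferentiableOn ℂ A (Dh σ) → DifferentiableOn ℂ B (Dh σ) →
      ∀ q ∈ Dh σ, pz (fun p => A p - B p) q = pz A q - pz B q ∧
        pw (fun p => A p - B p) q = pw A q - pw B q := fun hA hB q hq =>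
    ⟨((hasDerivAt_pz (hA.differentiableAt (hW.mem_nhds hq))).sub
      (hasDerivAt_pz (hB.differentiableAt (hW.mem_nhds hq)))).deriv,
     ((hasDerivAt_pw (hA.differentiableAt (hW.mem_nhds hq))).sub
      (hasDerivAt_pw (hB.differentiableAt (hW.mem_nhds hq)))).deriv⟩
  have e : pz (pw fun p => W₁ p - W₂ p) p = pz (pw W₁) p - pz (pw W₂) p := by
    rw [← (key (differentiableOn_pw hW h3) (differentiableOn_pw hW h4) p hp).1]
    have : (fun z => pw (fun p => W₁ p - W₂ p) (z, p.2)) =ᶠ[𝓝 p.1]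
        fun z => pw W₁ (z, p.2) - pw W₂ (z, p.2) := by
      have hc : Continuous fun z : ℂ => (z, p.2) := by fun_prop
      filter_upwards [hc.continuousAt.preimage_mem_nhds (hW.mem_nhds hp)] with z hz
      exact (key h3 h4 _ hz).2
    exact this.deriv_eq
  simp only [sPol, e, (key h1 h2 p hp).1, (key h1 h2 p hp).2]
  ring

/-- The gap b - a is cut into three equal steps δ: one for dividing by 1 - zw, one for each
derivative in the Laplacian of (P - I)f/V. Only the terms with P carry the factor 1/a. -/
theorem norm_sPol_le (θ : ℂ) {a b K : ℝ} (ha : 0 < a) (hab : a < b) (hb : b ≤ σ₁)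
    (hF : DifferentiableOn ℂ F (Dh b)) (hK : ∀ p ∈ Dh b, ‖F p‖ ≤ K)
    (hsp : ∀ p ∈ Dh b, ‖splitPol g h p‖ ≤ 4 * K / b) (hW : DifferentiableOn ℂ W (Dh b))
    (hWF : ∀ p ∈ Dh b, (1 - p.1 * p.2) * W p = -((splitPol g h p - F p) * (m.k p)⁻¹)) :
    ∀ p ∈ Dh a, ‖m.sPol θ F W p‖ ≤ M0 (1000 * M ^ 3) b a θ * K := by
  intro p hp
  have hb0 := ha.trans hab
  have hb8 : b ≤ 1 / 8 := hb.trans m.fits.le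
  have hM := m.M_pos
  have hK0 : 0 ≤ K := (norm_nonneg _).trans (hK p (Dh_mono ha hab.le hp))
  obtain ⟨δ, hδ, rfl⟩ : ∃ δ, 0 < δ ∧ b = a + 3 * δ := ⟨(b - a) / 3, by linarith, by ring⟩
  have hN : ∀ p ∈ Dh (a + 3 * δ), ‖-((splitPol g h p - F p) * (m.k p)⁻¹)‖ ≤ 5 * K * M / a := by
    intro q hq
    rw [norm_neg, norm_mul]
    calc _ ≤ 5 * K / (a + 3 * δ) * M := by
          gcongr
          · exact norm_splitPol_sub_le hb0 hb8 hK hsp q hq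
          · exact m.norm_k_inv q (Dh_mono hb0 hb hq)
      _ ≤ 5 * K / a * M := by gcongr
      _ = _ := by ring
  have hW1 := norm_quotient_le (a := a + 2 * δ) (by positivity) (by linarith) hb8 hW hWF hN
  have hm2 := Dh_mono (a := a + 2 * δ) (b := a + 3 * δ) (by positivity) (by linarith)
  have hm1 := Dh_mono (a := a + δ) (b := a + 2 * δ) (by positivity) (by linarith)
  have hW2 := norm_pw_le (a := a + δ) (b := a + 2 * δ) (by positivity) (by linarith) (by linarith)
    (hW.mono hm2) hW1
  have hW3 := norm_pz_le (a := a) (b := a + δ) (by positivity) (by linarith) (by linarith)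
    (differentiableOn_pw (isOpen_Dh _) ((hW.mono hm2).mono hm1)) hW2
  have hF1 := norm_pz_le ha hab hb8 hF hK p hp
  have hF2 := norm_pw_le ha hab hb8 hF hK p hp
  have hpa : p ∈ Dh (a + 2 * δ) := Dh_mono ha (by linarith) hp
  have hpb : p ∈ Dh (a + 3 * δ) := hm2 hpa
  have hp1 : p ∈ Dh σ₁ := Dh_mono hb0 hb hpb
  have w1 := hW1 p hpa
  have w3 := hW3 p hp
  have e1 : a + 3 * δ - (a + 2 * δ) = δ := by ring
  have e2 : a + 2 * δ - (a + δ) = δ := by ring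
  have e3 : a + δ - a = δ := by ring
  have e4 : a + 3 * δ - a = 3 * δ := by ring
  rw [e1] at w1
  rw [e1, e2, e3] at w3
  rw [e4] at hF1 hF2
  have t1 : ‖D.derivPol p * pz (fun p => (p.1 * p.2 - 1) * m.k p) p * (D.derivPolConj p * pw F p)‖
      ≤ M * (M * (3 * K / (3 * δ))) := by
    rw [norm_mul, norm_mul (D.derivPolConj p)]
    gcongr
    · exact m.norm_dzV p hp1
    · exact m.norm_B p hp1
  have t2 : ‖D.derivPolConj p * pw (fun p => (p.1 * p.2 - 1) * m.k p) p * (D.derivPol p * pz F p)‖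
      ≤ M * (M * (3 * K / (3 * δ))) := by
    rw [norm_mul, norm_mul (D.derivPol p)]
    gcongr
    · exact m.norm_dzbarV p hp1
    · exact m.norm_A p hp1
  have t3 : ‖F p * (D.derivPol p * D.derivPolConj p *
      pz (pw fun p => (p.1 * p.2 - 1) * m.k p) p)‖ ≤ K * M := by
    rw [norm_mul]
    gcongr
    · exact hK p hpb
    · exact m.norm_qLapV p hp1
  have t4 : ‖m.Γ p * W p‖ ≤ M * (3 * (5 * K * M / a) / δ) := by
    rw [norm_mul]
    gcongr
    exact m.norm_Γ p hp1
  have t5 : ‖θ / 4 * (D.derivPol p * D.derivPolConj p * pz (pw W) p)‖ ≤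
      ‖θ‖ / 4 * (M * M * (3 * (3 * (3 * (5 * K * M / a) / δ) / δ) / δ)) := by
    rw [norm_mul, norm_mul, norm_mul, norm_div, Complex.norm_ofNat]
    gcongr
    · exact m.norm_A p hp1
    · exact m.norm_B p hp1
  have h1 := m.one_le
  have ha1 : a ≤ 1 := by linarith
  have hδ1 : δ ≤ 1 := by linarith
  calc _ ≤ M * (M * (3 * K / (3 * δ))) + M * (M * (3 * K / (3 * δ))) + K * M
        + M * (3 * (5 * K * M / a) / δ)
        + ‖θ‖ / 4 * (M * M * (3 * (3 * (3 * (5 * K * M / a) / δ) / δ) / δ)) := by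
        refine (norm_add_le _ _).trans (add_le_add ((norm_add_le _ _).trans (add_le_add
          ((norm_add_le _ _).trans (add_le_add ((norm_add_le _ _).trans (add_le_add t1 t2)) t3))
          t4)) t5)
    _ = (2 * M ^ 2 * a + M * (a * δ) + 15 * M ^ 2) * (K / (a * δ)) +
          135 / 4 * M ^ 3 * (‖θ‖ * K / (a * δ ^ 3)) := by
        field_simp
        ring
    -- With b - a = 3δ the ϑ-term needs 27 · 135/4 ≤ 1000. The other terms need only 18 ≤ 1000/3, as
    -- a, δ ≤ 1 ≤ M.
    _ ≤ (1000 / 3 * M ^ 3) * (K / (a * δ)) + 1000 / 27 * M ^ 3 * (‖θ‖ * K / (a * δ ^ 3)) := by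
        have hM2 : M ^ 2 ≤ M ^ 3 := pow_le_pow_right₀ h1 (by norm_num)
        have hM1 : M ≤ M ^ 3 := le_self_pow₀ h1 (by norm_num)
        have i1 : M ^ 2 * a ≤ M ^ 2 := mul_le_of_le_one_right (by positivity) ha1
        have i2 : M * (a * δ) ≤ M :=
          mul_le_of_le_one_right hM.le (mul_le_one₀ ha1 hδ.le hδ1)
        gcongr ?_ * _ + ?_ * _
        · linarith [pow_pos hM 3]
        · linarith [pow_pos hM 3]
    _ = _ := by
        unfold M0
        rw [e4]
        field_simp
        ring

/-- On the curve the Poisson extension of a logarithm is that logarithm, so the numerator of T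
vanishes on zw = 1 and division by V is legitimate. -/
theorem exists_pol_T (h0 : 0 < σ) (hσ : σ ≤ σ₁) {θ : ℂ}
    (hX : D.Pol σ (fun w => D.L θ w + θ * D.S θ f w) G) (hG : ∀ p ∈ Dh σ, G p ∈ Complex.slitPlane)
    (hs : Split σ (fun p => Complex.log (G p)) g h) :
    ∃ H, DifferentiableOn ℂ H (Dh σ) ∧
      (∀ p ∈ Dh σ, (1 - p.1 * p.2) * H p = G p - Complex.exp (splitPol g h p)) ∧
      D.Pol σ (D.T θ f) fun p => -(H p * (m.k p)⁻¹) * (4 * m.Γ p)⁻¹ := by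
  have hfit := m.fits.mono h0 hσ
  have hN := hX.sub ((hX.log hG).P hfit hs).exp
  have hz : ∀ p ∈ Dh σ, p.1 * p.2 = 1 → G p - Complex.exp (splitPol g h p) = 0 := fun p hp hp1 => by
    rw [hs.circle hp hp1, Complex.exp_log (Complex.slitPlane_ne_zero (hG p hp)), sub_self]
  have hH := differentiableOn_divDiag (isOpen_Dh σ) hN.1 hz
  refine ⟨_, hH, fun p hp => mul_divDiag (hz p hp), ?_⟩
  exact ((m.pol_divV h0 hσ hN hH fun p hp => mul_divDiag (hz p hp)).mul
    (((m.pol_gradSq.mono h0 hσ).const_mul 4).inv fun p hp =>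
      mul_ne_zero (OfNat.ofNat_ne_zero 4) (m.Γ_ne_zero p (Dh_mono h0 hσ hp)))).congr_left
        fun z _ => div_eq_mul_inv _ _

end Model

end ExteriorData

end PlanarOP

end

open Filter Topology

noncomputable section

namespace PlanarOP

open Metric Set ComplexConjugate

/-! ### Elementary estimates for the logarithm and the exponential -/

/-- Both arguments lie in (-π/2, π/2), so their sum does not cross the branch cut. -/
theorem log_mul_of_re_pos {a b : ℂ} (ha : 0 < a.re) (hb : 0 < b.re) :
    a * b ∈ Complex.slitPlane ∧ Complex.log (a * b) = Complex.log a + Complex.log b := by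
  have ha0 : a ≠ 0 := fun h => by simp [h] at ha
  have hb0 : b ≠ 0 := fun h => by simp [h] at hb
  have h1 := abs_lt.1 (Complex.abs_arg_lt_pi_div_two_iff.2 (Or.inl ha))
  have h2 := abs_lt.1 (Complex.abs_arg_lt_pi_div_two_iff.2 (Or.inl hb))
  have h3 : a.arg + b.arg ∈ Ioc (-Real.pi) Real.pi := ⟨by linarith, by linarith⟩
  refine ⟨Complex.mem_slitPlane_iff_arg.2 ⟨?_, mul_ne_zero ha0 hb0⟩, Complex.log_mul ha0 hb0 h3⟩
  rw [Complex.arg_mul ha0 hb0 h3]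
  linarith

theorem norm_log_le {z : ℂ} {M : ℝ} (hM : 1 ≤ M) (h1 : M⁻¹ ≤ ‖z‖) (h2 : ‖z‖ ≤ M) :
    ‖Complex.log z‖ ≤ M + 4 := by
  have hz : 0 < ‖z‖ := lt_of_lt_of_le (by positivity) h1
  have h3 : Real.log ‖z‖ ≤ M := (Real.log_le_sub_one_of_pos hz).trans (by linarith)
  have h4 : -M ≤ Real.log ‖z‖ := by
    have := Real.one_sub_inv_le_log_of_pos hz
    have : ‖z‖⁻¹ ≤ M := inv_le_of_inv_le₀ (by linarith) h1
    linarith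
  calc ‖Complex.log z‖ ≤ |(Complex.log z).re| + |(Complex.log z).im| := Complex.norm_le_abs_re_add_abs_im _
    _ ≤ M + 4 := by
      rw [Complex.log_re, Complex.log_im]
      exact add_le_add (abs_le.2 ⟨h4, h3⟩) ((Complex.abs_arg_le_pi z).trans Real.pi_le_four)

theorem norm_log_one_add_sub_le {x y : ℂ} (hx : ‖x‖ ≤ 1 / 4) (hy : ‖y‖ ≤ 1 / 4) :
    ‖Complex.log (1 + x) - Complex.log (1 + y)‖ ≤ 4 / 3 * ‖x - y‖ := by
  have hn : ∀ z ∈ closedBall (0 : ℂ) (1 / 4), 3 / 4 ≤ (1 + z).re := fun z hz => by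
    have h1 := (Complex.abs_re_le_norm z).trans (mem_closedBall_zero_iff.1 hz)
    have := (abs_le.1 h1).1
    simp only [Complex.add_re, Complex.one_re]
    linarith
  refine (convex_closedBall (0 : ℂ) (1 / 4)).norm_image_sub_le_of_norm_hasDerivWithin_le
    (f := fun z => Complex.log (1 + z)) (f' := fun z => 1 / (1 + z)) (fun z hz => ?_)
    (fun z hz => ?_) (mem_closedBall_zero_iff.2 hy) (mem_closedBall_zero_iff.2 hx)
  · exact (((hasDerivAt_id z).const_add 1).clog
      (Or.inl (lt_of_lt_of_le (by norm_num) (hn z hz)))).hasDerivWithinAt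
  · rw [norm_div, norm_one, div_le_iff₀ (lt_of_lt_of_le (by norm_num)
      ((hn z hz).trans (Complex.re_le_norm _)))]
    linarith [(hn z hz).trans (Complex.re_le_norm _)]

/-- The radius 2/3 is below log 2, so exp has derivative at most 2 on the disc. -/
theorem norm_exp_sub_exp_le {a b : ℂ} (ha : ‖a‖ ≤ 2 / 3) (hb : ‖b‖ ≤ 2 / 3) :
    ‖Complex.exp a - Complex.exp b‖ ≤ 2 * ‖a - b‖ := by
  refine (convex_closedBall (0 : ℂ) (2 / 3)).norm_image_sub_le_of_norm_hasDerivWithin_le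
    (f := Complex.exp) (f' := Complex.exp) (fun z _ => (Complex.hasDerivAt_exp z).hasDerivWithinAt)
    (fun z hz => ?_) (mem_closedBall_zero_iff.2 hb) (mem_closedBall_zero_iff.2 ha)
  rw [Complex.norm_exp, ← Real.le_log_iff_exp_le two_pos]
  have := (Complex.re_le_norm z).trans (mem_closedBall_zero_iff.1 hz)
  linarith [Real.log_two_gt_d9]

theorem norm_exp_le (z : ℂ) : ‖Complex.exp z‖ ≤ Real.exp ‖z‖ := by
  rw [Complex.norm_exp]
  exact Real.exp_le_exp.2 (Complex.re_le_norm z)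

theorem closed_annulus_subset {a b : ℝ} (ha : 0 < a) (hab : a < b) (hb : b ≤ 1 / 8) :
    {ζ : ℂ | rho a ≤ ‖ζ‖ ∧ ‖ζ‖ ≤ (rho a)⁻¹} ⊆ annulus b := by
  have h1 := rho_sub_le ha hab.le hb
  have h2 := rho_inv_sub_le ha hab.le hb
  exact fun ζ hζ => ⟨by linarith [hζ.1], by linarith [hζ.2]⟩

namespace ExteriorData

variable {D : ExteriorData} {σ σ₁ M : ℝ} {f : ℂ → ℂ} {F : ℂ × ℂ → ℂ} {g h : ℂ → ℂ}

theorem memH_zero (σ : ℝ) : D.MemH σ 0 := (pol_zero σ).memH (M := 0) fun p _ => by simp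

theorem hNorm_zero (hσ : 0 < σ) : D.hNorm σ 0 ≤ 0 := (pol_zero σ).hNorm_le hσ fun p _ => by simp

/-! ### The operator norm of `P` -/

section OpNorm

variable {B : ℝ}

theorem opNorm_mem_le (hP : ∀ f, D.MemH σ f → D.InBall σ (B / σ * D.hNorm σ f) (D.P f))
    (hσ : 0 < σ) (hB : 0 ≤ B) {f : ℂ → ℂ} (h : D.MemH σ f) (h1 : D.hNorm σ f ≤ 1) :
    D.hNorm σ (D.P f) ≤ B / σ :=
  (hP f h).2.trans (mul_le_of_le_one_right (by positivity) h1)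

theorem opNorm_le (hP : ∀ f, D.MemH σ f → D.InBall σ (B / σ * D.hNorm σ f) (D.P f))
    (hσ : 0 < σ) (hB : 0 ≤ B) : D.opNorm σ D.P ≤ B / σ := by
  refine csSup_le ⟨_, 0, memH_zero σ, (hNorm_zero hσ).trans zero_le_one, rfl⟩ ?_
  rintro _ ⟨f, h, h1, rfl⟩
  exact opNorm_mem_le hP hσ hB h h1

/-- Scaling to the unit ball; K = 0 is treated separately. The hypothesis `hP` makes the supremum
defining `opNorm` finite. -/
theorem norm_splitPol_le_opNorm (hP : ∀ f, D.MemH σ f → D.InBall σ (B / σ * D.hNorm σ f) (D.P f))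
    (hσ : 0 < σ) (hB : 0 ≤ B) (hs : D.Fits σ) (hF : D.Pol σ f F) (hsp : Split σ F g h) {K : ℝ}
    (hK : ∀ p ∈ Dh σ, ‖F p‖ ≤ K) : ∀ p ∈ Dh σ, ‖splitPol g h p‖ ≤ D.opNorm σ D.P * K := by
  intro p hp
  have hK0 : 0 ≤ K := (norm_nonneg _).trans (hK p hp)
  rcases hK0.eq_or_lt with rfl | hKpos
  · have h1 := hP f (hF.memH hK)
    have h2 := hF.hNorm_le hσ hK
    calc _ ≤ D.hNorm σ (D.P f) := (hF.P hs hsp).norm_le_hNorm hσ h1.1 hp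
      _ ≤ B / σ * D.hNorm σ f := h1.2
      _ ≤ B / σ * 0 := by gcongr
      _ = _ := by ring
  · have hF' : D.Pol σ (fun z => ((K⁻¹ : ℝ) : ℂ) * f z) fun p => ((K⁻¹ : ℝ) : ℂ) * F p :=
      hF.const_mul _
    have hK' : ∀ p ∈ Dh σ, ‖((K⁻¹ : ℝ) : ℂ) * F p‖ ≤ 1 := fun q hq => by
      rw [norm_mul, Complex.norm_real, Real.norm_of_nonneg (inv_nonneg.2 hK0), inv_mul_le_iff₀ hKpos,
        mul_one]
      exact hK q hq
    have hm := hF'.memH hK'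
    have h1 := hF'.hNorm_le hσ hK'
    have h2 := (hF'.P hs (hsp.const_mul _)).norm_le_hNorm hσ (hP _ hm).1 hp
    have h3 : D.hNorm σ (D.P fun z => ((K⁻¹ : ℝ) : ℂ) * f z) ≤ D.opNorm σ D.P := by
      refine le_csSup ⟨B / σ, ?_⟩ ⟨_, hm, h1, rfl⟩
      rintro _ ⟨u, h, h1, rfl⟩
      exact opNorm_mem_le hP hσ hB h h1
    have e : splitPol (fun z => ((K⁻¹ : ℝ) : ℂ) * g z) (fun z => ((K⁻¹ : ℝ) : ℂ) * h z) p =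
        ((K⁻¹ : ℝ) : ℂ) * splitPol g h p := by simp only [splitPol]; ring
    rw [e, norm_mul, Complex.norm_real, Real.norm_of_nonneg (inv_nonneg.2 hK0),
      inv_mul_le_iff₀ hKpos] at h2
    calc _ ≤ _ := h2
      _ ≤ K * D.opNorm σ D.P := by gcongr
      _ = _ := mul_comm _ _

end OpNorm

theorem P_inBall (hs : D.Fits σ) (hf : D.MemH σ f) : D.InBall σ (4 / σ * D.hNorm σ f) (D.P f) := by
  obtain ⟨F, hF, hK⟩ := hf.exists_pol hs.pos
  obtain ⟨g, h, hsp, hb⟩ := exists_split hs.pos hs.le hF.1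
  refine (hF.P hs hsp).inBall hs.pos fun p hp => ?_
  rw [div_mul_eq_mul_div]
  exact hb _ hK p hp

/-! ### Bounds for 1/L, P[log L] and T[0] -/

namespace Model

variable (m : D.Model σ₁ M)

theorem isSBound (m : D.Model σ₁ M) (hσs : σ ≤ σ₁) : D.IsSBound σ (1000 * M ^ 3) := by
  have hM := m.M_pos
  refine ⟨by positivity, fun b a ha hab hb θ f hf => ?_⟩
  have hb0 := ha.trans hab
  have hb1 := hb.trans hσs
  obtain ⟨F, hF, hK⟩ := hf.exists_pol hb0
  obtain ⟨g, h, hsp, hbd⟩ := exists_split hb0 (hb1.trans m.fits.le) hF.1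
  obtain ⟨W, hW, hWF⟩ := m.exists_quotient hb0 hb1 hF.1 hsp
  exact ((m.pol_S hb0 hb1 hF hsp hW hWF θ).mono ha hab.le).inBall ha
    (m.norm_sPol_le θ ha hab hb1 hF.1 hK (hbd _ hK) hW hWF)

/-- The polarization of `L`. -/
def lPol (θ : ℂ) (p : ℂ × ℂ) : ℂ := m.L₀ p + θ * m.L₁ p

variable {θ : ℂ}

/-- The bound on ϑ is chosen so that this perturbation is at most half of the lower bound 1/M for
the real part of L₀. -/
theorem norm_mul_L₁_le (hθ : ‖θ‖ ≤ (2 * M ^ 2)⁻¹) {p : ℂ × ℂ} (hp : p ∈ Dh σ₁) :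
    ‖θ * m.L₁ p‖ ≤ (2 * M)⁻¹ := by
  have hM := m.M_pos
  rw [norm_mul]
  calc _ ≤ (2 * M ^ 2)⁻¹ * M := by gcongr; exact m.norm_L₁ p hp
    _ = _ := by field_simp

theorem le_re_lPol (hθ : ‖θ‖ ≤ (2 * M ^ 2)⁻¹) {p : ℂ × ℂ} (hp : p ∈ Dh σ₁) :
    (2 * M)⁻¹ ≤ (m.lPol θ p).re := by
  have h1 := m.norm_mul_L₁_le hθ hp
  have h2 := (abs_le.1 ((Complex.abs_re_le_norm _).trans h1)).1
  have h3 := m.le_re_L₀ p hp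
  have hM := m.M_pos
  have h4 : M⁻¹ = (2 * M)⁻¹ + (2 * M)⁻¹ := by field_simp; norm_num
  rw [lPol, Complex.add_re]
  linarith

theorem re_lPol_pos (hθ : ‖θ‖ ≤ (2 * M ^ 2)⁻¹) {p : ℂ × ℂ} (hp : p ∈ Dh σ₁) :
    0 < (m.lPol θ p).re := by
  have hM := m.M_pos
  exact lt_of_lt_of_le (by positivity) (m.le_re_lPol hθ hp)

theorem norm_lPol_le (hθ : ‖θ‖ ≤ (2 * M ^ 2)⁻¹) {p : ℂ × ℂ} (hp : p ∈ Dh σ₁) :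
    ‖m.lPol θ p‖ ≤ 2 * M := by
  have h1 := m.one_le
  have h2 : (2 * M)⁻¹ ≤ 1 := inv_le_one_of_one_le₀ (by linarith)
  have := (norm_add_le _ _).trans (add_le_add (m.norm_L₀ p hp) (m.norm_mul_L₁_le hθ hp))
  rw [lPol]
  linarith

theorem norm_log_lPol_le (hθ : ‖θ‖ ≤ (2 * M ^ 2)⁻¹) {p : ℂ × ℂ} (hp : p ∈ Dh σ₁) :
    ‖Complex.log (m.lPol θ p)‖ ≤ 2 * M + 4 :=
  norm_log_le (by linarith [m.one_le]) ((m.le_re_lPol hθ hp).trans (Complex.re_le_norm _))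
    (m.norm_lPol_le hθ hp)

theorem norm_lPol_inv_le (hθ : ‖θ‖ ≤ (2 * M ^ 2)⁻¹) {p : ℂ × ℂ} (hp : p ∈ Dh σ₁) :
    ‖(m.lPol θ p)⁻¹‖ ≤ 2 * M := by
  have hM := m.M_pos
  rw [norm_inv]
  exact inv_le_of_inv_le₀ (by positivity) ((m.le_re_lPol hθ hp).trans (Complex.re_le_norm _))

theorem pol_L_inv (hθ : ‖θ‖ ≤ (2 * M ^ 2)⁻¹) :
    D.Pol σ₁ (fun z => (D.L θ z)⁻¹) fun p => (m.lPol θ p)⁻¹ :=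
  (m.pol_L θ).inv fun _ hp h0 => (m.re_lPol_pos hθ hp).ne' (by rw [lPol, h0]; rfl)

theorem pol_log_L (hθ : ‖θ‖ ≤ (2 * M ^ 2)⁻¹) :
    D.Pol σ₁ (fun z => Complex.log (D.L θ z)) fun p => Complex.log (m.lPol θ p) :=
  (m.pol_L θ).log fun _ hp => Or.inl (m.re_lPol_pos hθ hp)

theorem exists_split_log (hθ : ‖θ‖ ≤ (2 * M ^ 2)⁻¹) :
    ∃ g h, Split σ₁ (fun p => Complex.log (m.lPol θ p)) g h ∧
      ∀ p ∈ Dh σ₁, ‖splitPol g h p‖ ≤ 4 * (2 * M + 4) / σ₁ := by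
  obtain ⟨g, h, h1, h2⟩ := exists_split m.fits.pos m.fits.le (m.pol_log_L hθ).1
  exact ⟨g, h, h1, h2 _ fun p hp => m.norm_log_lPol_le hθ hp⟩

/-- S[0] = 0 is read off from the norm estimate for `S` with K = 0. -/
theorem pol_L_add_S_zero {a : ℝ} (ha : 0 < a) (ha1 : a < σ₁) (θ : ℂ) :
    D.Pol a (fun w => D.L θ w + θ * D.S θ 0 w) (m.lPol θ) := by
  have hs1 := m.fits.pos
  obtain ⟨W, hW, hWF⟩ := m.exists_quotient hs1 le_rfl (F := 0) (differentiableOn_const 0)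
    (split_zero σ₁)
  have hS := (m.pol_S hs1 le_rfl (pol_zero σ₁) (split_zero σ₁) hW hWF θ).mono ha ha1.le
  have h0 := m.norm_sPol_le θ (K := 0) ha ha1 le_rfl (F := 0) (g := 0) (h := 0)
    (differentiableOn_const 0) (fun p _ => by simp) (fun p _ => by simp [splitPol]) hW hWF
  refine (((m.pol_L θ).mono ha ha1.le).add (hS.const_mul θ)).congr_right ha fun p hp => ?_
  have := h0 p hp
  rw [mul_zero] at this
  rw [norm_le_zero_iff.1 this, mul_zero, add_zero, lPol]

theorem T_zero_inBall (m : D.Model σ₁ M) {a b : ℝ} (ha : 0 < a) (hab : a < b) (hb : b < σ₁)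
    (hθ : ‖θ‖ ≤ (2 * M ^ 2)⁻¹) : D.InBall a
      (3 * (2 * M + Real.exp (4 * (2 * M + 4) / σ₁)) / (b - a) * M * M) (D.T θ 0) := by
  have hb0 := ha.trans hab
  have hM := m.M_pos
  have hd : 0 < b - a := sub_pos.2 hab
  obtain ⟨g, h, h1, h2⟩ := m.exists_split_log hθ
  have hsub := Dh_mono hb0 hb.le
  obtain ⟨H, hH, hHN, hT⟩ := m.exists_pol_T hb0 hb.le (m.pol_L_add_S_zero hb0 hb θ)
    (fun p hp => Or.inl (m.re_lPol_pos hθ (hsub hp))) (h1.mono hb0 hb.le)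
  have hbd := norm_quotient_le ha hab (hb.le.trans m.fits.le) hH hHN fun p hp =>
    (norm_sub_le _ _).trans (add_le_add (m.norm_lPol_le hθ (hsub hp))
      ((norm_exp_le _).trans (Real.exp_le_exp.2 (h2 p (hsub hp)))))
  refine (hT.mono ha hab.le).inBall ha fun p hp => ?_
  have hp1 : p ∈ Dh σ₁ := hsub (Dh_mono ha hab.le hp)
  rw [norm_mul, norm_neg, norm_mul]
  have : ‖(4 * m.Γ p)⁻¹‖ ≤ M := by
    rw [mul_inv, norm_mul, norm_inv, Complex.norm_ofNat]
    have := m.norm_Γ_inv p hp1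
    linarith [norm_nonneg (m.Γ p)⁻¹]
  gcongr
  · exact hbd p hp
  · exact m.norm_k_inv p hp1

theorem exists_isRange (m : D.Model σ₁ M) : ∃ B, 1 ≤ B ∧ D.IsRange (σ₁ / 2) (2 * M ^ 2)⁻¹ B := by
  have hM := m.M_pos
  have h1 := m.fits.pos
  have h2 : 0 < σ₁ / 2 := half_pos h1
  set E := 3 * (2 * M + Real.exp (4 * (2 * M + 4) / σ₁)) / (3 * σ₁ / 4 - σ₁ / 2) * M * M
  obtain ⟨B, hB⟩ := Finset.exists_le ({4, M, 2 * M, E, 4 * (2 * M + 4) / σ₁} : Finset ℝ)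
  simp only [Finset.mem_insert, Finset.mem_singleton, forall_eq_or_imp, forall_eq] at hB
  obtain ⟨b1, b2, b3, b4, b5⟩ := hB
  have hle : ∀ σ, σ ≤ σ₁ / 2 → σ ≤ σ₁ := fun σ h => by linarith
  refine ⟨B, by linarith, ?_, ?_, ?_, ?_, ?_, ?_, ?_⟩
  · exact (closed_annulus_subset h2 (half_lt_self h1) m.fits.le).trans m.fits.subset
  · intro σ h0 hσ
    exact ((m.pol_gradSq.inv m.Γ_ne_zero).mono h0 (hle σ hσ)).inBall h0 fun p hp =>
      (m.norm_Γ_inv p (Dh_mono h0 (hle σ hσ) hp)).trans b2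
  · intro σ h0 hσ
    refine (m.pol_defDivV h0 (hle σ hσ)).inBall h0 fun p hp => ?_
    rw [norm_neg]
    exact (m.norm_k_inv p (Dh_mono h0 (hle σ hσ) hp)).trans b2
  · intro σ h0 hσ θ hθ
    exact ((m.pol_L_inv hθ).mono h0 (hle σ hσ)).inBall h0 fun p hp =>
      (m.norm_lPol_inv_le hθ (Dh_mono h0 (hle σ hσ) hp)).trans b3
  · intro σ h0 hσ θ hθ
    -- T[0] is bounded once, at the largest parameter σ₁/2, with the collar up to 3σ₁/4 spent on the
    -- division by V. Smaller parameters inherit the bound.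
    obtain ⟨hm, hn⟩ := m.T_zero_inBall (b := 3 * σ₁ / 4) h2 (by linarith) (by linarith) hθ
    obtain ⟨G, hG, hGb⟩ := hm.exists_pol h2
    exact (hG.mono h0 hσ).inBall h0 fun p hp => (hGb p (Dh_mono h0 hσ hp)).trans (hn.trans b4)
  · intro σ h0 hσ θ hθ
    obtain ⟨g, h, hs, hb⟩ := m.exists_split_log hθ
    exact (((m.pol_log_L hθ).P m.fits hs).mono h0 (hle σ hσ)).inBall h0 fun p hp =>
      (hb p (Dh_mono h0 (hle σ hσ) hp)).trans b5
  · intro σ h0 hσ f hf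
    obtain ⟨hm, hn⟩ := P_inBall (m.fits.mono h0 (hle σ hσ)) hf
    refine ⟨hm, hn.trans ?_⟩
    have := hNorm_nonneg (D := D) σ f
    gcongr

end Model

end ExteriorData

end PlanarOP

end

/-! ### The Lipschitz estimate for T -/

open Filter Topology

noncomputable section

namespace PlanarOP

open Metric Set ComplexConjugate

theorem M0_nonneg {C a b : ℝ} (hC : 0 ≤ C) (ha : 0 < a) (hab : a < b) (θ : ℂ) :
    0 ≤ M0 C b a θ := by
  have : 0 < b - a := sub_pos.2 hab
  unfold M0
  positivity

namespace ExteriorData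

variable {D : ExteriorData} {σ₁ M s : ℝ} {θ : ℂ}

theorem r0_nonneg (σs ε₀ : ℝ) : 0 ≤ D.r0 σs ε₀ := by
  refine mul_nonneg zero_le_two (Real.sSup_nonneg ?_)
  rintro _ ⟨θ, -, rfl⟩
  exact hNorm_nonneg _ _

theorem supInvL_nonneg (ε₀ σ : ℝ) : 0 ≤ D.supInvL ε₀ σ := by
  refine Real.sSup_nonneg ?_
  rintro _ ⟨θ, -, rfl⟩
  exact hNorm_nonneg _ _

theorem opNorm_nonneg (σ : ℝ) (A : (ℂ → ℂ) → ℂ → ℂ) : 0 ≤ D.opNorm σ A := by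
  refine Real.sSup_nonneg ?_
  rintro _ ⟨f, -, -, rfl⟩
  exact hNorm_nonneg _ _

theorem IsRange.hNorm_L_inv_le {σs ε₀ B : ℝ} (hR : D.IsRange σs ε₀ B) (h0 : 0 < s) (hs : s ≤ σs)
    (hθ : ‖θ‖ ≤ ε₀) : D.hNorm s (fun z => (D.L θ z)⁻¹) ≤ D.supInvL ε₀ s := by
  refine le_csSup ⟨B, ?_⟩ ⟨θ, mem_closedBall_zero_iff.2 hθ, rfl⟩
  rintro _ ⟨η, hη, rfl⟩
  exact (hR.L_inv s h0 hs η (mem_closedBall_zero_iff.1 hη)).2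

theorem IsRange.supInvL_le {σs ε₀ B : ℝ} (hR : D.IsRange σs ε₀ B) (h0 : 0 < s) (hs : s ≤ σs)
    (hε : 0 ≤ ε₀) : D.supInvL ε₀ s ≤ B := by
  refine csSup_le ⟨_, 0, mem_closedBall_self hε, rfl⟩ ?_
  rintro _ ⟨η, hη, rfl⟩
  exact (hR.L_inv s h0 hs η (mem_closedBall_zero_iff.1 hη)).2

theorem m1_bounds {σs ε₀ C₀ σ t : ℝ} (hε : 0 < ε₀) (hθ : ‖θ‖ ≤ (D.m1 σs ε₀ C₀ σ t θ)⁻¹) :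
    ‖θ‖ ≤ ε₀ ∧ 4 * M0 C₀ σ t θ * D.supInvL ε₀ t * D.r0 σs ε₀ * ‖θ‖ ≤ 1 ∧
      2 * D.opNorm t D.P * M0 C₀ σ t θ * D.supInvL ε₀ t * D.r0 σs ε₀ * ‖θ‖ ≤ 1 := by
  set μ := D.m1 σs ε₀ C₀ σ t θ
  have h1 : ε₀⁻¹ ≤ μ := (le_max_left _ _).trans (le_max_left _ _)
  have hμ : 0 < μ := (inv_pos.2 hε).trans_le h1
  have h2 : μ * ‖θ‖ ≤ 1 := by
    have := mul_le_mul_of_nonneg_left hθ hμ.le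
    rwa [mul_inv_cancel₀ hμ.ne'] at this
  have h3 := norm_nonneg θ
  refine ⟨hθ.trans (inv_le_of_inv_le₀ hε h1), ?_, ?_⟩
  · exact (mul_le_mul_of_nonneg_right ((le_max_right _ _).trans (le_max_left _ _)) h3).trans h2
  · exact (mul_le_mul_of_nonneg_right (le_max_right _ _) h3).trans h2

namespace Model

variable (m : D.Model σ₁ M)

/-- The factor exp(P log L) does not depend on f. Separating it leaves only exp(P log(1 + x)) to
compare between two functions. -/
theorem exists_pol_T_of_small (h0 : 0 < s) (hs : s ≤ σ₁) (hθ : ‖θ‖ ≤ (2 * M ^ 2)⁻¹) {f : ℂ → ℂ}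
    {Sf : ℂ × ℂ → ℂ} (hSf : D.Pol s (D.S θ f) Sf)
    (hx : ∀ p ∈ Dh s, ‖θ * Sf p * (m.lPol θ p)⁻¹‖ ≤ 1 / 4) {g h gx hx' : ℂ → ℂ}
    (hL : Split s (fun p => Complex.log (m.lPol θ p)) g h)
    (hX : Split s (fun p => Complex.log (1 + θ * Sf p * (m.lPol θ p)⁻¹)) gx hx') :
    ∃ H, DifferentiableOn ℂ H (Dh s) ∧
      (∀ p ∈ Dh s, (1 - p.1 * p.2) * H p = m.lPol θ p + θ * Sf p -
        Complex.exp (splitPol g h p) * Complex.exp (splitPol gx hx' p)) ∧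
      D.Pol s (D.T θ f) fun p => -(H p * (m.k p)⁻¹) * (4 * m.Γ p)⁻¹ := by
  have key : ∀ p ∈ Dh s, m.lPol θ p + θ * Sf p ∈ Complex.slitPlane ∧
      Complex.log (m.lPol θ p + θ * Sf p) =
        Complex.log (m.lPol θ p) + Complex.log (1 + θ * Sf p * (m.lPol θ p)⁻¹) := by
    intro p hp
    have h1 := m.re_lPol_pos hθ (Dh_mono h0 hs hp)
    have h2 : m.lPol θ p ≠ 0 := fun h => by simp [h] at h1
    have h3 : m.lPol θ p + θ * Sf p = m.lPol θ p * (1 + θ * Sf p * (m.lPol θ p)⁻¹) := by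
      field_simp
    rw [h3]
    refine log_mul_of_re_pos h1 ?_
    have := (abs_le.1 ((Complex.abs_re_le_norm _).trans (hx p hp))).1
    rw [Complex.add_re, Complex.one_re]
    linarith
  obtain ⟨H, hH, hHN, hT⟩ := m.exists_pol_T h0 hs (((m.pol_L θ).mono h0 hs).add (hSf.const_mul θ))
    (fun p hp => (key p hp).1) ((hL.add hX).congr h0 fun p hp => (key p hp).2)
  refine ⟨H, hH, fun p hp => ?_, hT⟩
  rw [hHN p hp, ← Complex.exp_add]
  simp only [splitPol, lPol]
  ring_nf

/-- The gap is halved: from b to the midpoint s for applying `S`, from s to a for the final division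
by V. -/
theorem T_sub_le (m : D.Model σ₁ M) {B C₀ a b : ℝ} (hR : D.IsRange (σ₁ / 2) (2 * M ^ 2)⁻¹ B) (hB : 0 ≤ B)
    (hS : D.IsSBound (σ₁ / 2) C₀) (ha : 0 < a) (hab : a < b) (hb : b ≤ σ₁ / 2)
    (hθ : ‖θ‖ ≤ (D.m1 (σ₁ / 2) (2 * M ^ 2)⁻¹ C₀ b ((b + a) / 2) θ)⁻¹) {f g : ℂ → ℂ}
    (hf : D.InBall b (D.r0 (σ₁ / 2) (2 * M ^ 2)⁻¹) f)
    (hg : D.InBall b (D.r0 (σ₁ / 2) (2 * M ^ 2)⁻¹) g) :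
    D.MemH a (D.T θ f) ∧ D.MemH a (D.T θ g) ∧ D.hNorm a (D.T θ f - D.T θ g) ≤
      D.lipConst (2 * M ^ 2)⁻¹ b a θ * M0 C₀ b ((b + a) / 2) θ * ‖θ‖ * D.hNorm b (f - g) := by
  have hM := m.M_pos
  have hε : 0 < (2 * M ^ 2)⁻¹ := by positivity
  set ε := (2 * M ^ 2)⁻¹ with hε_def
  obtain ⟨hθε, hm1, hm2⟩ := m1_bounds hε hθ
  unfold lipConst
  obtain ⟨s, hs⟩ : ∃ s, s = (b + a) / 2 := ⟨_, rfl⟩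
  rw [← hs] at hm1 hm2 ⊢
  have hb0 : 0 < b := ha.trans hab
  have h0 : 0 < s := by linarith
  have has : a < s := by linarith
  have hsb : s < b := by linarith
  have hσ₁ := m.fits.pos
  have hbσ : b ≤ σ₁ := by linarith
  have hsσ : s ≤ σ₁ := by linarith
  have hss : s ≤ σ₁ / 2 := by linarith
  have hfit := m.fits.mono h0 hsσ
  set r := D.r0 (σ₁ / 2) ε
  set Λ := D.supInvL ε s
  set O := D.opNorm s D.P
  set μ := M0 C₀ b s θ
  set κ := D.hNorm b (f - g)
  have hr : 0 ≤ r := r0_nonneg _ _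
  have hΛ : 0 ≤ Λ := supInvL_nonneg _ _
  have hO : 0 ≤ O := opNorm_nonneg _ _
  have hμ : 0 ≤ μ := M0_nonneg hS.1.le h0 hsb θ
  have hκ : 0 ≤ κ := hNorm_nonneg _ _
  have hP := hR.P_bound s h0 hss
  -- polarizations of `S f`, `S g` and of their difference
  obtain ⟨F, hF, hFb⟩ := hf.1.exists_pol hb0
  obtain ⟨G, hG, hGb⟩ := hg.1.exists_pol hb0
  obtain ⟨g₁, h₁, hsp₁, -⟩ := exists_split hb0 (hbσ.trans m.fits.le) hF.1
  obtain ⟨g₂, h₂, hsp₂, -⟩ := exists_split hb0 (hbσ.trans m.fits.le) hG.1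
  obtain ⟨W₁, hW₁, hWF₁⟩ := m.exists_quotient hb0 hbσ hF.1 hsp₁
  obtain ⟨W₂, hW₂, hWF₂⟩ := m.exists_quotient hb0 hbσ hG.1 hsp₂
  have hS₁ := (m.pol_S hb0 hbσ hF hsp₁ hW₁ hWF₁ θ).mono h0 hsb.le
  have hS₂ := (m.pol_S hb0 hbσ hG hsp₂ hW₂ hWF₂ θ).mono h0 hsb.le
  have hFG : D.Pol b (f - g) fun p => F p - G p := hF.sub hG
  -- The quotient for f - g is the difference of the two quotients already chosen, so the bound for
  -- `S` applies to the difference.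
  have hS₃ := (m.pol_S hb0 hbσ hFG (hsp₁.sub hsp₂) (hW₁.sub hW₂) (fun p hp => by
    simp only [splitPol, Pi.sub_apply]
    have e1 := hWF₁ p hp
    have e2 := hWF₂ p hp
    simp only [splitPol] at e1 e2
    linear_combination e1 - e2) θ).mono h0 hsb.le
  have hfg : D.MemH b (f - g) := hFG.memH (M := r + r) fun p hp =>
    (norm_sub_le _ _).trans (add_le_add ((hFb p hp).trans hf.2) ((hGb p hp).trans hg.2))
  set S₁ := m.sPol θ F W₁
  set S₂ := m.sPol θ G W₂
  have bS : ∀ {u : ℂ → ℂ} {E : ℂ × ℂ → ℂ}, D.MemH b u → D.Pol s (D.S θ u) E →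
      ∀ p ∈ Dh s, ‖E p‖ ≤ μ * D.hNorm b u := fun hu hE p hp =>
    have := hS.2 b s h0 hsb hb θ _ hu
    (hE.norm_le_hNorm h0 this.1 hp).trans this.2
  have bS₁ : ∀ p ∈ Dh s, ‖S₁ p‖ ≤ μ * r := fun p hp =>
    (bS hf.1 hS₁ p hp).trans (mul_le_mul_of_nonneg_left hf.2 hμ)
  have bS₂ : ∀ p ∈ Dh s, ‖S₂ p‖ ≤ μ * r := fun p hp =>
    (bS hg.1 hS₂ p hp).trans (mul_le_mul_of_nonneg_left hg.2 hμ)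
  have bS₃ : ∀ p ∈ Dh s, ‖S₁ p - S₂ p‖ ≤ μ * κ := fun p hp => by
    have := bS hfg hS₃ p hp
    rwa [show m.sPol θ (fun p => F p - G p) (W₁ - W₂) p = S₁ p - S₂ p from
      m.sPol_sub θ hF.1 hG.1 hW₁ hW₂ (Dh_mono h0 hsb.le hp)] at this
  -- the relative perturbations
  set L := m.lPol θ
  have bL : ∀ p ∈ Dh s, ‖(L p)⁻¹‖ ≤ Λ := fun p hp =>
    (((m.pol_L_inv hθε).mono h0 hsσ).norm_le_hNorm h0 (hR.L_inv s h0 hss θ hθε).1 hp).trans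
      (hR.hNorm_L_inv_le h0 hss hθε)
  have bx : ∀ {E : ℂ × ℂ → ℂ} {K : ℝ}, (∀ p ∈ Dh s, ‖E p‖ ≤ K) →
      ∀ p ∈ Dh s, ‖θ * E p * (L p)⁻¹‖ ≤ ‖θ‖ * K * Λ := fun hE p hp => by
    have hK := (norm_nonneg _).trans (hE p hp)
    rw [norm_mul, norm_mul]
    gcongr
    · exact hE p hp
    · exact bL p hp
  -- This is the second entry of `m1`, which contains a factor 4.
  have hq : ‖θ‖ * (μ * r) * Λ ≤ 1 / 4 := by linarith
  have bx₁ : ∀ p ∈ Dh s, ‖θ * S₁ p * (L p)⁻¹‖ ≤ 1 / 4 := fun p hp => (bx bS₁ p hp).trans hq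
  have bx₂ : ∀ p ∈ Dh s, ‖θ * S₂ p * (L p)⁻¹‖ ≤ 1 / 4 := fun p hp => (bx bS₂ p hp).trans hq
  have bx₃ : ∀ p ∈ Dh s, ‖θ * S₁ p * (L p)⁻¹ - θ * S₂ p * (L p)⁻¹‖ ≤ ‖θ‖ * (μ * κ) * Λ := fun p hp => by
    rw [← sub_mul, ← mul_sub]
    exact bx bS₃ p hp
  have one_pol : D.Pol s (fun _ => 1) fun _ => 1 := ⟨differentiableOn_const 1, fun _ _ => rfl⟩
  have plog : ∀ {u : ℂ → ℂ} {E : ℂ × ℂ → ℂ}, D.Pol s (D.S θ u) E →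
      (∀ p ∈ Dh s, ‖θ * E p * (L p)⁻¹‖ ≤ 1 / 4) →
      D.Pol s (fun z => Complex.log (1 + θ * D.S θ u z * (D.L θ z)⁻¹)) fun p =>
        Complex.log (1 + θ * E p * (L p)⁻¹) := fun hE hx =>
    (one_pol.add ((hE.const_mul θ).mul ((m.pol_L_inv hθε).mono h0 hsσ))).log fun p hp => by
      left
      have := (abs_le.1 ((Complex.abs_re_le_norm _).trans (hx p hp))).1
      rw [Complex.add_re, Complex.one_re]
      linarith
  have pl₁ := plog hS₁ bx₁
  have pl₂ := plog hS₂ bx₂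
  obtain ⟨u₁, v₁, hX₁, -⟩ := exists_split h0 hfit.le pl₁.1
  obtain ⟨u₂, v₂, hX₂, -⟩ := exists_split h0 hfit.le pl₂.1
  have blog : ∀ {x : ℂ}, ‖x‖ ≤ 1 / 4 → ‖Complex.log (1 + x)‖ ≤ 4 / 3 * ‖x‖ := fun hx => by
    simpa using norm_log_one_add_sub_le hx (y := 0) (by simp)
  -- The third entry of `m1` gives a bound 1/2. With the Lipschitz constant 4/3 of log(1 + x) this
  -- is 2/3, the radius on which exp has Lipschitz constant 2.
  have hO2 : ∀ K, K ≤ ‖θ‖ * (μ * r) * Λ → O * (4 / 3 * K) ≤ 2 / 3 := fun K hK => by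
    have := mul_le_mul_of_nonneg_left hK hO
    linarith
  have bP₁ : ∀ p ∈ Dh s, ‖splitPol u₁ v₁ p‖ ≤ 2 / 3 := fun p hp =>
    (norm_splitPol_le_opNorm hP h0 hB hfit pl₁ hX₁ (fun q hq' => (blog (bx₁ q hq')).trans
      (mul_le_mul_of_nonneg_left (bx bS₁ q hq') (by norm_num))) p hp).trans (hO2 _ le_rfl)
  have bP₂ : ∀ p ∈ Dh s, ‖splitPol u₂ v₂ p‖ ≤ 2 / 3 := fun p hp =>
    (norm_splitPol_le_opNorm hP h0 hB hfit pl₂ hX₂ (fun q hq' => (blog (bx₂ q hq')).trans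
      (mul_le_mul_of_nonneg_left (bx bS₂ q hq') (by norm_num))) p hp).trans (hO2 _ le_rfl)
  have bP₃ : ∀ p ∈ Dh s, ‖splitPol u₁ v₁ p - splitPol u₂ v₂ p‖ ≤
      O * (4 / 3 * (‖θ‖ * (μ * κ) * Λ)) := fun p hp => by
    have := norm_splitPol_le_opNorm hP h0 hB hfit (pl₁.sub pl₂) (hX₁.sub hX₂) (fun q hq' =>
      (norm_log_one_add_sub_le (bx₁ q hq') (bx₂ q hq')).trans
        (mul_le_mul_of_nonneg_left (bx₃ q hq') (by norm_num))) p hp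
    convert this using 2
    simp only [splitPol]; ring
  -- the numerators
  obtain ⟨u, v, hL, -⟩ := m.exists_split_log hθε
  have hPL := (((m.pol_log_L hθε).P m.fits hL).mono hb0 hbσ)
  set e := D.hNorm b (D.PlogL θ)
  have bE : ∀ p ∈ Dh s, ‖Complex.exp (splitPol u v p)‖ ≤ Real.exp e := fun p hp =>
    (norm_exp_le _).trans (Real.exp_le_exp.2
      (hPL.norm_le_hNorm hb0 (hR.PlogL b hb0 hb θ hθε).1 (Dh_mono h0 hsb.le hp)))
  obtain ⟨H₁, hH₁, hN₁, hT₁⟩ := m.exists_pol_T_of_small h0 hsσ hθε hS₁ bx₁ (hL.mono h0 hsσ) hX₁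
  obtain ⟨H₂, hH₂, hN₂, hT₂⟩ := m.exists_pol_T_of_small h0 hsσ hθε hS₂ bx₂ (hL.mono h0 hsσ) hX₂
  have has8 : s ≤ 1 / 8 := hfit.le
  have hsub := Dh_mono ha has.le
  have bk : ∀ p ∈ Dh a, ‖(m.k p)⁻¹‖ ≤ D.hNorm a D.defDivV := fun p hp => by
    have := (m.pol_defDivV ha (has.le.trans hsσ)).norm_le_hNorm ha
      (hR.defDivV a ha (by linarith)).1 hp
    rwa [norm_neg] at this
  have bΓ : ∀ p ∈ Dh a, ‖(4 * m.Γ p)⁻¹‖ ≤ D.hNorm a (fun z => (D.gradSq z)⁻¹) / 4 := fun p hp => by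
    have := ((m.pol_gradSq.inv m.Γ_ne_zero).mono ha (has.le.trans hsσ)).norm_le_hNorm ha
      (hR.gradSq_inv a ha (by linarith)).1 hp
    rw [mul_inv, norm_mul, norm_inv, Complex.norm_ofNat]
    linarith
  set α := D.hNorm a D.defDivV
  set β := D.hNorm a fun z => (D.gradSq z)⁻¹
  have hα : 0 ≤ α := hNorm_nonneg _ _
  have hβ : 0 ≤ β := hNorm_nonneg _ _
  have bT : ∀ {H : ℂ × ℂ → ℂ} {K : ℝ}, 0 ≤ K → (∀ p ∈ Dh a, ‖H p‖ ≤ K) →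
      ∀ p ∈ Dh a, ‖-(H p * (m.k p)⁻¹) * (4 * m.Γ p)⁻¹‖ ≤ K * α * (β / 4) := fun hK hH p hp => by
    rw [norm_mul, norm_neg, norm_mul]
    gcongr
    · exact hH p hp
    · exact bk p hp
    · exact bΓ p hp
  have hd : 0 < s - a := sub_pos.2 has
  have memT : ∀ {y : ℂ → ℂ} {E H : ℂ × ℂ → ℂ} {p₁ p₂ : ℂ → ℂ}, (∀ p ∈ Dh s, ‖E p‖ ≤ μ * r) →
      DifferentiableOn ℂ H (Dh s) → (∀ p ∈ Dh s, (1 - p.1 * p.2) * H p = L p + θ * E p -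
        Complex.exp (splitPol u v p) * Complex.exp (splitPol p₁ p₂ p)) →
      (∀ p ∈ Dh s, ‖splitPol p₁ p₂ p‖ ≤ 2 / 3) →
      D.Pol s y (fun p => -(H p * (m.k p)⁻¹) * (4 * m.Γ p)⁻¹) → D.MemH a y := by
    intro y E H p₁ p₂ hE hH hN hp hy
    refine (hy.mono ha has.le).memH (bT ?_ (norm_quotient_le ha has has8 hH hN
      (M := 2 * M + ‖θ‖ * (μ * r) + Real.exp e * Real.exp (2 / 3)) fun p hp' => ?_))
    · positivity
    · refine (norm_sub_le _ _).trans (add_le_add ((norm_add_le _ _).trans (add_le_add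
        (m.norm_lPol_le hθε (Dh_mono h0 hsσ hp')) ?_)) ?_)
      · rw [norm_mul]
        exact mul_le_mul_of_nonneg_left (hE p hp') (norm_nonneg _)
      · rw [norm_mul]
        exact mul_le_mul (bE p hp') ((norm_exp_le _).trans (Real.exp_le_exp.2 (hp p hp')))
          (norm_nonneg _) (Real.exp_pos _).le
  refine ⟨memT bS₁ hH₁ hN₁ bP₁ hT₁, memT bS₂ hH₂ hN₂ bP₂ hT₂, ?_⟩
  -- The product of the Lipschitz constants is 2 · 4/3 = 8/3, rounded up to the stated 6.
  set K := ‖θ‖ * (μ * κ) * (1 + 6 * O * Λ * Real.exp e)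
  have hK : 0 ≤ K := by positivity
  have bN : ∀ p ∈ Dh s, ‖(L p + θ * S₁ p -
      Complex.exp (splitPol u v p) * Complex.exp (splitPol u₁ v₁ p)) - (L p + θ * S₂ p -
      Complex.exp (splitPol u v p) * Complex.exp (splitPol u₂ v₂ p))‖ ≤ K := fun p hp => by
    have e1 : ‖θ * (S₁ p - S₂ p)‖ ≤ ‖θ‖ * (μ * κ) := by
      rw [norm_mul]; exact mul_le_mul_of_nonneg_left (bS₃ p hp) (norm_nonneg _)
    have e2 : ‖Complex.exp (splitPol u v p) *
        (Complex.exp (splitPol u₁ v₁ p) - Complex.exp (splitPol u₂ v₂ p))‖ ≤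
        Real.exp e * (2 * (O * (4 / 3 * (‖θ‖ * (μ * κ) * Λ)))) := by
      rw [norm_mul]
      exact mul_le_mul (bE p hp) ((norm_exp_sub_exp_le (bP₁ p hp) (bP₂ p hp)).trans
        (mul_le_mul_of_nonneg_left (bP₃ p hp) zero_le_two)) (norm_nonneg _) (Real.exp_pos _).le
    have e3 : 0 ≤ Real.exp e * O * ‖θ‖ * (μ * κ) * Λ := by positivity
    calc _ = ‖θ * (S₁ p - S₂ p) - Complex.exp (splitPol u v p) *
        (Complex.exp (splitPol u₁ v₁ p) - Complex.exp (splitPol u₂ v₂ p))‖ := by ring_nf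
      _ ≤ ‖θ‖ * (μ * κ) + Real.exp e * (2 * (O * (4 / 3 * (‖θ‖ * (μ * κ) * Λ)))) :=
        (norm_sub_le _ _).trans (add_le_add e1 e2)
      _ ≤ K := by simp only [K]; linarith
  have bH := norm_quotient_le ha has has8 (hH₁.sub hH₂)
    (fun p hp => by rw [Pi.sub_apply, mul_sub, hN₁ p hp, hN₂ p hp]) bN
  have hTd : D.Pol a (D.T θ f - D.T θ g) fun p =>
      -((H₁ - H₂) p * (m.k p)⁻¹) * (4 * m.Γ p)⁻¹ :=
    ((hT₁.sub hT₂).mono ha has.le).congr_right ha fun p _ => by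
      simp only [Pi.sub_apply]; ring
  refine (hTd.hNorm_le ha (bT (by positivity) bH)).trans (le_of_eq ?_)
  -- The division costs 3/(s - a) = 6/(b - a). With the 4 in the denominator of T this is the 3/2 of
  -- `lipConst`.
  have e1 : s - a = (b - a) / 2 := by rw [hs]; ring
  have hba : b - a ≠ 0 := (sub_pos.2 hab).ne'
  rw [e1]
  simp only [K]
  field_simp
  ring

end Model

/-- The midpoint exceeds a, so the bound B/σ for the Poisson operator gives one factor 1/a and `M0`
the other. Halving the gap in `M0` costs at most 8, whence 12 = 8 · 3/2. -/
theorem IsRange.lipConst_mul_M0_le {σs ε₀ B C₀ a b : ℝ} (hR : D.IsRange σs ε₀ B) (hB : 0 ≤ B)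
    (hε : 0 ≤ ε₀) (hC : 0 ≤ C₀) (hσs : σs ≤ 1) (ha : 0 < a) (hab : a < b) (hb : b ≤ σs)
    (hθ : ‖θ‖ ≤ ε₀) : D.lipConst ε₀ b a θ * M0 C₀ b ((b + a) / 2) θ ≤
      12 * B ^ 2 * (1 + 6 * B ^ 2 * Real.exp B) * C₀ *
        (1 / (a ^ 2 * (b - a) ^ 2) + ‖θ‖ / (a ^ 2 * (b - a) ^ 4)) := by
  have hd : 0 < b - a := sub_pos.2 hab
  set d := b - a
  have hs0 : 0 < (b + a) / 2 := by linarith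
  have hss : (b + a) / 2 ≤ σs := by linarith
  have hsa : a ≤ (b + a) / 2 := by linarith
  have h1 : M0 C₀ b ((b + a) / 2) θ ≤ 8 * C₀ * (1 / (d * a) + ‖θ‖ / (d ^ 3 * a)) := by
    have e : b - (b + a) / 2 = d / 2 := by simp only [d]; ring
    unfold M0
    rw [e]
    calc _ ≤ C₀ * (1 / (d / 2 * a) + ‖θ‖ / ((d / 2) ^ 3 * a)) := by gcongr
      _ = 8 * C₀ * (1 / 4 * (1 / (d * a)) + ‖θ‖ / (d ^ 3 * a)) := by field_simp; ring
      _ ≤ _ := by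
        gcongr
        exact mul_le_of_le_one_left (by positivity) (by norm_num)
  have h2 : D.opNorm ((b + a) / 2) D.P ≤ B / a :=
    (opNorm_le (hR.P_bound _ hs0 hss) hs0 hB).trans (by gcongr)
  have h3 : D.lipConst ε₀ b a θ ≤ 3 * B * B / (2 * d) * ((1 + 6 * B ^ 2 * Real.exp B) / a) := by
    have g1 := (hR.gradSq_inv a ha (hab.le.trans hb)).2
    have g2 := (hR.defDivV a ha (hab.le.trans hb)).2
    have g3 := hR.supInvL_le hs0 hss hε
    have g4 := (hR.PlogL b (ha.trans hab) hb θ hθ).2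
    have n1 := hNorm_nonneg (D := D) a D.defDivV
    have n2 := hNorm_nonneg (D := D) a fun z => (D.gradSq z)⁻¹
    have n3 := supInvL_nonneg (D := D) ε₀ ((b + a) / 2)
    have n4 := opNorm_nonneg (D := D) ((b + a) / 2) D.P
    unfold lipConst
    calc _ ≤ 3 * B * B / (2 * d) * (1 + 6 * (B / a) * B * Real.exp B) := by gcongr
      _ ≤ 3 * B * B / (2 * d) * (1 / a + 6 * (B / a) * B * Real.exp B) := by
        gcongr
        exact (one_le_div₀ ha).2 (by linarith)
      _ = _ := by ring
  have h4 : 0 ≤ M0 C₀ b ((b + a) / 2) θ := M0_nonneg hC hs0 (by linarith) θ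
  calc _ ≤ 3 * B * B / (2 * d) * ((1 + 6 * B ^ 2 * Real.exp B) / a) *
        (8 * C₀ * (1 / (d * a) + ‖θ‖ / (d ^ 3 * a))) :=
        mul_le_mul h3 h1 h4 (by positivity)
    _ = _ := by field_simp; ring

end ExteriorData

end PlanarOP

end

theorem theorem8p5 (D : PlanarOP.ExteriorData) :
    ∃ σs ε₀ B : ℝ, 0 < σs ∧ σs < 1 ∧ 0 < ε₀ ∧ D.IsRange σs ε₀ B ∧
      (∃ C₀ : ℝ, D.IsSBound σs C₀) ∧
      ∀ C₀ : ℝ, D.IsSBound σs C₀ →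
        ∃ C₁ : ℝ, 0 < C₁ ∧
          ∀ σ σ' : ℝ, 0 < σ' → σ' < σ → σ ≤ σs →
          ∀ θ : ℂ, ‖θ‖ ≤ (D.m1 σs ε₀ C₀ σ ((σ + σ') / 2) θ)⁻¹ →
            (∀ f g : ℂ → ℂ, D.InBall σ (D.r0 σs ε₀) f → D.InBall σ (D.r0 σs ε₀) g →
              D.MemH σ' (D.T θ f) ∧ D.MemH σ' (D.T θ g) ∧
              D.hNorm σ' (D.T θ f - D.T θ g) ≤
                D.lipConst ε₀ σ σ' θ * PlanarOP.M0 C₀ σ ((σ + σ') / 2) θ * ‖θ‖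
                  * D.hNorm σ (f - g)) ∧
            D.lipConst ε₀ σ σ' θ * PlanarOP.M0 C₀ σ ((σ + σ') / 2) θ ≤
              C₁ * (1 / (σ' ^ 2 * (σ - σ') ^ 2) + ‖θ‖ / (σ' ^ 2 * (σ - σ') ^ 4)) := by
  obtain ⟨σ₁, M, ⟨m⟩⟩ := D.exists_model
  obtain ⟨B, hB1, hR⟩ := m.exists_isRange
  have hM := m.M_pos
  have hσ₁ := m.fits.pos
  have hσ₁8 := m.fits.le
  have hB : 0 < B := zero_lt_one.trans_le hB1
  -- The parameter σ₁/2 leaves a collar inside the model domain, needed for T[0] at the endpoint and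
  -- for the closed annulus.
  refine ⟨σ₁ / 2, (2 * M ^ 2)⁻¹, B, half_pos hσ₁, by linarith, by positivity, hR,
    ⟨_, m.isSBound (half_le_self hσ₁.le)⟩, fun C₀ hS => ?_⟩
  have hC := hS.1
  refine ⟨12 * B ^ 2 * (1 + 6 * B ^ 2 * Real.exp B) * C₀, by positivity,
    fun σ σ' h0 h1 h2 θ hθ => ⟨fun f g hf hg => m.T_sub_le hR hB.le hS h0 h1 h2 hθ hf hg, ?_⟩⟩
  exact hR.lipConst_mul_M0_le hB.le (by positivity) hC.le (by linarith) h0 h1 h2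
    (PlanarOP.ExteriorData.m1_bounds (by positivity) hθ).1
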